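/- **Setting.** Let $N\ge 1$, $T>0$, $I=(0,T)$, and let $\Omega\subset\mathbb{R}^{3N}$ be a bounded domain with smooth boundary. Put $H=L_2(\Omega;\mathbb{C})$, $V=H^1_0(\Omega;\mathbb{C})$, let $V'$ be the space of continuous antilinear functionals on $V$ (with $H\hookrightarrow V'$ through $(\cdot,\cdot)_H$, which is linear in the first argument), and $\mathbb{U}=L_2(I;H)$. Let $\mathcal{V}:I\times\Omega\to\mathbb{R}$ be a measurable real-valued potential, let $\mathcal{V}(t)$ denote multiplication by $\mathcal{V}(t,\cdot)$ (which is hermitian on $H$, as $\mathcal V$ is real-valued), and assume that there are constants $C_{\mathcal V}<\infty$ and $\alpha_{\mathcal V}>0$ with $\|\mathcal{V}(t)\phi\|_H\le C_{\mathcal V}\|\phi\|_H$ and $(\mathcal{V}(t)\phi,\phi)_H\ge\alpha_{\mathcal V}\|\phi\|_H^2$ for all $t\in I$, $\phi\in H$, and that $t\mapsto(\mathcal{V}(t)\phi,\psi)_H$ is differentiable on $I$ for all $\phi,\psi\in H$. Let $u_0\in V$ and $$a_t(\phi,\psi)=\tfrac12(\nabla\phi,\nabla\psi)_{L_2(\Omega)}+(\mathcal{V}(t)\phi,\psi)_H,\qquad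 \phi,\psi\in V.$$ A *weak solution* of the homogeneous Schrödinger equation $\mathrm{i}\partial_t u+\frac12\Delta u-\mathcal{V}u=0$ is a function $u\in L_2(I;V)\cap H^1(I;V')\hookrightarrow C(\overline I;H)$ with $u(0)=u_0$ such that, for all $(v_1,v_2)\in L_2(I;V)\times V'$, $$\int_0^T\big\{\mathrm{i}\langle\partial_t u(t),v_1(t)\rangle_{V'\times V}-a_t(u(t),v_1(t))\big\}\,dt+\mathrm{i}\langle u(0),v_2\rangle_{V\times V'}=\mathrm{i}\langle u_0,v_2\rangle_{V\times V'}.$$ Let $D$ be the linear span of the functions $(t,x)\mapsto\theta(t)\varphi(x)$, where $\theta\in C^1(I)\cap C(\overline I)$, $\theta'\in L_2(I)$, $\theta(T)=0$, and $\varphi\in C^2(\Omega)\cap C(\overline\Omega)$, $\Delta\varphi\in L_2(\Omega)$, $\varphi=0$ on $\partial\Omega$ (all functions complex-valued). On $D$ let $S^*v=\mathrm{i}\partial_t v+\frac12\Delta v-\mathcal{V}v\in\mathbb{U}$, and let $S^*:\mathbb{V}\to\mathbb{U}$ be the closure of this operator in $\mathbb{U}$: $v\in\mathbb{V}$ and $S^*v=w$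 if and only if there are $v_n\in D$ with $v_n\to v$ and $S^*v_n\to w$ in $\mathbb{U}$. An *ultra-weak solution* is a function $u\in\mathbb{U}$ such that every $v\in\mathbb{V}$ has a representative in $C(\overline I;H)$ and, $v(0)$ being its value at $t=0$, $$(u,S^*v)_{\mathbb{U}}=\mathrm{i}\,(u_0,v(0))_H\qquad\text{for all }v\in\mathbb{V}.$$ **Proposition.** Let $u^*\in L_2(I;V)\cap H^1(I;V')$ be a weak solution. Then $u^*$, regarded as an element of $\mathbb{U}$, is an ultra-weak solution, and it is the only ultra-weak solution in $\mathbb{U}$. -/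

import Mathlib

open MeasureTheory Set
open scoped ContDiff InnerProductSpace

noncomputable section

namespace Schroedinger

/-- The space `ℝ^d` with its Euclidean norm. -/
abbrev Space (d : ℕ) : Type := EuclideanSpace ℝ (Fin d)

/-- The boundary of `Ω` is smooth: near each of its points, `Ω` is the sublevel set
`{ρ < 0}` of a smooth function `ρ` whose differential does not vanish. -/
def HasSmoothBoundary {d : ℕ} (Ω : Set (Space d)) : Prop :=
  ∀ p ∈ frontier Ω, ∃ (W : Set (Space d)) (ρ : Space d → ℝ), IsOpen W ∧ p ∈ W ∧
    ContDiffOn ℝ ∞ ρ W ∧ (∀ x ∈ W, fderiv ℝ ρ x ≠ 0) ∧ Ω ∩ W = {x ∈ W | ρ x < 0}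

/-- A bounded domain (nonempty, open, connected) with smooth boundary. -/
structure IsSmoothBoundedDomain {d : ℕ} (Ω : Set (Space d)) : Prop where
  isOpen : IsOpen Ω
  isConnected : IsConnected Ω
  isBounded : Bornology.IsBounded Ω
  smoothBoundary : HasSmoothBoundary Ω

/-- `H = L₂(Ω; ℂ)`. -/
abbrev StateSpace {d : ℕ} (Ω : Set (Space d)) : Type := Lp ℂ 2 (volume.restrict Ω)

/-- `L₂(Ω; ℂ^d)`, the space of square integrable vector fields. -/
abbrev FieldSpace {d : ℕ} (Ω : Set (Space d)) : Type :=
  Lp (EuclideanSpace ℂ (Fin d)) 2 (volume.restrict Ω)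

/-- The classical gradient `(∂₁φ, …, ∂_dφ)` of a complex valued function. -/
def grad {d : ℕ} (φ : Space d → ℂ) (x : Space d) : EuclideanSpace ℂ (Fin d) :=
  WithLp.toLp 2 fun i => fderiv ℝ φ x (EuclideanSpace.single i 1)

/-- `H¹₀(Ω; ℂ)`, realized as the closure of the pairs `(φ, ∇φ)`, with `φ` a smooth function
with compact support in `Ω`, in the Hilbert space `L₂(Ω; ℂ) × L₂(Ω; ℂ^d)`. The inner product
that it inherits is the usual one of `H¹`, namely `(φ, ψ)_{L₂} + (∇φ, ∇ψ)_{L₂}`.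
(The set of these pairs already is a subspace, `span` only bundles it.) -/
def H10 {d : ℕ} (Ω : Set (Space d)) : Submodule ℂ (WithLp 2 (StateSpace Ω × FieldSpace Ω)) :=
  (Submodule.span ℂ {p : WithLp 2 (StateSpace Ω × FieldSpace Ω) |
    ∃ φ : Space d → ℂ, ContDiff ℝ ∞ φ ∧ HasCompactSupport φ ∧ tsupport φ ⊆ Ω ∧
      p.fst =ᵐ[volume.restrict Ω] φ ∧ p.snd =ᵐ[volume.restrict Ω] grad φ}).topologicalClosure

/-- `V = H¹₀(Ω; ℂ)` as a Hilbert space. -/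
abbrev VSpace {d : ℕ} (Ω : Set (Space d)) : Type := ↥(H10 Ω)

/-- The embedding `V ↪ H`. -/
def toH {d : ℕ} {Ω : Set (Space d)} : VSpace Ω →L[ℂ] StateSpace Ω :=
  (WithLp.fstL 2 ℂ (StateSpace Ω) (FieldSpace Ω)).comp (H10 Ω).subtypeL

/-- The weak gradient of an element of `V`. -/
def weakGrad {d : ℕ} {Ω : Set (Space d)} : VSpace Ω →L[ℂ] FieldSpace Ω :=
  (WithLp.sndL 2 ℂ (StateSpace Ω) (FieldSpace Ω)).comp (H10 Ω).subtypeL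

/-- `V' = H⁻¹(Ω; ℂ)`, the space of continuous antilinear functionals on `V`; the pairing
`⟨f, v⟩` of `V'` and `V` is `f v`. -/
abbrev VDual {d : ℕ} (Ω : Set (Space d)) : Type := VSpace Ω →L⋆[ℂ] ℂ

/-- The embedding `H ↪ V'`, `⟨h, v⟩ = (h, v)_H`. Here and below, the inner product `(h, k)_H`
(linear in `h` and antilinear in `k`) is written `inner ℂ k h`. -/
def toDual {d : ℕ} {Ω : Set (Space d)} (h : StateSpace Ω) : VDual Ω :=
  (innerSLFlip ℂ h).comp toH

/-- Lebesgue measure on the time interval `I = (0, T)`. -/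
abbrev timeMeasure (T : ℝ) : Measure ℝ := volume.restrict (Ioo 0 T)

/-- `𝕌 = L₂(I; H)`. -/
abbrev USpace (T : ℝ) {d : ℕ} (Ω : Set (Space d)) : Type := Lp (StateSpace Ω) 2 (timeMeasure T)

/-- A function `f` on `I × Ω` is a representative of `v ∈ L₂(I; H)`. -/
def Represents {T : ℝ} {d : ℕ} {Ω : Set (Space d)} (v : USpace T Ω) (f : ℝ → Space d → ℂ) :
    Prop :=
  ∀ᵐ t ∂timeMeasure T, v t =ᵐ[volume.restrict Ω] f t

/-- `v ∈ L₂(I; H)` has a representative in `C([0, T]; H)`, whose value at `t = 0` is `h`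
(in short: `v(0) = h`). -/
def HasInitialValue {T : ℝ} {d : ℕ} {Ω : Set (Space d)} (v : USpace T Ω) (h : StateSpace Ω) : Prop :=
  ∃ w : ℝ → StateSpace Ω, ContinuousOn w (Icc 0 T) ∧ v =ᵐ[timeMeasure T] w ∧ w 0 = h

/-- The assumptions on the real valued potential `𝒱`: the multiplication operators
`𝒱(t) : H → H` are uniformly bounded, uniformly positive and differentiable in `t` (in the weak
sense). That they are hermitian holds because `𝒱` is real valued. -/
structure IsAdmissiblePotential (T : ℝ) {d : ℕ} (Ω : Set (Space d)) (𝒱 : ℝ → Space d → ℝ) :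
    Prop where
  measurable : AEStronglyMeasurable (Function.uncurry 𝒱)
    ((timeMeasure T).prod (volume.restrict Ω))
  measurable_slice : ∀ t ∈ Ioo 0 T, AEStronglyMeasurable (𝒱 t) (volume.restrict Ω)
  bounded : ∃ C : ℝ, ∀ t ∈ Ioo 0 T, ∀ φ : StateSpace Ω,
    eLpNorm (fun x => (𝒱 t x : ℂ) * φ x) 2 (volume.restrict Ω) ≤
      ENNReal.ofReal C * eLpNorm φ 2 (volume.restrict Ω)
  positive : ∃ α : ℝ, 0 < α ∧ ∀ t ∈ Ioo 0 T, ∀ φ : StateSpace Ω,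
    α * ‖φ‖ ^ 2 ≤ ∫ x in Ω, 𝒱 t x * ‖φ x‖ ^ 2
  differentiable : ∀ φ ψ : StateSpace Ω,
    DifferentiableOn ℝ (fun t => ∫ x in Ω, (𝒱 t x : ℂ) * φ x * star (ψ x)) (Ioo 0 T)

/-- The form `a_t(φ, ψ) = ½ (∇φ, ∇ψ)_H + (𝒱(t) φ, ψ)_H` on `V`. -/
def energyForm {d : ℕ} {Ω : Set (Space d)} (𝒱 : ℝ → Space d → ℝ) (t : ℝ) (φ ψ : VSpace Ω) : ℂ :=
  (1 / 2 : ℂ) * inner ℂ (weakGrad ψ) (weakGrad φ) +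
    ∫ x in Ω, (𝒱 t x : ℂ) * toH φ x * star (toH ψ x)

/-- `w ∈ L₂(I; V')` is the weak time derivative of `u ∈ L₂(I; V)`, so that
`u ∈ L₂(I; V) ∩ H¹(I; V')`. -/
def IsWeakTimeDeriv {T : ℝ} {d : ℕ} {Ω : Set (Space d)} (u : Lp (VSpace Ω) 2 (timeMeasure T))
    (w : Lp (VDual Ω) 2 (timeMeasure T)) : Prop :=
  ∀ θ : ℝ → ℝ, ContDiff ℝ ∞ θ → HasCompactSupport θ → tsupport θ ⊆ Ioo 0 T →
    ∫ t in Ioo 0 T, ((deriv θ t : ℝ) : ℂ) • toDual (toH (u t)) =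
      -∫ t in Ioo 0 T, ((θ t : ℝ) : ℂ) • w t

/-- `u ∈ L₂(I; V) ∩ H¹(I; V')` is a weak solution of the homogeneous Schrödinger equation with
initial value `u₀ ∈ V`: `u(0) = u₀` in `H` and, for all `v₁ ∈ L₂(I; V)` and `v₂ ∈ V'`,
`∫ (i ⟨∂ₜu, v₁⟩ - a_t(u, v₁)) dt + i ⟨u(0), v₂⟩ = i ⟨u₀, v₂⟩`. The element `z` of `V`
is `u(0)`, and the pairing `⟨z, f⟩` of `V` and `V'` is the conjugate of `⟨f, z⟩`. -/
def IsWeakSolution {T : ℝ} {d : ℕ} {Ω : Set (Space d)} (𝒱 : ℝ → Space d → ℝ) (u₀ : VSpace Ω)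
    (u : Lp (VSpace Ω) 2 (timeMeasure T)) : Prop :=
  ∃ (w : Lp (VDual Ω) 2 (timeMeasure T)) (z : VSpace Ω),
    IsWeakTimeDeriv u w ∧ HasInitialValue (toH.compLp u) (toH z) ∧ toH z = toH u₀ ∧
    ∀ (v₁ : Lp (VSpace Ω) 2 (timeMeasure T)) (v₂ : VDual Ω),
      (∫ t in Ioo 0 T, (Complex.I * w t (v₁ t) - energyForm 𝒱 t (u t) (v₁ t))) +
        Complex.I * star (v₂ z) = Complex.I * star (v₂ u₀)

/-- The functions `θ ∈ C¹(I) ∩ C([0, T])` with `θ(T) = 0`; the derivative has to be square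
integrable for the Schrödinger operator to map into `L₂(I; H)`. -/
structure IsTimeFactor (T : ℝ) (θ : ℝ → ℂ) : Prop where
  contDiffOn : ContDiffOn ℝ 1 θ (Ioo 0 T)
  continuousOn : ContinuousOn θ (Icc 0 T)
  terminal : θ T = 0
  memLp_deriv : MemLp (deriv θ) 2 (timeMeasure T)

/-- The functions `φ ∈ C²(Ω) ∩ C(closure Ω)` that vanish on the boundary; the Laplacian has to
be square integrable for the Schrödinger operator to map into `L₂(I; H)`. -/
structure IsSpaceFactor {d : ℕ} (Ω : Set (Space d)) (φ : Space d → ℂ) : Prop where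
  contDiffOn : ContDiffOn ℝ 2 φ Ω
  continuousOn : ContinuousOn φ (closure Ω)
  boundary : ∀ x ∈ frontier Ω, φ x = 0
  memLp_laplacian : MemLp (Laplacian.laplacian φ) 2 (volume.restrict Ω)

/-- The classical domain of the adjoint Schrödinger operator, the algebraic tensor product
`[C¹(I) ∩ C_{T}([0, T])] ⊗ [C²(Ω) ∩ C₀(closure Ω)]`. -/
def classicalDomain (T : ℝ) {d : ℕ} (Ω : Set (Space d)) : Submodule ℂ (ℝ → Space d → ℂ) :=
  Submodule.span ℂ {v | ∃ (θ : ℝ → ℂ) (φ : Space d → ℂ), IsTimeFactor T θ ∧ IsSpaceFactor Ω φ ∧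
    v = fun t x => θ t * φ x}

/-- The (formally self-adjoint) Schrödinger operator `i ∂ₜv + ½ Δv - 𝒱 v` in the classical,
pointwise sense. -/
def classicalOp {d : ℕ} (𝒱 : ℝ → Space d → ℝ) (v : ℝ → Space d → ℂ) (t : ℝ) (x : Space d) : ℂ :=
  Complex.I * deriv (fun s => v s x) t + (1 / 2 : ℂ) * Laplacian.laplacian (v t) x
    - (𝒱 t x : ℂ) * v t x

/-- The graph of the adjoint Schrödinger operator `S*` on its domain `𝕍`: the pair
`(v, w) ∈ 𝕌 × 𝕌` belongs to it iff `v ∈ 𝕍` and `w = S* v`. Here `𝕍` consists of the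
limits `v` of functions `vₙ` in the classical domain for which `S* vₙ` converges in `𝕌` (that is,
`vₙ` converges in the norm `‖v‖_𝕍 = ‖S* v‖_𝕌`), and `S* v = lim S* vₙ`. -/
def adjointGraph (T : ℝ) {d : ℕ} (Ω : Set (Space d)) (𝒱 : ℝ → Space d → ℝ) :
    Set (USpace T Ω × USpace T Ω) :=
  closure {p | ∃ f ∈ classicalDomain T Ω, Represents p.1 f ∧ Represents p.2 (classicalOp 𝒱 f)}

/-- `u ∈ 𝕌` is an ultra-weak solution of the homogeneous Schrödinger equation with initial value
`u₀`: every `v ∈ 𝕍` has an initial value `v(0) ∈ H`, and `(u, S* v)_𝕌 = i (u₀, v(0))_H`. -/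
def IsUltraWeakSolution {T : ℝ} {d : ℕ} {Ω : Set (Space d)} (𝒱 : ℝ → Space d → ℝ)
    (u₀ : VSpace Ω) (u : USpace T Ω) : Prop :=
  ∀ v w : USpace T Ω, (v, w) ∈ adjointGraph T Ω 𝒱 →
    ∃ v₀ : StateSpace Ω, HasInitialValue v v₀ ∧ inner ℂ w u = Complex.I * inner ℂ v₀ (toH u₀)

end Schroedinger

end

noncomputable section

namespace Schroedinger

/-! ### Calculus of vector-valued absolutely continuous functions on an interval. -/

section TimeCalculus

variable {E F G : Type*} [NormedAddCommGroup E] [NormedSpace ℝ E] [NormedAddCommGroup F]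
  [NormedSpace ℝ F] [NormedAddCommGroup G] [NormedSpace ℝ G]

/-! Existence. On the classical domain the ultra-weak identity is the weak formulation with `v₁ =
v`, after integration by parts in time, where v(T) = 0 removes the end term, and Green's formula in
space. Two points need work. A space factor is only C² inside Ω and continuous up to the boundary,
so its membership in H¹₀ and Green's formula are obtained by truncating small values
(`exists_vSpace_of_real`, `exists_vSpace_of_spaceFactor`). And the identity has to survive the
closure: as Δ and the potential are symmetric, Re ⟪v, v'⟫ = Im ⟪v, S*v⟫, which bounds sup ‖v(t)‖ by
a multiple of ∫ ‖S*v‖ (`IsClassicalRep.norm_toH_le`), so initial values pass to limits.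

Uniqueness. The difference z of two ultra-weak solutions is orthogonal to S*(D), but it is too rough
to be tested with itself. Let J embed V into H and let B = J J*, that is, (1 - Δ)⁻¹. For a space
factor φ and ψ = φ - Δφ one has φ = Bψ and Δφ = Bψ - ψ, so orthogonality to S*(θφ) involves bounded
operators only. It says that Bz is absolutely continuous, starts at 0 and has derivative -i(½(z -
Bz) + B𝒱z). The operator K_n = 1 - (1 - B)^(2n) is a polynomial in B divisible by B, so K_n z is
absolutely continuous too. In its energy identity the kinetic term is real and drops out, leaving
‖K_n z(t)‖² = 2 ∫ Im ⟪K_n z, K_n 𝒱z⟫. Since K_n → 1 strongly, ‖z(t)‖² = 2 ∫ Im ⟪z, 𝒱z⟫ = 0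
(`eq_zero_of_weak_evolution`). No commutator of B and 𝒱 has to be estimated.

This requires the functions φ - Δφ to be total in H (`eq_zero_of_inner_sub_laplacian`). A duality
argument reduces it to totality of the Δφ (`eq_zero_of_inner_laplacian`), and for that it suffices
to solve Δφ = Δp classically with zero boundary values for exponentials p: orthogonality then kills
the Fourier transform of z away from the origin. The classical solution
(`exists_spaceFactor_laplacian_eq`) is the weak one, smooth inside by Weyl's lemma and continuous up
to the boundary by the maximum principle with barriers. The barriers come from exterior balls, the
only place where smoothness of the boundary enters. -/

theorem integrable_bilin_prod {α β : Type*} [MeasurableSpace α] [MeasurableSpace β]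
    {μ : Measure α} {ν : Measure β} [SFinite ν] [SFinite μ] (L : E →L[ℝ] F →L[ℝ] G)
    {f : α → E} {g : β → F} (hf : Integrable f μ) (hg : Integrable g ν) :
    Integrable (fun p : α × β => L (f p.1) (g p.2)) (μ.prod ν) := by
  refine Integrable.mono' ((hf.norm.mul_prod hg.norm).const_mul ‖L‖)
    (L.aestronglyMeasurable_comp₂ hf.aestronglyMeasurable.comp_fst
      hg.aestronglyMeasurable.comp_snd) (Filter.Eventually.of_forall fun p => ?_)
  simpa [mul_assoc] using L.le_opNorm₂ (f p.1) (g p.2)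

theorem integrable_bilin_of_bounded {α : Type*} [MeasurableSpace α] {μ : Measure α}
    (L : E →L[ℝ] F →L[ℝ] G) {f : α → E} {g : α → F} {C : ℝ} (hf : Integrable f μ)
    (hg : AEStronglyMeasurable g μ) (hC : ∀ᵐ t ∂μ, ‖g t‖ ≤ C) :
    Integrable (fun t => L (f t) (g t)) μ := by
  refine Integrable.mono' (hf.norm.const_mul (‖L‖ * C))
    (L.aestronglyMeasurable_comp₂ hf.aestronglyMeasurable hg) ?_
  filter_upwards [hC] with t ht
  calc ‖L (f t) (g t)‖ ≤ ‖L‖ * ‖f t‖ * ‖g t‖ := L.le_opNorm₂ _ _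
    _ ≤ ‖L‖ * ‖f t‖ * C := by gcongr
    _ = _ := by ring

theorem continuousOn_primitive_Ioo {T : ℝ} {f : ℝ → E}
    (hf : IntegrableOn f (Ioo 0 T)) : ContinuousOn (fun t => ∫ s in Ioo 0 t, f s) (Icc 0 T) := by
  have h := intervalIntegral.continuousOn_primitive
    ((integrableOn_Icc_iff_integrableOn_Ioo (f := f) (a := 0) (b := T) (μ := volume)).2 hf)
  refine h.congr fun t _ => ?_
  exact integral_Ioc_eq_integral_Ioo.symm

theorem norm_primitive_le {T t : ℝ} {f : ℝ → E} (ht : t ≤ T) (hf : IntegrableOn f (Ioo 0 T)) :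
    ‖∫ s in Ioo 0 t, f s‖ ≤ ∫ s in Ioo 0 T, ‖f s‖ :=
  (norm_integral_le_integral_norm _).trans <|
    setIntegral_mono_set hf.norm (Filter.Eventually.of_forall fun _ => norm_nonneg _)
      (Filter.Eventually.of_forall (Ioo_subset_Ioo_right ht))

theorem aestronglyMeasurable_primitive {T : ℝ} {f : ℝ → E} (hf : IntegrableOn f (Ioo 0 T)) :
    AEStronglyMeasurable (fun t => ∫ s in Ioo 0 t, f s) (timeMeasure T) :=
  ((continuousOn_primitive_Ioo hf).mono Ioo_subset_Icc_self).aestronglyMeasurable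
    measurableSet_Ioo

theorem setIntegral_Ioo_eq_interval {t : ℝ} (ht : 0 ≤ t) (f : ℝ → E) :
    ∫ s in Ioo 0 t, f s = ∫ s in (0 : ℝ)..t, f s := by
  rw [intervalIntegral.integral_of_le ht, integral_Ioc_eq_integral_Ioo]

theorem setIntegral_test_smul {T : ℝ} {θ : ℝ → ℝ} (h : tsupport θ ⊆ Ioo 0 T) (g : ℝ → E) :
    ∫ t in Ioo 0 T, θ t • g t = ∫ t, θ t • g t :=
  setIntegral_eq_integral_of_forall_compl_eq_zero fun t ht => by
    rw [image_eq_zero_of_notMem_tsupport fun h' => ht (h h'), zero_smul]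

variable [CompleteSpace E] [CompleteSpace F] [CompleteSpace G]

/-- By Fubini the left side is an integral over the square (0,T)². The diagonal cuts the square into
two triangles, and each triangle contributes one term on the right. -/
theorem bilin_primitive (L : E →L[ℝ] F →L[ℝ] G) {T : ℝ} {f : ℝ → E} {g : ℝ → F}
    (hf : IntegrableOn f (Ioo 0 T)) (hg : IntegrableOn g (Ioo 0 T)) :
    L (∫ t in Ioo 0 T, f t) (∫ t in Ioo 0 T, g t) =
      (∫ t in Ioo 0 T, L (f t) (∫ s in Ioo 0 t, g s)) +
        ∫ t in Ioo 0 T, L (∫ s in Ioo 0 t, f s) (g t) := by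
  set μ := timeMeasure T
  have hfm : Integrable f μ := hf
  have hgm : Integrable g μ := hg
  have hint := integrable_bilin_prod L hfm hgm
  have hS : MeasurableSet {p : ℝ × ℝ | p.2 < p.1} := measurableSet_lt measurable_snd measurable_fst
  have h1 : L (∫ t, f t ∂μ) (∫ t, g t ∂μ) = ∫ p, L (f p.1) (g p.2) ∂(μ.prod μ) := by
    rw [integral_prod _ hint]
    calc L (∫ t, f t ∂μ) (∫ t, g t ∂μ) = ∫ t, L.flip (∫ t, g t ∂μ) (f t) ∂μ :=
          ((L.flip (∫ t, g t ∂μ)).integral_comp_comm hfm).symm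
      _ = _ := by
          refine integral_congr_ae (Filter.Eventually.of_forall fun t => ?_)
          exact ((L (f t)).integral_comp_comm hgm).symm
  rw [h1, ← integral_add_compl hS hint]
  congr 1
  · rw [← integral_indicator hS, integral_prod _ (hint.indicator hS)]
    refine setIntegral_congr_fun measurableSet_Ioo fun t ht => ?_
    have : ∀ s, {p : ℝ × ℝ | p.2 < p.1}.indicator (fun p => L (f p.1) (g p.2)) (t, s) =
        (Iio t).indicator (fun s => L (f t) (g s)) s := fun s => by
      by_cases h : s < t <;> simp [indicator, h]
    simp only [this]
    rw [integral_indicator measurableSet_Iio, Measure.restrict_restrict measurableSet_Iio]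
    have e : Iio t ∩ Ioo 0 T = Ioo 0 t := by
      ext s; simp only [mem_inter_iff, mem_Iio, mem_Ioo] at *; constructor
      · rintro ⟨a, b, c⟩; exact ⟨b, a⟩
      · rintro ⟨a, b⟩; exact ⟨b, a, b.trans ht.2⟩
    rw [e]
    exact (L (f t)).integral_comp_comm (hg.mono_set (Ioo_subset_Ioo_right ht.2.le))
  · rw [← integral_indicator hS.compl, integral_prod_symm _ (hint.indicator hS.compl)]
    refine setIntegral_congr_fun measurableSet_Ioo fun t ht => ?_
    have : ∀ s, ({p : ℝ × ℝ | p.2 < p.1}ᶜ).indicator (fun p => L (f p.1) (g p.2)) (s, t) =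
        (Iic t).indicator (fun s => L.flip (g t) (f s)) s := fun s => by
      by_cases h : s ≤ t
      · simp [indicator, h]
      · simp [indicator, h, not_le.1 h]
    simp only [this]
    rw [integral_indicator measurableSet_Iic, Measure.restrict_restrict measurableSet_Iic]
    have e : Iic t ∩ Ioo 0 T = Ioc 0 t := by
      ext s; simp only [mem_inter_iff, mem_Iic, mem_Ioo, mem_Ioc] at *; constructor
      · rintro ⟨a, b, c⟩; exact ⟨b, a⟩
      · rintro ⟨a, b⟩; exact ⟨b, a, b.trans_lt ht.2⟩
    rw [e, integral_Ioc_eq_integral_Ioo]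
    exact (L.flip (g t)).integral_comp_comm (hf.mono_set (Ioo_subset_Ioo_right ht.2.le))

/-- Integration by parts for absolutely continuous vector valued functions. -/
theorem bilin_integral_by_parts (L : E →L[ℝ] F →L[ℝ] G) {T : ℝ} {f u : ℝ → E} {g v : ℝ → F}
    {a : E} {b : F} (hf : IntegrableOn f (Ioo 0 T)) (hg : IntegrableOn g (Ioo 0 T))
    (hu : ∀ᵐ t ∂timeMeasure T, u t = a + ∫ s in Ioo 0 t, f s)
    (hv : ∀ᵐ t ∂timeMeasure T, v t = b + ∫ s in Ioo 0 t, g s) :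
    Integrable (fun t => L (f t) (v t)) (timeMeasure T) ∧
    Integrable (fun t => L (u t) (g t)) (timeMeasure T) ∧
    (∫ t in Ioo 0 T, L (f t) (v t)) + ∫ t in Ioo 0 T, L (u t) (g t) =
      L (a + ∫ t in Ioo 0 T, f t) (b + ∫ t in Ioo 0 T, g t) - L a b := by
  have i1 : Integrable (fun t => L (f t) (∫ s in Ioo 0 t, g s)) (timeMeasure T) :=
    integrable_bilin_of_bounded L hf (aestronglyMeasurable_primitive hg)
      ((ae_restrict_mem measurableSet_Ioo).mono fun t ht => norm_primitive_le ht.2.le hg)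
  have i2 : Integrable (fun t => L (∫ s in Ioo 0 t, f s) (g t)) (timeMeasure T) :=
    integrable_bilin_of_bounded L.flip hg (aestronglyMeasurable_primitive hf)
      ((ae_restrict_mem measurableSet_Ioo).mono fun t ht => norm_primitive_le ht.2.le hf)
  have i3 : Integrable (fun t => L (f t) b) (timeMeasure T) := (L.flip b).integrable_comp hf
  have i4 : Integrable (fun t => L a (g t)) (timeMeasure T) := (L a).integrable_comp hg
  have e1 : (fun t => L (f t) (v t)) =ᵐ[timeMeasure T]
      fun t => L (f t) b + L (f t) (∫ s in Ioo 0 t, g s) := by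
    filter_upwards [hv] with t ht; rw [ht, map_add]
  have e2 : (fun t => L (u t) (g t)) =ᵐ[timeMeasure T]
      fun t => L a (g t) + L (∫ s in Ioo 0 t, f s) (g t) := by
    filter_upwards [hu] with t ht; rw [ht, map_add, add_apply]
  refine ⟨(i3.add i1).congr e1.symm, (i4.add i2).congr e2.symm, ?_⟩
  rw [integral_congr_ae e1, integral_congr_ae e2, integral_add i3 i1, integral_add i4 i2]
  have h3 : ∫ t in Ioo 0 T, L (f t) b = L (∫ t in Ioo 0 T, f t) b :=
    (L.flip b).integral_comp_comm hf
  have h4 : ∫ t in Ioo 0 T, L a (g t) = L a (∫ t in Ioo 0 T, g t) := (L a).integral_comp_comm hg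
  rw [h3, h4]
  simp only [map_add, add_apply, bilin_primitive L hf hg]
  abel

theorem exists_Icc_of_compact_subset_Ioo {T : ℝ} (hT : 0 < T) {K : Set ℝ} (hK : IsCompact K)
    (hKT : K ⊆ Ioo 0 T) : ∃ a b, 0 < a ∧ b < T ∧ K ⊆ Icc a b := by
  rcases K.eq_empty_or_nonempty with rfl | hne
  · exact ⟨T / 2, T / 2, by linarith, by linarith, empty_subset _⟩
  · exact ⟨sInf K, sSup K, (hKT (hK.sInf_mem hne)).1, (hKT (hK.sSup_mem hne)).2,
      fun x hx => ⟨csInf_le hK.bddBelow hx, le_csSup hK.bddAbove hx⟩⟩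

theorem ae_eq_zero_of_integral_test {T : ℝ} {g : ℝ → E} (hg : IntegrableOn g (Ioo 0 T))
    (h : ∀ θ : ℝ → ℝ, ContDiff ℝ ∞ θ → HasCompactSupport θ → tsupport θ ⊆ Ioo 0 T →
      ∫ t in Ioo 0 T, θ t • g t = 0) : ∀ᵐ t ∂timeMeasure T, g t = 0 := by
  rw [ae_restrict_iff' measurableSet_Ioo]
  refine isOpen_Ioo.ae_eq_zero_of_integral_contDiff_smul_eq_zero hg.locallyIntegrableOn
    fun θ h1 h2 h3 => ?_
  rw [← setIntegral_test_smul h3]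
  exact h θ h1 h2 h3

theorem integrableOn_test {T : ℝ} {θ : ℝ → ℝ} (h : Continuous θ) : IntegrableOn θ (Ioo 0 T) :=
  (h.integrableOn_Icc (a := 0) (b := T)).mono_set Ioo_subset_Icc_self

theorem hasDerivAt_primitive {ζ : ℝ → ℝ} (h : Continuous ζ) (t : ℝ) :
    HasDerivAt (fun t => ∫ s in (0 : ℝ)..t, ζ s) (ζ t) t :=
  intervalIntegral.integral_hasDerivAt_right (h.intervalIntegrable _ _)
    (h.stronglyMeasurableAtFilter _ _) h.continuousAt

theorem contDiff_primitive {ζ : ℝ → ℝ} (h : ContDiff ℝ ∞ ζ) :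
    ContDiff ℝ ∞ (fun t => ∫ s in (0 : ℝ)..t, ζ s) := by
  rw [contDiff_infty_iff_deriv]
  have : deriv (fun t => ∫ s in (0 : ℝ)..t, ζ s) = ζ :=
    funext fun t => (hasDerivAt_primitive h.continuous t).deriv
  refine ⟨fun t => (hasDerivAt_primitive h.continuous t).differentiableAt, ?_⟩
  rw [this]
  exact h

/-- A test function with vanishing integral is the derivative of a test function. -/
theorem exists_test_deriv_eq {T : ℝ} (hT : 0 < T) {ζ : ℝ → ℝ} (h1 : ContDiff ℝ ∞ ζ)
    (h2 : HasCompactSupport ζ) (h3 : tsupport ζ ⊆ Ioo 0 T) (h0 : ∫ t, ζ t = 0) :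
    ∃ θ : ℝ → ℝ, ContDiff ℝ ∞ θ ∧ HasCompactSupport θ ∧ tsupport θ ⊆ Ioo 0 T ∧ deriv θ = ζ := by
  obtain ⟨a, b, ha, hb, hab⟩ := exists_Icc_of_compact_subset_Ioo hT h2 h3
  have hz : ∀ t, t ∉ Icc a b → ζ t = 0 := fun t ht =>
    image_eq_zero_of_notMem_tsupport fun h => ht (hab h)
  -- To the left of `a` nothing has been integrated yet; to the right of `b` the primitive equals
  -- the total integral, which is zero.
  have hs : Function.support (fun t => ∫ s in (0 : ℝ)..t, ζ s) ⊆ Icc a b := by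
    intro t ht
    by_contra hn
    apply ht
    simp only
    rcases lt_or_ge t a with hta | hta
    · refine intervalIntegral.integral_zero_ae (Filter.Eventually.of_forall fun s hs => hz s ?_)
      rintro ⟨hs1, -⟩
      rcases le_total 0 t with h | h
      · rw [uIoc_of_le h] at hs; linarith [hs.2]
      · rw [uIoc_of_ge h] at hs; linarith [hs.2]
    · have htb : b < t := by
        by_contra hc; exact hn ⟨hta, not_lt.1 hc⟩
      rw [intervalIntegral.integral_eq_integral_of_support_subset, h0]
      intro s hs
      have := hab (subset_tsupport _ hs)
      exact ⟨ha.trans_le this.1, this.2.trans htb.le⟩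
  have hts : tsupport (fun t => ∫ s in (0 : ℝ)..t, ζ s) ⊆ Icc a b :=
    closure_minimal hs isClosed_Icc
  exact ⟨_, contDiff_primitive h1, HasCompactSupport.of_support_subset_isCompact isCompact_Icc hs,
    hts.trans fun s hs => ⟨ha.trans_le hs.1, hs.2.trans_lt hb⟩,
    funext fun t => (hasDerivAt_primitive h1.continuous t).deriv⟩

theorem exists_test_integral_eq_one {T : ℝ} (hT : 0 < T) :
    ∃ η : ℝ → ℝ, ContDiff ℝ ∞ η ∧ HasCompactSupport η ∧ tsupport η ⊆ Ioo 0 T ∧ ∫ t, η t = 1 := by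
  let b : ContDiffBump (T / 2) := ⟨T / 8, T / 4, by positivity, by linarith⟩
  refine ⟨b.normed volume, b.contDiff_normed, b.hasCompactSupport_normed, ?_, b.integral_normed⟩
  rw [b.tsupport_normed_eq]
  intro x hx
  rw [Real.closedBall_eq_Icc] at hx
  have h1 := hx.1
  have h2 := hx.2
  simp only [b] at h1 h2
  constructor <;> linarith

/-- A vector valued function with integrable weak derivative is absolutely continuous. -/
theorem exists_eq_add_primitive_of_weakDeriv {T : ℝ} (hT : 0 < T) {g w : ℝ → E}
    (hg : IntegrableOn g (Ioo 0 T)) (hw : IntegrableOn w (Ioo 0 T))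
    (h : ∀ θ : ℝ → ℝ, ContDiff ℝ ∞ θ → HasCompactSupport θ → tsupport θ ⊆ Ioo 0 T →
      ∫ t in Ioo 0 T, deriv θ t • g t = -∫ t in Ioo 0 T, θ t • w t) :
    ∃ c : E, ∀ᵐ t ∂timeMeasure T, g t = c + ∫ s in Ioo 0 t, w s := by
  obtain ⟨η, e1, e2, e3, e4⟩ := exists_test_integral_eq_one hT
  set W : ℝ → E := fun t => ∫ s in Ioo 0 t, w s with hW
  have hWi : IntegrableOn W (Ioo 0 T) :=
    ((continuousOn_primitive_Ioo hw).integrableOn_Icc).mono_set Ioo_subset_Icc_self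
  set k : ℝ → E := fun t => g t - W t with hk
  have hki : IntegrableOn k (Ioo 0 T) := hg.sub hWi
  have hsm : ∀ (θ : ℝ → ℝ), Continuous θ → HasCompactSupport θ → ∀ {f : ℝ → E},
      IntegrableOn f (Ioo 0 T) → IntegrableOn (fun t => θ t • f t) (Ioo 0 T) := by
    intro θ hθ hc f hf
    obtain ⟨C, hC⟩ := hθ.bounded_above_of_compact_support hc
    exact integrable_bilin_of_bounded (ContinuousLinearMap.lsmul ℝ ℝ).flip hf
      hθ.aestronglyMeasurable (Filter.Eventually.of_forall hC)
  -- The du Bois-Reymond argument: `k`, which is g minus the primitive of w, has zero weak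
  -- derivative and must be shown to be constant.
  have key : ∀ θ : ℝ → ℝ, ContDiff ℝ ∞ θ → HasCompactSupport θ → tsupport θ ⊆ Ioo 0 T →
      ∫ t in Ioo 0 T, deriv θ t • k t = 0 := by
    intro θ h1 h2 h3
    have hd : Continuous (deriv θ) := h1.continuous_deriv (by simp)
    have hθ0 : θ 0 = 0 := image_eq_zero_of_notMem_tsupport fun h => by simpa using h3 h
    have hθT : θ T = 0 := image_eq_zero_of_notMem_tsupport fun h => by simpa using h3 h
    have hp : ∀ t, 0 ≤ t → ∫ s in Ioo 0 t, deriv θ s = θ t := fun t ht => by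
      rw [setIntegral_Ioo_eq_interval ht, intervalIntegral.integral_deriv_eq_sub
        (fun s _ => (h1.differentiable (by simp)) s) (hd.intervalIntegrable _ _), hθ0, sub_zero]
    have := (bilin_integral_by_parts (ContinuousLinearMap.lsmul ℝ ℝ : ℝ →L[ℝ] E →L[ℝ] E)
      (u := θ) (v := W) (a := 0) (b := 0) (integrableOn_test hd) hw
      ((ae_restrict_mem measurableSet_Ioo).mono fun t ht => by rw [hp t ht.1.le, zero_add])
      (Filter.Eventually.of_forall fun t => by rw [zero_add])).2.2
    rw [hp T hT.le, hθT] at this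
    simp only [ContinuousLinearMap.lsmul_apply, add_zero, map_zero, sub_zero,
      zero_apply] at this
    have hd2 : HasCompactSupport (deriv θ) := h2.deriv
    simp only [hk, smul_sub]
    rw [integral_sub (hsm _ hd hd2 hg) (hsm _ hd hd2 hWi), h θ h1 h2 h3, eq_neg_of_add_eq_zero_left this]
    simp
  refine ⟨∫ t in Ioo 0 T, η t • k t, ?_⟩
  set c := ∫ t in Ioo 0 T, η t • k t with hc
  have : ∀ᵐ t ∂timeMeasure T, k t - c = 0 := by
    refine ae_eq_zero_of_integral_test (hki.sub (by simp)) fun θ h1 h2 h3 => ?_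
    -- Subtracting (∫θ)η makes the integral vanish, so the result is the derivative of a test
    -- function and `key` applies to it.
    obtain ⟨Θ, g1, g2, g3, g4⟩ := exists_test_deriv_eq hT (ζ := fun t => θ t - (∫ s, θ s) * η t)
      (h1.sub (contDiff_const.mul e1)) (h2.sub (e2.mul_left)) (by
        refine (tsupport_sub _ _).trans (union_subset h3 ?_)
        exact (closure_mono (Function.support_mul_subset_right _ _)).trans e3) (by
        rw [integral_sub (h1.continuous.integrable_of_hasCompactSupport h2)
          ((e1.continuous.integrable_of_hasCompactSupport e2).const_mul _), integral_const_mul, e4]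
        ring)
    have := key Θ g1 g2 g3
    rw [g4] at this
    simp only [sub_smul, mul_smul] at this
    have hi : IntegrableOn (fun t => (∫ s, θ s) • η t • k t) (Ioo 0 T) :=
      (hsm _ e1.continuous e2 hki).smul _
    rw [integral_sub (hsm _ h1.continuous h2 hki) hi,
      integral_smul, ← hc, sub_eq_zero] at this
    simp only [smul_sub]
    rw [integral_sub (hsm _ h1.continuous h2 hki) (hsm _ h1.continuous h2 (by simp)), this,
      integral_smul_const, sub_eq_zero]
    congr 1
    exact (setIntegral_eq_integral_of_forall_compl_eq_zero fun t ht =>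
      image_eq_zero_of_notMem_tsupport fun h' => ht (h3 h')).symm
  filter_upwards [this] with t ht
  rw [sub_eq_zero] at ht
  rw [← ht]
  simp [hk, hW]

/-- Equality at the endpoints follows by continuity from the open interval. This makes initial
values independent of the continuous representative. -/
theorem eqOn_Icc_of_ae_eq {E : Type*} [NormedAddCommGroup E] {T : ℝ} (hT : 0 < T)
    {f g : ℝ → E} (hf : ContinuousOn f (Icc 0 T)) (hg : ContinuousOn g (Icc 0 T)) (h : f =ᵐ[timeMeasure T] g) : EqOn f g (Icc 0 T) := by
  have h1 : EqOn f g (Ioo 0 T) :=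
    Measure.eqOn_open_of_ae_eq h isOpen_Ioo (hf.mono Ioo_subset_Icc_self)
      (hg.mono Ioo_subset_Icc_self)
  refine h1.of_subset_closure hf hg Ioo_subset_Icc_self ?_
  rw [closure_Ioo hT.ne]

end TimeCalculus

/-! ### Uniqueness for the abstract evolution equation, regularized by the resolvent. -/

section AbstractEvolution

open Filter Topology

variable {H V : Type*} [NormedAddCommGroup H] [InnerProductSpace ℂ H] [CompleteSpace H]
  [NormedAddCommGroup V] [InnerProductSpace ℂ V] [CompleteSpace V]

/-- The solution operator `f ↦ φ` of the problem `(φ, ψ)_V = (f, ψ)_H` for all `ψ ∈ V`. -/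
def solutionOp (J : V →L[ℂ] H) : H →L[ℂ] H := J ∘L (ContinuousLinearMap.adjoint J)

theorem solutionOp_apply (J : V →L[ℂ] H) (x : H) :
    solutionOp J x = J (ContinuousLinearMap.adjoint J x) := rfl

theorem inner_solutionOp (J : V →L[ℂ] H) (x y : H) :
    inner ℂ (solutionOp J x) y = inner ℂ x (solutionOp J y) := by
  simp only [solutionOp_apply]
  rw [← ContinuousLinearMap.adjoint_inner_right, ContinuousLinearMap.adjoint_inner_left]

theorem re_inner_solutionOp (J : V →L[ℂ] H) (x : H) :
    (inner ℂ x (solutionOp J x)).re = ‖ContinuousLinearMap.adjoint J x‖ ^ 2 := by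
  rw [solutionOp_apply, ← ContinuousLinearMap.adjoint_inner_left, inner_self_eq_norm_sq_to_K]
  norm_cast

theorem norm_sq_one_sub_solutionOp (J : V →L[ℂ] H) (x : H) :
    ‖(1 - solutionOp J) x‖ ^ 2 =
      ‖x‖ ^ 2 - 2 * ‖ContinuousLinearMap.adjoint J x‖ ^ 2 + ‖solutionOp J x‖ ^ 2 := by
  have := norm_sub_sq (𝕜 := ℂ) x (solutionOp J x)
  rw [show RCLike.re (inner ℂ x (solutionOp J x)) = _ from re_inner_solutionOp J x] at this
  simpa using this

/-- Expand the square and use ‖J J* x‖ ≤ ‖J* x‖. The surplus term ‖J* x‖² shows that 1 - J J* can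
preserve the norm of x only if J* x = 0. -/
theorem norm_sq_one_sub_solutionOp_le {J : V →L[ℂ] H} (hJ : ∀ v, ‖J v‖ ≤ ‖v‖) (x : H) :
    ‖(1 - solutionOp J) x‖ ^ 2 + ‖ContinuousLinearMap.adjoint J x‖ ^ 2 ≤ ‖x‖ ^ 2 := by
  have h1 : ‖solutionOp J x‖ ^ 2 ≤ ‖ContinuousLinearMap.adjoint J x‖ ^ 2 := by
    gcongr; exact hJ _
  linarith [norm_sq_one_sub_solutionOp J x]

theorem norm_one_sub_solutionOp_le {J : V →L[ℂ] H} (hJ : ∀ v, ‖J v‖ ≤ ‖v‖) (x : H) :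
    ‖(1 - solutionOp J) x‖ ≤ ‖x‖ := by
  refine le_of_sq_le_sq ?_ (norm_nonneg _)
  nlinarith [norm_sq_one_sub_solutionOp_le hJ x, sq_nonneg ‖ContinuousLinearMap.adjoint J x‖]

theorem inner_pow_left {C : H →L[ℂ] H} (hC : ∀ x y, inner ℂ (C x) y = inner ℂ x (C y)) (n : ℕ)
    (x y : H) : inner ℂ ((C ^ n) x) y = inner ℂ x ((C ^ n) y) := by
  induction n generalizing x y with
  | zero => simp
  | succ n ih => rw [pow_succ, mul_apply_eq_comp, ih, hC, ← mul_apply_eq_comp,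
      ← pow_succ', pow_succ]

theorem norm_pow_apply_le {C : H →L[ℂ] H} (hC : ∀ x, ‖C x‖ ≤ ‖x‖) (n : ℕ) (x : H) :
    ‖(C ^ n) x‖ ≤ ‖x‖ := by
  induction n with
  | zero => simp
  | succ n ih => rw [pow_succ', mul_apply_eq_comp]; exact (hC _).trans ih

/-- No spectral calculus is needed. For a symmetric contraction C the norms ‖Cⁿx‖ decrease, and Re
⟪C^(2m) x, C^(2n) x⟫ = ‖C^(m+n) x‖², so the even powers form a Cauchy sequence. The limit y
satisfies C²y = y, hence C preserves its norm, hence J* y = 0, and y is orthogonal to the dense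
range of J. -/
theorem tendsto_one_sub_solutionOp_pow {J : V →L[ℂ] H} (hJ : ∀ v, ‖J v‖ ≤ ‖v‖)
    (hd : DenseRange J) (x : H) :
    Tendsto (fun n : ℕ => ((1 - solutionOp J) ^ (2 * n)) x) atTop (𝓝 0) := by
  set C : H →L[ℂ] H := 1 - solutionOp J with hCdef
  have hsym : ∀ x y, inner ℂ (C x) y = inner ℂ x (C y) := fun x y => by
    simp [hCdef, inner_solutionOp]
  have hle : ∀ x, ‖C x‖ ≤ ‖x‖ := norm_one_sub_solutionOp_le hJ
  have hin : ∀ m n : ℕ, (inner ℂ ((C ^ (2 * m)) x) ((C ^ (2 * n)) x)).re = ‖(C ^ (m + n)) x‖ ^ 2 := by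
    intro m n
    rw [inner_pow_left hsym, ← mul_apply_eq_comp, ← pow_add,
      show 2 * m + 2 * n = (m + n) + (m + n) by ring, pow_add, mul_apply_eq_comp,
      ← inner_pow_left hsym, inner_self_eq_norm_sq_to_K]
    norm_cast
  have hanti : Antitone fun n : ℕ => ‖(C ^ n) x‖ ^ 2 := antitone_nat_of_succ_le fun n => by
    have : ‖(C ^ (n + 1)) x‖ ≤ ‖(C ^ n) x‖ := by rw [pow_succ', mul_apply_eq_comp]; exact hle _
    gcongr
  obtain ⟨l, hl⟩ : ∃ l, Tendsto (fun n : ℕ => ‖(C ^ n) x‖ ^ 2) atTop (𝓝 l) :=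
    ⟨_, tendsto_atTop_ciInf hanti ⟨0, by rintro _ ⟨n, rfl⟩; positivity⟩⟩
  have hcau : CauchySeq (fun n : ℕ => (C ^ (2 * n)) x) := by
    rw [Metric.cauchySeq_iff']
    intro ε hε
    have hll : ∀ n, l ≤ ‖(C ^ n) x‖ ^ 2 := hanti.le_of_tendsto hl
    obtain ⟨N, hN⟩ := eventually_atTop.1 (hl.eventually_lt_const
      (show l < l + ε ^ 2 / 2 by nlinarith [sq_pos_of_pos hε]))
    refine ⟨N, fun n hn => ?_⟩
    rw [dist_eq_norm]
    refine lt_of_pow_lt_pow_left₀ 2 hε.le ?_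
    have h1 := norm_sub_sq (𝕜 := ℂ) ((C ^ (2 * n)) x) ((C ^ (2 * N)) x)
    rw [show RCLike.re (inner ℂ ((C ^ (2 * n)) x) ((C ^ (2 * N)) x)) = _ from hin n N] at h1
    have h2 := hN (n + n) (by omega)
    have h3 := hN (N + N) (by omega)
    have h4 := hll (n + N)
    rw [← two_mul] at h2 h3
    linarith
  obtain ⟨y, hy⟩ := cauchySeq_tendsto_of_complete hcau
  have hyC : C (C y) = y := by
    have h1 : Tendsto (fun n : ℕ => C (C ((C ^ (2 * n)) x))) atTop (𝓝 (C (C y))) :=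
      ((C.continuous.comp C.continuous).tendsto y).comp hy
    have h2 := (tendsto_add_atTop_iff_nat 1).2 hy
    refine tendsto_nhds_unique (h1.congr fun n => ?_) h2
    rw [show 2 * (n + 1) = 2 * n + 1 + 1 by ring, pow_succ', pow_succ']
    rfl
  have h0 : ContinuousLinearMap.adjoint J y = 0 := by
    have h1 := norm_sq_one_sub_solutionOp_le hJ y
    have h2 : ‖y‖ ≤ ‖C y‖ := by
      calc ‖y‖ = ‖C (C y)‖ := by rw [hyC]
        _ ≤ _ := hle _
    have h3 : ‖y‖ ^ 2 ≤ ‖C y‖ ^ 2 := by gcongr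
    have h4 : ‖ContinuousLinearMap.adjoint J y‖ ^ 2 ≤ 0 := by
      change ‖C y‖ ^ 2 + _ ≤ _ at h1
      linarith
    simpa using le_antisymm h4 (sq_nonneg _)
  have hy0 : y = 0 := by
    refine hd.eq_zero_of_inner_left ℂ fun v => ?_
    rw [← ContinuousLinearMap.adjoint_inner_left, h0, inner_zero_left]
  rwa [hy0] at hy

/-- The real part of the inner product as a real bilinear map. -/
def reInner : H →L[ℝ] H →L[ℝ] ℝ :=
  LinearMap.mkContinuous₂ (LinearMap.mk₂ ℝ (fun a b : H => (inner ℂ a b).re)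
    (fun _ _ _ => by simp) (fun c a b => by
      rw [← Complex.coe_smul, inner_smul_left]; simp)
    (fun _ _ _ => by simp) (fun c a b => by
      rw [← Complex.coe_smul, inner_smul_right]; simp)) 1 fun a b => by
        simpa using (Complex.abs_re_le_norm _).trans (norm_inner_le_norm (𝕜 := ℂ) a b)

theorem reInner_apply (a b : H) : reInner a b = (inner ℂ a b).re := rfl

theorem im_inner_self_of_symm {S : H →L[ℂ] H} (hS : ∀ x y, inner ℂ (S x) y = inner ℂ x (S y))
    (x : H) : (inner ℂ x (S x)).im = 0 := by
  have h := inner_conj_symm (𝕜 := ℂ) x (S x)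
  rw [hS] at h
  exact Complex.conj_eq_iff_im.1 h

/-- Here B stands for (1 - Δ)⁻¹ and g for 𝒱z. The equation is tested only against the range of B, so
it determines Bz, as a primitive with value 0 at time 0: the factor ∫₀ᵗ η - ∫₀ᵀ η vanishes at T but
is free at 0. The step from Bz to z is made by the energy identity for operators divisible by B that
converge strongly to 1. -/
theorem eq_zero_of_weak_evolution {B : H →L[ℂ] H}
    (hB : ∀ x y, inner ℂ (B x) y = inner ℂ x (B y)) (hB1 : ∀ x, ‖(1 - B) x‖ ≤ ‖x‖)
    (hB2 : ∀ x, Tendsto (fun n : ℕ => ((1 - B) ^ (2 * n)) x) atTop (𝓝 0)) {T : ℝ}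
    {z g : ℝ → H} (hz : MemLp z 2 (timeMeasure T)) (hg : MemLp g 2 (timeMeasure T))
    (him : ∀ᵐ t ∂timeMeasure T, (inner ℂ (z t) (g t)).im = 0)
    (h : ∀ η : ℝ → ℝ, ContDiff ℝ ∞ η → HasCompactSupport η → tsupport η ⊆ Ioo 0 T → ∀ ψ : H,
      ∫ t in Ioo 0 T, (-Complex.I * (η t : ℂ) * inner ℂ (B ψ) (z t) +
        (((∫ s in Ioo 0 t, η s) - ∫ s in Ioo 0 T, η s : ℝ) : ℂ) *
          ((1 / 2 : ℂ) * inner ℂ (B ψ - ψ) (z t) - inner ℂ (B ψ) (g t))) = 0) :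
    z =ᵐ[timeMeasure T] 0 := by
  have hzi : Integrable z (timeMeasure T) := hz.integrable (by norm_num)
  have hgi : Integrable g (timeMeasure T) := hg.integrable (by norm_num)
  -- The derivative dictated by the equation: B applied to z' = -i(-½Δz + g), with -BΔ = 1 - B.
  set y : ℝ → H := fun t => -Complex.I • ((1 / 2 : ℂ) • (z t - B (z t)) + B (g t)) with hy
  have hBz : Integrable (fun t => B (z t)) (timeMeasure T) := B.integrable_comp hzi
  have hyi : Integrable y (timeMeasure T) :=
    (((hzi.sub hBz).smul (1 / 2 : ℂ)).add (B.integrable_comp hgi)).smul (-Complex.I)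
  have hBY : ∀ᵐ t ∂timeMeasure T, B (z t) = ∫ s in Ioo 0 t, y s := by
    have hYi : IntegrableOn (fun t => ∫ s in Ioo 0 t, y s) (Ioo 0 T) :=
      ((continuousOn_primitive_Ioo hyi).integrableOn_Icc).mono_set Ioo_subset_Icc_self
    suffices ∀ᵐ t ∂timeMeasure T, B (z t) - ∫ s in Ioo 0 t, y s = 0 from
      this.mono fun t ht => sub_eq_zero.1 ht
    refine ae_eq_zero_of_integral_test (hBz.sub hYi) fun η h1 h2 h3 => ?_
    obtain ⟨Cη, hCη⟩ := h1.continuous.bounded_above_of_compact_support h2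
    have hηi : IntegrableOn η (Ioo 0 T) := integrableOn_test h1.continuous
    set θ : ℝ → ℝ := fun t => (∫ s in Ioo 0 t, η s) - ∫ s in Ioo 0 T, η s with hθ
    obtain ⟨i1, i2, e⟩ := bilin_integral_by_parts (T := T)
      (ContinuousLinearMap.lsmul ℝ ℝ : ℝ →L[ℝ] H →L[ℝ] H)
      (u := θ) (v := fun t => ∫ s in Ioo 0 t, y s) (a := -∫ s in Ioo 0 T, η s) (b := 0)
      hηi hyi (Eventually.of_forall fun t => by simp only [hθ]; ring)
      (Eventually.of_forall fun t => (zero_add _).symm)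
    simp only [ContinuousLinearMap.lsmul_apply, neg_add_cancel, map_zero, sub_zero,
      zero_apply] at i1 i2 e
    have i3 : Integrable (fun t => η t • B (z t)) (timeMeasure T) :=
      integrable_bilin_of_bounded (ContinuousLinearMap.lsmul ℝ ℝ).flip hBz
        h1.continuous.aestronglyMeasurable (Eventually.of_forall hCη)
    have hF : ∫ t in Ioo 0 T, (η t • B (z t) + θ t • y t) = 0 := by
      refine ext_inner_left ℂ fun ψ => ?_
      have i4 : Integrable (fun t => η t • B (z t) + θ t • y t) (timeMeasure T) := i3.add i2
      rw [← integral_inner i4, inner_zero_right]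
      have h4 := h η h1 h2 h3 ψ
      rw [← mul_eq_zero_iff_left (neg_ne_zero.2 Complex.I_ne_zero), ← integral_const_mul, ← h4]
      refine integral_congr_ae (Eventually.of_forall fun t => ?_)
      simp only [hy, ← Complex.coe_smul, inner_add_right, inner_smul_right, inner_sub_right,
        inner_sub_left, hB]
      change _ = _ + ((θ t : ℝ) : ℂ) * _
      linear_combination (θ t : ℂ) * (1 / 2 * inner ℂ ψ (z t) - 1 / 2 * inner ℂ ψ (B (z t)) +
        inner ℂ ψ (B (g t))) * Complex.I_mul_I
    rw [integral_add i3 i2] at hF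
    simp only [smul_sub]
    rw [integral_sub i3 i1, sub_eq_zero]
    rw [← eq_neg_iff_add_eq_zero] at hF e
    rw [hF, e]
  -- By the geometric sum, `K n` is divisible by B, so `K n (z t)` inherits a derivative from Bz; at
  -- the same time `K n` tends strongly to 1.
  set K : ℕ → H →L[ℂ] H := fun n => 1 - (1 - B) ^ (2 * n) with hK
  have hCs : ∀ x y, inner ℂ ((1 - B) x) y = inner ℂ x ((1 - B) y) := fun x y => by
    simp [hB]
  have hKn : ∀ n x, ‖K n x‖ ≤ 2 * ‖x‖ := fun n x => by
    have := norm_pow_apply_le hB1 (2 * n) x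
    calc ‖K n x‖ = ‖x - ((1 - B) ^ (2 * n)) x‖ := by simp [hK]
      _ ≤ ‖x‖ + ‖((1 - B) ^ (2 * n)) x‖ := norm_sub_le _ _
      _ ≤ _ := by linarith
  have hKlim : ∀ x, Tendsto (fun n => K n x) atTop (𝓝 x) := fun x => by
    have := (hB2 x).const_sub x
    simpa [hK] using this
  have hen : ∀ n, ∀ᵐ t ∂timeMeasure T, ‖K n (z t)‖ ^ 2 =
      2 * ∫ s in Ioo 0 t, (inner ℂ (K n (z s)) (K n (g s))).im := by
    intro n
    set Q : H →L[ℂ] H := ∑ k ∈ Finset.range (2 * n), (1 - B) ^ k with hQ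
    have hQB : Q * B = K n := by
      have := geom_sum_mul_neg (1 - B) (2 * n)
      rwa [sub_sub_cancel] at this
    have hBQ : B * Q = K n := by
      have := mul_neg_geom_sum (1 - B) (2 * n)
      rwa [sub_sub_cancel] at this
    have hQs : ∀ x y, inner ℂ (Q x) y = inner ℂ x (Q y) := fun x y => by
      simp only [hQ, FunLike.coe_sum, Finset.sum_apply, sum_inner, inner_sum,
        inner_pow_left hCs]
    have hKs : ∀ x y, inner ℂ (K n x) y = inner ℂ x (K n y) := fun x y => by
      rw [← hQB, mul_apply_eq_comp, hQs, hB, ← mul_apply_eq_comp, hBQ, hQB]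
    have hcomm : (1 - B) * Q = Q * (1 - B) := by
      rw [sub_mul, mul_sub, hBQ, hQB, one_mul, mul_one]
    have hKQ : K n * Q * (1 - B) = (1 - B) * (Q * K n) := by
      have h1 : Commute (1 - B) Q := hcomm
      have h2 : Commute (1 - B) B := (Commute.one_left B).sub_left (Commute.refl B)
      rw [← hQB, ((h1.mul_right (h1.mul_right h2))).eq, mul_assoc Q B Q, hBQ, hQB]
    have hpt : ∀ t, (inner ℂ (K n (z t)) (Q (y t))).re = (inner ℂ (K n (z t)) (K n (g t))).im := by
      intro t
      have h1 : Q (y t) = -Complex.I • ((1 / 2 : ℂ) • Q ((1 - B) (z t)) + K n (g t)) := by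
        rw [← hQB]; simp [hy]
      -- The kinetic term is a quadratic form of the symmetric operator `K n * Q * (1 - B)`, a real
      -- polynomial in B; being real, it disappears from the real part after multiplication by -i.
      have h2 : (inner ℂ (K n (z t)) (Q ((1 - B) (z t)))).im = 0 := by
        rw [hKs]
        refine im_inner_self_of_symm (S := K n * Q * (1 - B)) (fun a b => ?_) (z t)
        simp only [mul_apply_eq_comp]
        rw [hKs, hQs, hCs]
        simp only [← mul_apply_eq_comp]
        rw [← hKQ, mul_assoc]
      rw [h1, inner_smul_right, inner_add_right, inner_smul_right]
      generalize inner ℂ (K n (z t)) (Q ((1 - B) (z t))) = c at h2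
      simp [h2]
    have hz1 : ∀ᵐ t ∂timeMeasure T, K n (z t) = 0 + ∫ s in Ioo 0 t, Q (y s) := by
      filter_upwards [hBY, ae_restrict_mem measurableSet_Ioo] with t ht htI
      rw [← hQB, mul_apply_eq_comp, ht, zero_add]
      exact (Q.integral_comp_comm (IntegrableOn.mono_set hyi (Ioo_subset_Ioo_right htI.2.le))).symm
    filter_upwards [hz1, ae_restrict_mem measurableSet_Ioo] with t ht htI
    have hsub : Ioo 0 t ⊆ Ioo 0 T := Ioo_subset_Ioo_right htI.2.le
    have hQi : IntegrableOn (fun s => Q (y s)) (Ioo 0 t) :=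
      IntegrableOn.mono_set (Q.integrable_comp hyi) hsub
    have hz2 := ae_mono (Measure.restrict_mono hsub le_rfl) hz1
    have e := (bilin_integral_by_parts reInner hQi hQi hz2 hz2).2.2
    rw [← ht] at e
    have e1 : ∀ x : H, (inner ℂ x x).re = ‖x‖ ^ 2 := fun x => by
      rw [inner_self_eq_norm_sq_to_K]; norm_cast
    simp only [reInner_apply, hpt, e1, norm_zero] at e
    have e2 : ∀ s, (inner ℂ (Q (y s)) (K n (z s))).re = (inner ℂ (K n (z s)) (K n (g s))).im := fun s => by
      rw [← hpt, ← inner_conj_symm, Complex.conj_re]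
    simp only [e2] at e
    rw [two_mul, e]
    simp
  have hen' := ae_all_iff.2 hen
  filter_upwards [hen', ae_restrict_mem measurableSet_Ioo] with t ht htI
  have hsub : Ioo 0 t ⊆ Ioo 0 T := Ioo_subset_Ioo_right htI.2.le
  have h1 : Tendsto (fun n => ‖K n (z t)‖ ^ 2) atTop (𝓝 (‖z t‖ ^ 2)) := (hKlim (z t)).norm.pow 2
  have h2 : Tendsto (fun n => ∫ s in Ioo 0 t, (inner ℂ (K n (z s)) (K n (g s))).im) atTop
      (𝓝 (∫ s in Ioo 0 t, (inner ℂ (z s) (g s)).im)) := by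
    have hzm : AEStronglyMeasurable z (timeMeasure t) :=
      hz.1.mono_measure (Measure.restrict_mono hsub le_rfl)
    have hgm : AEStronglyMeasurable g (timeMeasure t) :=
      hg.1.mono_measure (Measure.restrict_mono hsub le_rfl)
    refine tendsto_integral_of_dominated_convergence (fun s => 4 * (‖z s‖ * ‖g s‖)) (fun n => ?_)
      ?_ (fun n => Eventually.of_forall fun s => ?_) (Eventually.of_forall fun s => ?_)
    · exact Complex.continuous_im.comp_aestronglyMeasurable
        (((K n).continuous.comp_aestronglyMeasurable hzm).inner
          ((K n).continuous.comp_aestronglyMeasurable hgm))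
    · exact (IntegrableOn.mono_set (hz.norm.integrable_mul hg.norm) hsub).const_mul 4
    · calc ‖(inner ℂ (K n (z s)) (K n (g s))).im‖ ≤ ‖inner ℂ (K n (z s)) (K n (g s))‖ :=
            Complex.abs_im_le_norm _
        _ ≤ ‖K n (z s)‖ * ‖K n (g s)‖ := norm_inner_le_norm _ _
        _ ≤ (2 * ‖z s‖) * (2 * ‖g s‖) := by gcongr <;> exact hKn _ _
        _ = _ := by ring
    · exact (Complex.continuous_im.tendsto _).comp ((hKlim _).inner (hKlim _))
  have h3 : ∫ s in Ioo 0 t, (inner ℂ (z s) (g s)).im = 0 := by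
    rw [integral_congr_ae (ae_mono (Measure.restrict_mono hsub le_rfl) him)]
    simp
  rw [h3] at h2
  have h4 := tendsto_nhds_unique h1 ((h2.const_mul 2).congr fun n => (ht n).symm)
  simpa using h4

end AbstractEvolution

/-! ### Integration by parts and Green's formulas in space. -/

section Green

open Filter Topology

variable {d : ℕ} {Ω : Set (Space d)}

theorem grad_apply (φ : Space d → ℂ) (x : Space d) (i : Fin d) :
    grad φ x i = fderiv ℝ φ x (EuclideanSpace.single i 1) := rfl

theorem inner_grad (χ φ : Space d → ℂ) (x : Space d) :
    inner ℂ (grad χ x) (grad φ x) = ∑ i, star (fderiv ℝ χ x (EuclideanSpace.single i 1)) *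
      fderiv ℝ φ x (EuclideanSpace.single i 1) := by
  simp [PiLp.inner_apply, grad_apply, mul_comm]

theorem laplacian_eq_sum {φ : Space d → ℂ} {x : Space d} (h : ContDiffAt ℝ 2 φ x) :
    Laplacian.laplacian φ x = ∑ i, fderiv ℝ (fun y => fderiv ℝ φ y (EuclideanSpace.single i 1)) x
      (EuclideanSpace.single i 1) := by
  have h1 : DifferentiableAt ℝ (fderiv ℝ φ) x :=
    (h.fderiv_right (m := 1) (by norm_num)).differentiableAt (by norm_num)
  rw [InnerProductSpace.laplacian_eq_iteratedFDeriv_orthonormalBasis φ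
    (EuclideanSpace.basisFun (Fin d) ℝ)]
  refine Finset.sum_congr rfl fun i _ => ?_
  rw [iteratedFDeriv_two_apply, fderiv_clm_apply h1 (by fun_prop)]
  simp

theorem continuous_of_continuousOn_of_tsupport {E : Type*} [NormedAddCommGroup E]
    {f : Space d → E} (hΩ : IsOpen Ω) (hf : ContinuousOn f Ω) (hs : tsupport f ⊆ Ω) :
    Continuous f :=
  continuous_of_tsupport fun _ hx => hf.continuousAt (hΩ.mem_nhds (hs hx))

theorem integrable_mul_test {f g : Space d → ℂ} (hΩ : IsOpen Ω) (hf : ContinuousOn f Ω)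
    (hg : Continuous g) (hc : HasCompactSupport g) (hs : tsupport g ⊆ Ω) :
    Integrable (fun x => f x * g x) := by
  refine Continuous.integrable_of_hasCompactSupport ?_ hc.mul_left
  exact continuous_of_continuousOn_of_tsupport hΩ (hf.mul hg.continuousOn)
    ((closure_mono (Function.support_mul_subset_right _ _)).trans hs)

theorem setIntegral_mul_test {f g : Space d → ℂ} (hs : tsupport g ⊆ Ω) :
    ∫ x in Ω, f x * g x = ∫ x, f x * g x :=
  setIntegral_eq_integral_of_forall_compl_eq_zero fun x hx => by
    rw [image_eq_zero_of_notMem_tsupport fun h' => hx (hs h'), mul_zero]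

theorem tsupport_fderiv_apply_subset {g : Space d → ℂ} (v : Space d) :
    tsupport (fun x => fderiv ℝ g x v) ⊆ tsupport g :=
  (closure_mono fun x hx => by
    rw [Function.mem_support] at hx ⊢
    intro h; exact hx (by rw [h]; simp)).trans (tsupport_fderiv_subset ℝ (f := g))

/-- Integration by parts with one factor of compact support. -/
theorem integral_mul_fderiv_test {f g : Space d → ℂ} (hΩ : IsOpen Ω) (hf : ContDiffOn ℝ 1 f Ω)
    (hg : ContDiff ℝ 1 g) (hc : HasCompactSupport g) (hs : tsupport g ⊆ Ω) (v : Space d) :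
    Integrable (fun x => f x * fderiv ℝ g x v) ∧ Integrable (fun x => fderiv ℝ f x v * g x) ∧
    ∫ x in Ω, f x * fderiv ℝ g x v = -∫ x in Ω, fderiv ℝ f x v * g x := by
  have hs' := (tsupport_fderiv_apply_subset (g := g) v).trans hs
  have i1 : Integrable (fun x => f x * fderiv ℝ g x v) :=
    integrable_mul_test hΩ hf.continuousOn ((hg.continuous_fderiv (by norm_num)).clm_apply
      continuous_const) (hc.fderiv_apply ℝ v) hs'
  have i2 : Integrable (fun x => fderiv ℝ f x v * g x) :=
    integrable_mul_test hΩ ((hf.continuousOn_fderiv_of_isOpen hΩ (by norm_num)).clm_apply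
      continuousOn_const) hg.continuous hc hs
  refine ⟨i1, i2, ?_⟩
  rw [setIntegral_mul_test hs', setIntegral_mul_test hs]
  refine integral_mul_fderiv_eq_neg_fderiv_mul_of_integrable i2 i1
    (integrable_mul_test hΩ hf.continuousOn hg.continuous hc hs) (fun x hx => ?_)
    fun x _ => (hg.differentiable (by norm_num)) x
  exact (hf.contDiffAt (hΩ.mem_nhds (hs hx))).differentiableAt (by norm_num)

theorem contDiff_star {g : Space d → ℂ} {n : WithTop ℕ∞} (hg : ContDiff ℝ n g) :
    ContDiff ℝ n (fun x => star (g x)) := Complex.conjCLE.contDiff.comp hg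

theorem fderiv_star_apply (g : Space d → ℂ) (x v : Space d) :
    fderiv ℝ (fun x => star (g x)) x v = star (fderiv ℝ g x v) := by
  have := Complex.conjCLE.comp_fderiv (f := g) (x := x)
  exact congrArg (fun L => L v) this

theorem tsupport_star (g : Space d → ℂ) : tsupport (fun x => star (g x)) = tsupport g := by
  simp [tsupport, Function.support]

theorem laplacian_star {g : Space d → ℂ} {x : Space d} (h : ContDiffAt ℝ 2 g x) :
    Laplacian.laplacian (fun x => star (g x)) x = star (Laplacian.laplacian g x) :=
  h.laplacian_CLM_comp_left (l := (Complex.conjCLE : ℂ →L[ℝ] ℂ))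

theorem contDiffOn_fderiv_apply {φ : Space d → ℂ} (hΩ : IsOpen Ω) (hφ : ContDiffOn ℝ 2 φ Ω)
    (v : Space d) : ContDiffOn ℝ 1 (fun x => fderiv ℝ φ x v) Ω :=
  (hφ.fderiv_of_isOpen hΩ (m := 1) (by norm_num)).clm_apply contDiffOn_const

/-- Green's first formula, the second factor having compact support. -/
theorem green_left {φ χ : Space d → ℂ} (hΩ : IsOpen Ω) (hφ : ContDiffOn ℝ 2 φ Ω)
    (hχ : ContDiff ℝ 1 χ) (hc : HasCompactSupport χ) (hs : tsupport χ ⊆ Ω) :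
    ∫ x in Ω, star (χ x) * Laplacian.laplacian φ x = -∫ x in Ω, inner ℂ (grad χ x) (grad φ x) := by
  have hc' : HasCompactSupport (fun x => star (χ x)) := by
    rw [HasCompactSupport, tsupport_star]; exact hc
  have hp := fun i : Fin d => integral_mul_fderiv_test hΩ
    (contDiffOn_fderiv_apply hΩ hφ (EuclideanSpace.single i 1)) (contDiff_star hχ) hc'
    (by rwa [tsupport_star]) (EuclideanSpace.single i 1)
  have h1 : EqOn (fun x => star (χ x) * Laplacian.laplacian φ x)
      (fun x => ∑ i, fderiv ℝ (fun y => fderiv ℝ φ y (EuclideanSpace.single i 1)) x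
        (EuclideanSpace.single i 1) * star (χ x)) Ω := fun x hx => by
    simp only [laplacian_eq_sum (hφ.contDiffAt (hΩ.mem_nhds hx))]
    rw [mul_comm, Finset.sum_mul]
  rw [setIntegral_congr_fun hΩ.measurableSet h1, integral_finsetSum _
    fun i _ => ((hp i).2.1).integrableOn]
  simp only [inner_grad]
  rw [integral_finsetSum _ fun i _ => by
    have := (hp i).1.integrableOn (s := Ω)
    simpa only [fderiv_star_apply, mul_comm] using! this, ← Finset.sum_neg_distrib]
  refine Finset.sum_congr rfl fun i _ => ?_
  rw [← neg_eq_iff_eq_neg.2 (hp i).2.2]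
  simp only [fderiv_star_apply, mul_comm]

/-- Green's first formula, the first factor having compact support. -/
theorem green_right {φ χ : Space d → ℂ} (hΩ : IsOpen Ω) (hφ : ContDiffOn ℝ 1 φ Ω)
    (hχ : ContDiff ℝ 2 χ) (hc : HasCompactSupport χ) (hs : tsupport χ ⊆ Ω) :
    ∫ x in Ω, star (Laplacian.laplacian χ x) * φ x = -∫ x in Ω, inner ℂ (grad χ x) (grad φ x) := by
  have hp := fun i : Fin d => integral_mul_fderiv_test hΩ hφ
    (contDiff_star ((hχ.fderiv_right (m := 1) (by norm_num)).clm_apply contDiff_const))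
    (g := fun x => star (fderiv ℝ χ x (EuclideanSpace.single i 1)))
    (by rw [HasCompactSupport, tsupport_star]; exact hc.fderiv_apply ℝ _)
    (by rw [tsupport_star]; exact (tsupport_fderiv_apply_subset _).trans hs)
    (EuclideanSpace.single i 1)
  have h1 : ∀ x, star (Laplacian.laplacian χ x) * φ x =
      ∑ i, φ x * fderiv ℝ (fun y => star (fderiv ℝ χ y (EuclideanSpace.single i 1))) x
        (EuclideanSpace.single i 1) := fun x => by
    simp only [laplacian_eq_sum hχ.contDiffAt, fderiv_star_apply, star_sum]
    rw [mul_comm, Finset.mul_sum]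
  simp only [h1, inner_grad]
  rw [integral_finsetSum _ fun i _ => ((hp i).1).integrableOn, integral_finsetSum _ fun i _ => by
    simpa only [mul_comm] using! ((hp i).2.1).integrableOn (s := Ω), ← Finset.sum_neg_distrib]
  refine Finset.sum_congr rfl fun i _ => ?_
  rw [(hp i).2.2]
  simp only [mul_comm]

end Green

/-! ### Test functions and limits in H¹₀. -/

section SobolevSpace

open Filter Topology

variable {d : ℕ} {Ω : Set (Space d)}

/-- `v ∈ V` is represented by the function `φ`, and its gradient by the classical gradient. -/
def IsRep (v : VSpace Ω) (φ : Space d → ℂ) : Prop :=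
  toH v =ᵐ[volume.restrict Ω] φ ∧ weakGrad v =ᵐ[volume.restrict Ω] grad φ

/-- Smooth functions with compact support in `Ω`. -/
structure IsTest (Ω : Set (Space d)) (φ : Space d → ℂ) : Prop where
  contDiff : ContDiff ℝ ∞ φ
  hasCompactSupport : HasCompactSupport φ
  tsupport_subset : tsupport φ ⊆ Ω

theorem norm_sq_vSpace (v : VSpace Ω) : ‖v‖ ^ 2 = ‖toH v‖ ^ 2 + ‖weakGrad v‖ ^ 2 :=
  WithLp.prod_norm_sq_eq_of_L2 (v : WithLp 2 (StateSpace Ω × FieldSpace Ω))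

theorem inner_vSpace (v w : VSpace Ω) :
    inner ℂ v w = inner ℂ (toH v) (toH w) + inner ℂ (weakGrad v) (weakGrad w) :=
  WithLp.prod_inner_apply (v : WithLp 2 (StateSpace Ω × FieldSpace Ω)) w

theorem norm_toH_le (v : VSpace Ω) : ‖toH v‖ ≤ ‖v‖ := by
  refine le_of_sq_le_sq ?_ (norm_nonneg _)
  nlinarith [norm_sq_vSpace v, sq_nonneg ‖weakGrad v‖]

theorem norm_weakGrad_le (v : VSpace Ω) : ‖weakGrad v‖ ≤ ‖v‖ := by
  refine le_of_sq_le_sq ?_ (norm_nonneg _)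
  nlinarith [norm_sq_vSpace v, sq_nonneg ‖toH v‖]

instance completeSpace_vSpace : CompleteSpace (VSpace Ω) :=
  (Submodule.isClosed_topologicalClosure _).completeSpace_coe

/-- Since `H10` is closed in the product, values and gradients may converge separately. Elements of
V that are not test functions are constructed in this way. -/
theorem exists_vSpace_of_tendsto {ι : Type*} {l : Filter ι} [l.NeBot] {v : ι → VSpace Ω}
    {a : StateSpace Ω} {b : FieldSpace Ω} (h1 : Tendsto (fun i => toH (v i)) l (𝓝 a))
    (h2 : Tendsto (fun i => weakGrad (v i)) l (𝓝 b)) :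
    ∃ w : VSpace Ω, toH w = a ∧ weakGrad w = b := by
  have h : Tendsto (fun i => ((v i : VSpace Ω) : WithLp 2 (StateSpace Ω × FieldSpace Ω))) l
      (𝓝 (WithLp.toLp 2 (a, b))) :=
    ((WithLp.prod_continuous_toLp 2 _ _).tendsto (a, b)).comp (h1.prodMk_nhds h2)
  have hm : WithLp.toLp 2 (a, b) ∈ H10 Ω :=
    (Submodule.isClosed_topologicalClosure _).mem_of_tendsto h (Eventually.of_forall fun i => (v i).2)
  exact ⟨⟨_, hm⟩, rfl, rfl⟩

theorem continuous_grad {φ : Space d → ℂ} (h : ContDiff ℝ 1 φ) : Continuous (grad φ) :=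
  (PiLp.continuous_toLp 2 _).comp
    (continuous_pi fun _ => (h.continuous_fderiv (by norm_num)).clm_apply continuous_const)

theorem hasCompactSupport_grad {φ : Space d → ℂ} (h : HasCompactSupport φ) :
    HasCompactSupport (grad φ) := by
  refine (h.fderiv ℝ).mono fun x hx => ?_
  rw [Function.mem_support] at hx ⊢
  intro h0
  apply hx
  ext i
  simp [grad_apply, h0]

theorem exists_isRep_of_test {φ : Space d → ℂ} (h : IsTest Ω φ) : ∃ v : VSpace Ω, IsRep v φ := by
  have h1 : MemLp φ 2 (volume.restrict Ω) :=
    (h.contDiff.continuous.memLp_of_hasCompactSupport h.hasCompactSupport).restrict _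
  have h2 : MemLp (grad φ) 2 (volume.restrict Ω) :=
    ((continuous_grad (h.contDiff.of_le (by norm_cast))).memLp_of_hasCompactSupport
      (hasCompactSupport_grad h.hasCompactSupport)).restrict _
  refine ⟨⟨WithLp.toLp 2 (h1.toLp, h2.toLp), ?_⟩, h1.coeFn_toLp, h2.coeFn_toLp⟩
  exact Submodule.le_topologicalClosure _ (Submodule.subset_span ⟨φ, h.contDiff,
    h.hasCompactSupport, h.tsupport_subset, h1.coeFn_toLp, h2.coeFn_toLp⟩)

theorem IsTest.add {φ ψ : Space d → ℂ} (h : IsTest Ω φ) (h' : IsTest Ω ψ) : IsTest Ω (φ + ψ) :=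
  ⟨h.contDiff.add h'.contDiff, h.hasCompactSupport.add h'.hasCompactSupport,
    (tsupport_add _ _).trans (union_subset h.tsupport_subset h'.tsupport_subset)⟩

theorem IsTest.const_smul {φ : Space d → ℂ} (h : IsTest Ω φ) (c : ℂ) : IsTest Ω (c • φ) :=
  ⟨h.contDiff.const_smul c, h.hasCompactSupport.smul_left,
    (closure_mono (Function.support_const_smul_subset c φ)).trans h.tsupport_subset⟩

theorem grad_add {φ ψ : Space d → ℂ} {x : Space d} (h : DifferentiableAt ℝ φ x)
    (h' : DifferentiableAt ℝ ψ x) : grad (φ + ψ) x = grad φ x + grad ψ x := by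
  ext i; simp [grad_apply, fderiv_add h h']

theorem grad_sub {φ ψ : Space d → ℂ} {x : Space d} (h : DifferentiableAt ℝ φ x)
    (h' : DifferentiableAt ℝ ψ x) : grad (φ - ψ) x = grad φ x - grad ψ x := by
  ext i; simp [grad_apply, fderiv_sub h h']

theorem grad_const_smul {φ : Space d → ℂ} {x : Space d} (h : DifferentiableAt ℝ φ x) (c : ℂ) :
    grad (c • φ) x = c • grad φ x := by
  ext i; simp [grad_apply, fderiv_const_smul h]

theorem IsTest.differentiableAt {φ : Space d → ℂ} (h : IsTest Ω φ) (x : Space d) :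
    DifferentiableAt ℝ φ x := (h.contDiff.differentiable (by simp)) x

theorem IsRep.sub {v w : VSpace Ω} {φ ψ : Space d → ℂ} (h : IsRep v φ) (h' : IsRep w ψ)
    (hφ : ∀ x ∈ Ω, DifferentiableAt ℝ φ x) (hψ : ∀ x ∈ Ω, DifferentiableAt ℝ ψ x)
    (hΩ : MeasurableSet Ω) : IsRep (v - w) (φ - ψ) := by
  constructor
  · rw [map_sub]
    filter_upwards [Lp.coeFn_sub (toH v) (toH w), h.1, h'.1] with x h1 h2 h3
    rw [h1, Pi.sub_apply, h2, h3, Pi.sub_apply]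
  · rw [map_sub]
    filter_upwards [Lp.coeFn_sub (weakGrad v) (weakGrad w), h.2, h'.2, ae_restrict_mem hΩ]
      with x h1 h2 h3 hx
    rw [h1, Pi.sub_apply, h2, h3, grad_sub (hφ x hx) (hψ x hx)]

/-- Every element of `V` is the limit of smooth functions with compact support. -/
theorem exists_test_tendsto (v : VSpace Ω) : ∃ (φ : ℕ → Space d → ℂ) (w : ℕ → VSpace Ω),
    (∀ n, IsTest Ω (φ n)) ∧ (∀ n, IsRep (w n) (φ n)) ∧ Tendsto w atTop (𝓝 v) := by
  -- The pairs (φ, ∇φ) already form a subspace, so every element of the span comes from a single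
  -- test function.
  have hspan : ∀ p ∈ Submodule.span ℂ {p : WithLp 2 (StateSpace Ω × FieldSpace Ω) |
      ∃ φ : Space d → ℂ, ContDiff ℝ ∞ φ ∧ HasCompactSupport φ ∧ tsupport φ ⊆ Ω ∧
        p.fst =ᵐ[volume.restrict Ω] φ ∧ p.snd =ᵐ[volume.restrict Ω] grad φ},
      ∃ φ : Space d → ℂ, IsTest Ω φ ∧
        p.fst =ᵐ[volume.restrict Ω] φ ∧ p.snd =ᵐ[volume.restrict Ω] grad φ := by
    intro p hp
    induction hp using Submodule.span_induction with
    | mem p hp => obtain ⟨φ, a, b, c, h⟩ := hp; exact ⟨φ, ⟨a, b, c⟩, h⟩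
    | zero =>
      refine ⟨0, ⟨contDiff_const, HasCompactSupport.zero, by simp⟩, Lp.coeFn_zero _ _ _, ?_⟩
      refine (Lp.coeFn_zero _ _ _).trans (Eventually.of_forall fun x => ?_)
      ext i; simp [grad_apply]
    | add p q _ _ hp hq =>
      obtain ⟨φ, h, h1, h2⟩ := hp
      obtain ⟨ψ, h', h3, h4⟩ := hq
      refine ⟨φ + ψ, h.add h', (Lp.coeFn_add _ _).trans (h1.add h3), (Lp.coeFn_add _ _).trans ?_⟩
      filter_upwards [h2, h4] with x e1 e2
      exact (congrArg₂ (· + ·) e1 e2).trans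
        (grad_add (h.differentiableAt x) (h'.differentiableAt x)).symm
    | smul c p _ hp =>
      obtain ⟨φ, h, h1, h2⟩ := hp
      refine ⟨c • φ, h.const_smul c, (Lp.coeFn_smul c _).trans (h1.const_smul c),
        (Lp.coeFn_smul c _).trans ?_⟩
      filter_upwards [h2] with x e1
      exact (congrArg (c • ·) e1).trans (grad_const_smul (h.differentiableAt x) c).symm
  have hv := v.2
  change (v : WithLp 2 (StateSpace Ω × FieldSpace Ω)) ∈ Submodule.topologicalClosure _ at hv
  rw [← SetLike.mem_coe, Submodule.topologicalClosure_coe] at hv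
  obtain ⟨p, hp, hlim⟩ := mem_closure_iff_seq_limit.1 hv
  choose φ hφ h1 h2 using fun n => hspan (p n) (hp n)
  exact ⟨φ, fun n => ⟨p n, Submodule.le_topologicalClosure _ (hp n)⟩, hφ, fun n => ⟨h1 n, h2 n⟩,
    tendsto_subtype_rng.2 hlim⟩

theorem inner_lp_eq_integral {E : Type*} [NormedAddCommGroup E] [InnerProductSpace ℂ E]
    {a b : Lp E 2 (volume.restrict Ω)} {f g : Space d → E} (h1 : a =ᵐ[volume.restrict Ω] f)
    (h2 : b =ᵐ[volume.restrict Ω] g) : inner ℂ a b = ∫ x in Ω, inner ℂ (f x) (g x) := by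
  rw [L2.inner_def]
  refine integral_congr_ae ?_
  filter_upwards [h1, h2] with x e1 e2
  rw [e1, e2]

theorem norm_sq_lp_eq_integral {E : Type*} [NormedAddCommGroup E] [InnerProductSpace ℂ E]
    {a : Lp E 2 (volume.restrict Ω)} {f : Space d → E} (h1 : a =ᵐ[volume.restrict Ω] f) :
    ‖a‖ ^ 2 = ∫ x in Ω, ‖f x‖ ^ 2 := by
  have h := inner_lp_eq_integral h1 h1
  simp only [inner_self_eq_norm_sq_to_K] at h
  norm_cast at h

theorem norm_lp_le_of_bound {E : Type*} [NormedAddCommGroup E]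
    {a : Lp E 2 (volume.restrict Ω)} (hΩ : volume Ω ≠ ⊤) {C : ℝ} (hC : 0 ≤ C)
    (h : ∀ᵐ x ∂volume.restrict Ω, ‖a x‖ ≤ C) :
    ‖a‖ ≤ (volume Ω).toReal ^ (1 / 2 : ℝ) * C := by
  have : IsFiniteMeasure (volume.restrict Ω) := ⟨by simpa using hΩ.lt_top⟩
  have := Lp.norm_le_of_ae_bound hC h
  simpa [measureUnivNNReal, NNReal.coe_rpow, ENNReal.coe_toNNReal_eq_toReal] using this

end SobolevSpace

/-! ### C¹ functions with compact support belong to H¹₀. -/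

section Mollification

open Filter Topology
open scoped Convolution

variable {d : ℕ} {Ω : Set (Space d)}

theorem norm_le_sum_norm (y : EuclideanSpace ℂ (Fin d)) : ‖y‖ ≤ ∑ i, ‖y i‖ := by
  have h : y = ∑ i, EuclideanSpace.single i (y i) := by
    ext j; simp
  conv_lhs => rw [h]
  refine (norm_sum_le _ _).trans (le_of_eq ?_)
  simp

/-- The mollification of a function of class `C¹` with compact support. -/
theorem exists_test_approx {f : Space d → ℂ} (hΩ : IsOpen Ω) (hf : ContDiff ℝ 1 f)
    (hc : HasCompactSupport f) (hs : tsupport f ⊆ Ω) {ε : ℝ} (hε : 0 < ε) :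
    ∃ φ, IsTest Ω φ ∧ (∀ x, ‖φ x - f x‖ ≤ ε) ∧ ∀ x, ‖grad φ x - grad f x‖ ≤ ε := by
  obtain ⟨r, hr, hrΩ⟩ := hc.isCompact.exists_cthickening_subset_open hΩ hs
  -- The gradient error is at most the sum of the errors of d partial derivatives; d + 1 also covers
  -- d = 0.
  set ε' : ℝ := ε / (d + 1) with hε'
  have hε'0 : 0 < ε' := by positivity
  have huc : ∀ g : Space d → ℂ, Continuous g → HasCompactSupport g →
      ∃ δ > 0, ∀ x y, dist x y < δ → dist (g x) (g y) ≤ ε' := by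
    intro g hg hgc
    obtain ⟨δ, hδ, h⟩ := Metric.uniformContinuous_iff.1 (hgc.uniformContinuous_of_continuous hg) ε' hε'0
    exact ⟨δ, hδ, fun x y hxy => (h hxy).le⟩
  have hD : ∀ i : Fin d, Continuous fun x => fderiv ℝ f x (EuclideanSpace.single i 1) := fun i =>
    (hf.continuous_fderiv (by norm_num)).clm_apply continuous_const
  obtain ⟨δ₀, hδ₀, h₀⟩ := huc f hf.continuous hc
  choose δ hδ hδ' using fun i : Fin d => huc _ (hD i) (hc.fderiv_apply ℝ _)
  -- One mollification radius serves the uniform continuity of f and of all its partial derivatives,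
  -- and keeps the support inside Ω.
  obtain ⟨ρ, hρ, hρ0, hρr, hρi⟩ : ∃ ρ > 0, ρ ≤ δ₀ ∧ ρ ≤ r ∧ ∀ i, ρ ≤ δ i := by
    have hev : ∀ᶠ ρ in 𝓝[>] (0 : ℝ), ρ ≤ δ₀ ∧ ρ ≤ r ∧ ∀ i, ρ ≤ δ i := by
      have : ∀ a : ℝ, 0 < a → ∀ᶠ ρ in 𝓝[>] (0 : ℝ), ρ ≤ a := fun a ha =>
        nhdsWithin_le_nhds (eventually_le_nhds ha)
      exact (this _ hδ₀).and ((this _ hr).and (eventually_all.2 fun i => this _ (hδ i)))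
    obtain ⟨ρ, h1, h2⟩ := (hev.and self_mem_nhdsWithin).exists
    exact ⟨ρ, h2, h1⟩
  let b : ContDiffBump (0 : Space d) := ⟨ρ / 2, ρ, by positivity, by linarith⟩
  set φ : Space d → ℂ := b.normed volume ⋆[ContinuousLinearMap.lsmul ℝ ℝ, volume] f with hφ
  have hbl : LocallyIntegrable (b.normed (volume : Measure (Space d))) :=
    b.continuous_normed.locallyIntegrable
  have hsm : ContDiff ℝ ∞ φ :=
    b.hasCompactSupport_normed.contDiff_convolution_left _ b.contDiff_normed
      hf.continuous.locallyIntegrable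
  have hsup : tsupport φ ⊆ Metric.cthickening r (tsupport f) := by
    refine closure_minimal ?_ Metric.isClosed_cthickening
    refine (support_convolution_subset (ContinuousLinearMap.lsmul ℝ ℝ)).trans ?_
    rintro _ ⟨x, hx, y, hy, rfl⟩
    rw [b.support_normed_eq, mem_ball_zero_iff] at hx
    refine Metric.mem_cthickening_of_dist_le (x + y) y r _ (subset_tsupport _ hy) ?_
    rw [dist_eq_norm, add_sub_cancel_right]
    exact hx.le.trans hρr
  have hfd : ∀ x v, fderiv ℝ φ x v = (b.normed volume ⋆[ContinuousLinearMap.lsmul ℝ ℝ, volume]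
      fun y => fderiv ℝ f y v) x := fun x v => by
    rw [(hc.hasFDerivAt_convolution_right (ContinuousLinearMap.lsmul ℝ ℝ) hbl hf x).fderiv,
      convolution_precompR_apply _ hbl (hc.fderiv ℝ) (hf.continuous_fderiv (by norm_num))]
  have hle : ε' ≤ ε := div_le_self hε.le (by linarith [Nat.cast_nonneg (α := ℝ) d])
  refine ⟨φ, ⟨hsm, ?_, hsup.trans hrΩ⟩, fun x => ?_, fun x => ?_⟩
  · exact HasCompactSupport.of_support_subset_isCompact hc.isCompact.cthickening
      ((subset_tsupport _).trans hsup)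
  · rw [← dist_eq_norm]
    refine (b.dist_normed_convolution_le hf.continuous.aestronglyMeasurable fun y hy => ?_).trans hle
    exact h₀ y x (hy.trans_le hρ0)
  · calc ‖grad φ x - grad f x‖ ≤ ∑ i, ‖(grad φ x - grad f x) i‖ := norm_le_sum_norm _
      _ ≤ ∑ _i : Fin d, ε' := by
          refine Finset.sum_le_sum fun i _ => ?_
          rw [PiLp.sub_apply, grad_apply, grad_apply, ← dist_eq_norm, hfd]
          exact b.dist_normed_convolution_le (hD i).aestronglyMeasurable fun y hy =>
            hδ' i y x (hy.trans_le (hρi i))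
      _ = d * ε' := by simp
      _ ≤ ε := by
          rw [hε', mul_div_assoc', div_le_iff₀ (by positivity)]
          nlinarith [Nat.cast_nonneg (α := ℝ) d]

/-- Needed because truncations of space factors are only C². On a set of finite measure the uniform
convergence of mollifications and of their gradients is convergence in V. -/
theorem exists_isRep_of_contDiff_one {f : Space d → ℂ} (hΩ : IsOpen Ω) (hv : volume Ω ≠ ⊤)
    (hf : ContDiff ℝ 1 f) (hc : HasCompactSupport f) (hs : tsupport f ⊆ Ω) :
    ∃ v : VSpace Ω, IsRep v f := by
  have h1 : MemLp f 2 (volume.restrict Ω) :=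
    (hf.continuous.memLp_of_hasCompactSupport hc).restrict _
  have h2 : MemLp (grad f) 2 (volume.restrict Ω) :=
    ((continuous_grad hf).memLp_of_hasCompactSupport (hasCompactSupport_grad hc)).restrict _
  choose φ hφ e1 e2 using fun n : ℕ => exists_test_approx hΩ hf hc hs (ε := 1 / ((n : ℝ) + 1))
    (by positivity)
  choose v hvr using fun n => exists_isRep_of_test (hφ n)
  have hlim : Tendsto (fun n : ℕ => (volume Ω).toReal ^ (1 / 2 : ℝ) * (1 / ((n : ℝ) + 1))) atTop
      (𝓝 0) := by
    simpa using tendsto_one_div_add_atTop_nhds_zero_nat.const_mul ((volume Ω).toReal ^ (1 / 2 : ℝ))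
  obtain ⟨w, hw1, hw2⟩ := exists_vSpace_of_tendsto (v := v) (l := atTop) (a := h1.toLp) (b := h2.toLp)
    (by
      rw [tendsto_iff_norm_sub_tendsto_zero]
      refine squeeze_zero (fun _ => norm_nonneg _) (fun n => ?_) hlim
      refine norm_lp_le_of_bound hv (by positivity) ?_
      filter_upwards [Lp.coeFn_sub (toH (v n)) h1.toLp, (hvr n).1, h1.coeFn_toLp] with x a b c
      rw [a, Pi.sub_apply, b, c]
      exact e1 n x)
    (by
      rw [tendsto_iff_norm_sub_tendsto_zero]
      refine squeeze_zero (fun _ => norm_nonneg _) (fun n => ?_) hlim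
      refine norm_lp_le_of_bound hv (by positivity) ?_
      filter_upwards [Lp.coeFn_sub (weakGrad (v n)) h2.toLp, (hvr n).2, h2.coeFn_toLp] with x a b c
      rw [a, Pi.sub_apply, b, c]
      exact e2 n x)
  exact ⟨w, hw1 ▸ h1.coeFn_toLp, hw2 ▸ h2.coeFn_toLp⟩

end Mollification

/-! ### The Poincaré inequality. -/

section Poincare

open Filter Topology

variable {d : ℕ} {Ω : Set (Space d)}

theorem norm_fderiv_single_le_grad (φ : Space d → ℂ) (x : Space d) (i : Fin d) :
    ‖fderiv ℝ φ x (EuclideanSpace.single i 1)‖ ≤ ‖grad φ x‖ :=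
  PiLp.norm_apply_le (grad φ x) i

/-- Product rule and Young's inequality; the weight ½ lets `poincare_test` absorb the first term.
The bound on `c` is asked only where φ ≠ 0, because the derivative of |φ|² vanishes elsewhere. -/
theorem norm_mul_fderiv_normSq_le {φ : Space d → ℂ} {x : Space d} (hd : DifferentiableAt ℝ φ x)
    (i : Fin d) {c : ℂ} {R : ℝ} (hR : φ x ≠ 0 → ‖c‖ ≤ R) :
    ‖c * fderiv ℝ (fun x => φ x * star (φ x)) x (EuclideanSpace.single i 1)‖ ≤
      1 / 2 * ‖φ x‖ ^ 2 + 2 * R ^ 2 * ‖grad φ x‖ ^ 2 := by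
  set e : Space d := EuclideanSpace.single i 1
  have hds : DifferentiableAt ℝ (fun x => star (φ x)) x :=
    Complex.conjCLE.differentiableAt.comp x hd
  have hfd : fderiv ℝ (fun x => φ x * star (φ x)) x e =
      φ x * star (fderiv ℝ φ x e) + star (φ x) * fderiv ℝ φ x e := by
    rw [fderiv_fun_mul hd hds, add_apply, smul_apply, smul_apply, fderiv_star_apply]
    rfl
  by_cases hx : φ x = 0
  · rw [hfd, hx, star_zero, zero_mul, zero_mul, add_zero, mul_zero, norm_zero]
    positivity
  · have hfe : ‖fderiv ℝ φ x e‖ ≤ ‖grad φ x‖ := norm_fderiv_single_le_grad φ x i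
    have h6 : ‖fderiv ℝ (fun x => φ x * star (φ x)) x e‖ ≤ 2 * (‖φ x‖ * ‖grad φ x‖) := by
      rw [hfd]
      refine (norm_add_le _ _).trans ?_
      rw [norm_mul, norm_mul, norm_star, norm_star]
      nlinarith [norm_nonneg (φ x)]
    have hR0 : 0 ≤ R := (norm_nonneg _).trans (hR hx)
    rw [norm_mul]
    calc ‖c‖ * ‖fderiv ℝ (fun x => φ x * star (φ x)) x e‖
        ≤ R * (2 * (‖φ x‖ * ‖grad φ x‖)) := by gcongr; exact hR hx
      _ ≤ _ := by nlinarith [sq_nonneg (‖φ x‖ - 2 * R * ‖grad φ x‖)]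

theorem integrable_norm_sq {E : Type*} [NormedAddCommGroup E] {f : Space d → E} (hf : Continuous f)
    (hc : HasCompactSupport f) : Integrable (fun x => ‖f x‖ ^ 2) := by
  refine (hf.norm.pow 2).integrable_of_hasCompactSupport (hc.mono fun x hx => ?_)
  rw [Function.mem_support] at hx ⊢
  intro h
  simp [h] at hx

theorem exists_coordinate (i : Fin d) : ∃ L : Space d →L[ℝ] ℂ,
    L (EuclideanSpace.single i 1) = 1 ∧ ∀ x, ‖L x‖ ≤ ‖x‖ := by
  refine ⟨Complex.ofRealCLM ∘L (innerSL ℝ (EuclideanSpace.single i 1)), by simp, fun x => ?_⟩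
  have : ‖(Complex.ofRealCLM ∘L (innerSL ℝ (EuclideanSpace.single i 1))) x‖ =
    |inner ℝ (EuclideanSpace.single i 1) x| := by simp
  rw [this]
  exact (abs_real_inner_le_norm _ x).trans (by simp)

/-- Write the factor 1 in ∫ |φ|² as the derivative of the first coordinate, which exists as 0 < d,
and integrate by parts: ∫ |φ|² = -∫ x₁ ∂₁|φ|². Then |x₁| ≤ R where φ ≠ 0. -/
theorem poincare_test {φ : Space d → ℂ} (hd : 0 < d) (hφ : IsTest Ω φ) {R : ℝ}
    (hR : ∀ x ∈ Ω, ‖x‖ ≤ R) : ∫ x in Ω, ‖φ x‖ ^ 2 ≤ 4 * R ^ 2 * ∫ x in Ω, ‖grad φ x‖ ^ 2 := by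
  obtain ⟨L, hLe, hLn⟩ := exists_coordinate (⟨0, hd⟩ : Fin d)
  generalize he : (EuclideanSpace.single (⟨0, hd⟩ : Fin d) (1 : ℝ) : Space d) = e at hLe
  have h1 : ContDiff ℝ 1 φ := hφ.contDiff.of_le (by norm_cast)
  have hd1 : ∀ x, DifferentiableAt ℝ φ x := fun x => (h1.differentiable (by norm_num)) x
  have h2 : ContDiff ℝ 1 (fun x => φ x * star (φ x)) := h1.mul (contDiff_star h1)
  have hp := (integral_mul_fderiv_test (f := L) (g := fun x => φ x * star (φ x)) isOpen_univ
    L.contDiff.contDiffOn h2 hφ.hasCompactSupport.mul_right (subset_univ _) e)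
  have hi2 := integrable_norm_sq h1.continuous hφ.hasCompactSupport
  have hi3 := integrable_norm_sq (continuous_grad h1) (hasCompactSupport_grad hφ.hasCompactSupport)
  have hz : ∀ x, x ∉ Ω → φ x = 0 := fun x hx =>
    image_eq_zero_of_notMem_tsupport fun h => hx (hφ.tsupport_subset h)
  have hgz : ∀ x, x ∉ Ω → grad φ x = 0 := fun x hx => by
    have : fderiv ℝ φ x = 0 := image_eq_zero_of_notMem_tsupport fun h =>
      hx (hφ.tsupport_subset (tsupport_fderiv_subset ℝ h))
    ext i; simp [grad_apply, this]
  rw [setIntegral_eq_integral_of_forall_compl_eq_zero fun x hx => by simp [hz x hx],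
    setIntegral_eq_integral_of_forall_compl_eq_zero fun x hx => by simp [hgz x hx]]
  have h3 : ∫ x, ‖φ x‖ ^ 2 ≤ ∫ x, (1 / 2 * ‖φ x‖ ^ 2 + 2 * R ^ 2 * ‖grad φ x‖ ^ 2) := by
    have h4 := hp.2.2
    simp only [Measure.restrict_univ, ContinuousLinearMap.fderiv, hLe, one_mul] at h4
    have h5 : ∫ x, φ x * star (φ x) = ((∫ x, ‖φ x‖ ^ 2 : ℝ) : ℂ) := by
      rw [← integral_complex_ofReal]
      refine integral_congr_ae (Eventually.of_forall fun x => ?_)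
      simp [Complex.mul_conj, Complex.normSq_eq_norm_sq]
    rw [h5] at h4
    calc ∫ x, ‖φ x‖ ^ 2 ≤ ‖((∫ x, ‖φ x‖ ^ 2 : ℝ) : ℂ)‖ := by
          rw [Complex.norm_real]; exact le_abs_self _
      _ = ‖∫ x, L x * fderiv ℝ (fun x => φ x * star (φ x)) x e‖ := by rw [h4, norm_neg]
      _ ≤ ∫ x, ‖L x * fderiv ℝ (fun x => φ x * star (φ x)) x e‖ := norm_integral_le_integral_norm _
      _ ≤ _ := by
          refine integral_mono hp.1.norm ((hi2.const_mul _).add (hi3.const_mul _)) fun x => ?_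
          subst he
          exact norm_mul_fderiv_normSq_le (hd1 x) ⟨0, hd⟩ fun hx =>
            (hLn x).trans (hR x (by_contra fun h => hx (hz x h)))
  rw [integral_add (hi2.const_mul _) (hi3.const_mul _), integral_const_mul, integral_const_mul] at h3
  linarith

/-- The Poincaré inequality. -/
theorem poincare (hd : 0 < d) {R : ℝ} (hR : ∀ x ∈ Ω, ‖x‖ ≤ R) (v : VSpace Ω) :
    ‖toH v‖ ^ 2 ≤ 4 * R ^ 2 * ‖weakGrad v‖ ^ 2 := by
  obtain ⟨φ, w, hφ, hw, hlim⟩ := exists_test_tendsto v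
  have h1 : Tendsto (fun n => ‖toH (w n)‖ ^ 2) atTop (𝓝 (‖toH v‖ ^ 2)) :=
    (((toH (Ω := Ω)).continuous.tendsto v).comp hlim).norm.pow 2
  have h2 : Tendsto (fun n => 4 * R ^ 2 * ‖weakGrad (w n)‖ ^ 2) atTop
      (𝓝 (4 * R ^ 2 * ‖weakGrad v‖ ^ 2)) :=
    ((((weakGrad (Ω := Ω)).continuous.tendsto v).comp hlim).norm.pow 2).const_mul _
  refine le_of_tendsto_of_tendsto' h1 h2 fun n => ?_
  rw [norm_sq_lp_eq_integral (hw n).1, norm_sq_lp_eq_integral (hw n).2]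
  exact poincare_test hd (hφ n) hR

end Poincare

/-! ### Membership of real classical functions in H¹₀, by truncation of small values. -/

section SpaceFactor

open Filter Topology

variable {d : ℕ} {Ω : Set (Space d)}

theorem abs_primitive_le_of_support {h : ℝ → ℝ} (hc : Continuous h) {m : ℝ} (hm : 0 ≤ m)
    (h1 : ∀ s, |h s| ≤ 1) (h0 : ∀ s, m ≤ |s| → h s = 0) (x : ℝ) :
    |∫ s in (0 : ℝ)..x, h s| ≤ 2 * m := by
  have hi : Integrable ((Icc (-m) m).indicator fun _ => (1 : ℝ)) :=
    (integrable_indicator_iff measurableSet_Icc).2 (by simp)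
  calc |∫ s in (0 : ℝ)..x, h s| ≤ ∫ s in uIoc 0 x, ‖h s‖ := by
        rw [← Real.norm_eq_abs]; exact intervalIntegral.norm_integral_le_integral_norm_uIoc
    _ ≤ ∫ s in uIoc 0 x, (Icc (-m) m).indicator (fun _ => (1 : ℝ)) s := by
        refine setIntegral_mono (hc.norm.integrableOn_uIoc) hi.integrableOn fun s => ?_
        by_cases hs : s ∈ Icc (-m) m
        · rw [indicator_of_mem hs]; exact h1 s
        · rw [indicator_of_notMem hs, h0 s, norm_zero]
          by_contra hlt
          exact hs (abs_le.1 (not_le.1 hlt).le)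
    _ ≤ ∫ s, (Icc (-m) m).indicator (fun _ => (1 : ℝ)) s :=
        setIntegral_le_integral hi (Eventually.of_forall fun s =>
          indicator_nonneg (fun _ _ => zero_le_one) s)
    _ = 2 * m := by
        rw [integral_indicator measurableSet_Icc]
        simp [hm, two_mul]

theorem continuous_laplacian {φ : Space d → ℂ} (h : ContDiff ℝ 2 φ) :
    Continuous (Laplacian.laplacian φ) := by
  have : Laplacian.laplacian φ = fun x => ∑ i, fderiv ℝ (fun y => fderiv ℝ φ y
      (EuclideanSpace.single i 1)) x (EuclideanSpace.single i 1) :=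
    funext fun x => laplacian_eq_sum h.contDiffAt
  rw [this]
  refine continuous_finsetSum _ fun i _ => ?_
  exact (((h.fderiv_right (m := 1) (by norm_num)).clm_apply contDiff_const).continuous_fderiv
    (by norm_num)).clm_apply continuous_const

theorem support_laplacian_subset (φ : Space d → ℂ) :
    Function.support (Laplacian.laplacian φ) ⊆ tsupport φ := by
  intro x hx
  by_contra h
  apply hx
  rw [(InnerProductSpace.laplacian_congr_nhds (notMem_tsupport_iff_eventuallyEq.1 h)).eq_of_nhds]
  exact congrFun (InnerProductSpace.laplacian_const (c := (0 : ℂ))) x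

theorem memLp_laplacian_of_hasCompactSupport {φ : Space d → ℂ} (h : ContDiff ℝ 2 φ)
    (hc : HasCompactSupport φ) : MemLp (Laplacian.laplacian φ) 2 (volume.restrict Ω) :=
  ((continuous_laplacian h).memLp_of_hasCompactSupport
    (HasCompactSupport.of_support_subset_isCompact hc (support_laplacian_subset φ))).restrict _

/-- As r is continuous on the compact closure and zero on the boundary, |r| ≥ ε holds only on a
compact subset of Ω, and g ∘ r lives there. Cutting off by the value of r instead of the distance to
the boundary needs no regularity of the boundary. -/
theorem trunc_comp_contDiff {r : Space d → ℝ} {g : ℝ → ℝ} {n : WithTop ℕ∞} (hΩ : IsOpen Ω)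
    (hb : Bornology.IsBounded Ω) (hr : ContDiffOn ℝ n r Ω) (hrc : ContinuousOn r (closure Ω))
    (hr0 : ∀ x ∈ frontier Ω, r x = 0) (hg : ContDiff ℝ n g) {ε : ℝ} (hε : 0 < ε)
    (hg0 : ∀ s, |s| < ε → g s = 0) :
    ContDiff ℝ n (Ω.indicator fun x => (g (r x) : ℂ)) ∧
      HasCompactSupport (Ω.indicator fun x => (g (r x) : ℂ)) ∧
      tsupport (Ω.indicator fun x => (g (r x) : ℂ)) ⊆ Ω := by
  set w : Space d → ℂ := Ω.indicator fun x => (g (r x) : ℂ) with hw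
  set K : Set (Space d) := closure Ω ∩ r ⁻¹' {s | ε ≤ |s|} with hK
  have hKc : IsClosed K :=
    hrc.preimage_isClosed_of_isClosed isClosed_closure (isClosed_le continuous_const continuous_abs)
  have hKΩ : K ⊆ Ω := by
    intro x hx
    by_contra hn
    have : x ∈ frontier Ω := by rw [hΩ.frontier_eq]; exact ⟨hx.1, hn⟩
    have h2 := hx.2
    simp only [mem_preimage, hr0 x this, mem_ofPred_eq, abs_zero] at h2
    linarith
  have hsup : Function.support w ⊆ K := by
    intro x hx
    have hxΩ : x ∈ Ω := by
      by_contra h; exact hx (indicator_of_notMem h _)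
    refine ⟨subset_closure hxΩ, ?_⟩
    by_contra h
    apply hx
    rw [hw, indicator_of_mem hxΩ, hg0 _ (not_le.1 h), Complex.ofReal_zero]
  have hKcomp : IsCompact K :=
    Metric.isCompact_of_isClosed_isBounded hKc (hb.closure.subset inter_subset_left)
  have hts : tsupport w ⊆ Ω := (closure_minimal hsup hKc).trans hKΩ
  refine ⟨?_, HasCompactSupport.of_support_subset_isCompact hKcomp hsup, hts⟩
  refine contDiff_iff_contDiffAt.2 fun x => ?_
  by_cases hx : x ∈ tsupport w
  swap
  · exact contDiffAt_const.congr_of_eventuallyEq (notMem_tsupport_iff_eventuallyEq.1 hx)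
  have hx' := hΩ.mem_nhds (hts hx)
  have h1 : ContDiffAt ℝ n (fun x => (g (r x) : ℂ)) x :=
    Complex.ofRealCLM.contDiff.contDiffAt.comp x (hg.contDiffAt.comp x (hr.contDiffAt hx'))
  refine h1.congr_of_eventuallyEq ?_
  filter_upwards [hx'] with y hy
  rw [hw, indicator_of_mem hy]

theorem grad_ofReal_comp {r : Space d → ℝ} {g : ℝ → ℝ} {x : Space d} {g' : ℝ}
    (hr : DifferentiableAt ℝ r x) (hg : HasDerivAt g g' (r x)) :
    grad (fun y => (g (r y) : ℂ)) x = (g' : ℂ) • grad (fun y => (r y : ℂ)) x := by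
  have h1 : HasFDerivAt (fun y => (r y : ℂ)) (Complex.ofRealCLM ∘L fderiv ℝ r x) x :=
    Complex.ofRealCLM.hasFDerivAt.comp x hr.hasFDerivAt
  have h2 : HasFDerivAt (fun y => (g (r y) : ℂ)) (Complex.ofRealCLM ∘L (g' • fderiv ℝ r x)) x :=
    Complex.ofRealCLM.hasFDerivAt.comp x (hg.comp_hasFDerivAt x hr.hasFDerivAt)
  ext i
  simp [grad_apply, h1.fderiv, h2.fderiv]

theorem grad_congr {φ ψ : Space d → ℂ} {x : Space d} (h : φ =ᶠ[𝓝 x] ψ) : grad φ x = grad ψ x := by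
  ext i; simp [grad_apply, h.fderiv_eq]

/-- The derivative of the smooth truncation function with threshold `1 / (n + 1)`. -/
def truncDeriv (n : ℕ) (s : ℝ) : ℝ := Real.smoothTransition ((s * (n + 1)) ^ 2 - 1)

/-- The smooth truncation function with threshold `1 / (n + 1)`. -/
def trunc (n : ℕ) (s : ℝ) : ℝ := ∫ τ in (0 : ℝ)..s, truncDeriv n τ

theorem contDiff_truncDeriv (n : ℕ) : ContDiff ℝ ∞ (truncDeriv n) :=
  Real.smoothTransition.contDiff.comp (((contDiff_id.mul contDiff_const).pow 2).sub contDiff_const)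

theorem truncDeriv_eq_zero {n : ℕ} {s : ℝ} (h : |s| ≤ 1 / (n + 1)) : truncDeriv n s = 0 := by
  refine Real.smoothTransition.zero_of_nonpos ?_
  have h1 : |s * (n + 1)| ≤ 1 := by
    rw [abs_mul, abs_of_pos (by positivity : (0 : ℝ) < n + 1)]
    rwa [le_div_iff₀ (by positivity)] at h
  have := (sq_le_one_iff_abs_le_one _).2 h1
  linarith

theorem truncDeriv_eq_one {n : ℕ} {s : ℝ} (h : 2 / (n + 1) ≤ |s|) : truncDeriv n s = 1 := by
  refine Real.smoothTransition.one_of_one_le ?_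
  have h1 : 2 ≤ |s * (n + 1)| := by
    rw [abs_mul, abs_of_pos (by positivity : (0 : ℝ) < n + 1)]
    rwa [div_le_iff₀ (by positivity)] at h
  rw [← sq_abs]
  nlinarith

theorem truncDeriv_nonneg (n : ℕ) (s : ℝ) : 0 ≤ truncDeriv n s := Real.smoothTransition.nonneg _

theorem truncDeriv_le_one (n : ℕ) (s : ℝ) : truncDeriv n s ≤ 1 := Real.smoothTransition.le_one _

theorem primitive_eq_zero {h : ℝ → ℝ} {ε : ℝ} (h0 : ∀ s, |s| ≤ ε → h s = 0) (x : ℝ)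
    (hx : |x| < ε) : ∫ s in (0 : ℝ)..x, h s = 0 := by
  refine intervalIntegral.integral_zero_ae (Eventually.of_forall fun s hs => h0 s ?_)
  refine le_trans ?_ hx.le
  have h1 := uIoc_subset_uIcc hs
  simpa using abs_sub_left_of_mem_uIcc h1

theorem abs_trunc_sub_self_le (n : ℕ) (s : ℝ) : |trunc n s - s| ≤ 4 / (n + 1) := by
  have h1 : trunc n s - s = ∫ τ in (0 : ℝ)..s, (truncDeriv n τ - 1) := by
    rw [intervalIntegral.integral_sub ((contDiff_truncDeriv n).continuous.intervalIntegrable _ _)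
      (continuous_const.intervalIntegrable _ _)]
    simp [trunc]
  rw [h1]
  refine (abs_primitive_le_of_support (h := fun τ => truncDeriv n τ - 1)
    ((contDiff_truncDeriv n).continuous.sub continuous_const) (m := 2 / (n + 1)) (by positivity)
    (fun s => ?_) (fun s hs => ?_) s).trans (le_of_eq (by ring))
  · rw [abs_le]; constructor <;> linarith [truncDeriv_nonneg n s, truncDeriv_le_one n s]
  · rw [truncDeriv_eq_one hs, sub_self]

/-- The truncations of a classical function with square integrable Laplacian and zero boundary
values form a Cauchy sequence in `H¹`. -/
theorem integral_truncDeriv_sub_le {r : Space d → ℝ} (hΩ : IsOpen Ω) (hb : Bornology.IsBounded Ω)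
    (hr : ContDiffOn ℝ 2 r Ω) (hrc : ContinuousOn r (closure Ω)) (hr0 : ∀ x ∈ frontier Ω, r x = 0)
    (hL : Integrable (Laplacian.laplacian fun x => (r x : ℂ)) (volume.restrict Ω)) {k m n : ℕ}
    (hkm : k ≤ m) (hkn : k ≤ n) :
    ∫ x in Ω, ((truncDeriv m (r x) - truncDeriv n (r x)) ^ 2) * ‖grad (fun y => (r y : ℂ)) x‖ ^ 2 ≤
      4 / (k + 1) * ∫ x in Ω, ‖Laplacian.laplacian (fun x => (r x : ℂ)) x‖ := by
  set h : ℝ → ℝ := fun s => (truncDeriv m s - truncDeriv n s) ^ 2 with hh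
  have hcd : ContDiff ℝ ∞ h := ((contDiff_truncDeriv m).sub (contDiff_truncDeriv n)).pow 2
  -- Green's formula is tested with F(r): its gradient h(r)∇r reproduces the left side, while F is
  -- uniformly small because 0 ≤ h ≤ 1 and h vanishes for |s| ≥ 2/(k+1). F vanishes near 0, so F(r)
  -- has compact support in Ω.
  set F : ℝ → ℝ := fun s => ∫ τ in (0 : ℝ)..s, h τ with hF
  have hFd : ∀ s, HasDerivAt F (h s) s := hasDerivAt_primitive hcd.continuous
  have hmono : ∀ {a b : ℕ}, a ≤ b → (1 : ℝ) / (b + 1) ≤ 1 / (a + 1) := fun hab => by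
    have : (_ : ℝ) ≤ _ := Nat.cast_le (α := ℝ).2 hab
    gcongr
  have hmono2 : ∀ {a b : ℕ}, a ≤ b → (2 : ℝ) / (b + 1) ≤ 2 / (a + 1) := fun hab => by
    have : (_ : ℝ) ≤ _ := Nat.cast_le (α := ℝ).2 hab
    gcongr
  have hFb : ∀ s, |F s| ≤ 4 / (k + 1) := fun s => by
    refine (abs_primitive_le_of_support hcd.continuous (m := 2 / (k + 1)) (by positivity)
      (fun s => ?_) (fun s hs => ?_) s).trans (le_of_eq (by ring))
    · rw [abs_of_nonneg (sq_nonneg _)]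
      rw [sq_le_one_iff_abs_le_one, abs_le]
      constructor <;> linarith [truncDeriv_nonneg n s, truncDeriv_le_one n s,
        truncDeriv_nonneg m s, truncDeriv_le_one m s]
    · simp only [hh]
      rw [truncDeriv_eq_one ((hmono2 hkm).trans hs), truncDeriv_eq_one ((hmono2 hkn).trans hs)]
      ring
  have hF0 : ∀ s, |s| < 1 / ((max m n : ℕ) + 1 : ℝ) → F s = 0 := by
    refine primitive_eq_zero fun s hs => ?_
    simp only [hh]
    rw [truncDeriv_eq_zero (hs.trans (hmono (le_max_left m n))),
      truncDeriv_eq_zero (hs.trans (hmono (le_max_right m n)))]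
    ring
  obtain ⟨c1, c2, c3⟩ := trunc_comp_contDiff (n := 1) hΩ hb (hr.of_le (by norm_num)) hrc hr0
    ((contDiff_primitive hcd).of_le (by norm_cast)) (by positivity) hF0
  set χ : Space d → ℂ := Ω.indicator fun x => (F (r x) : ℂ) with hχ
  have hRc : ContDiffOn ℝ 2 (fun x => (r x : ℂ)) Ω := Complex.ofRealCLM.contDiff.comp_contDiffOn hr
  have hgreen := green_left hΩ hRc c1 c2 c3
  have hpt : ∀ x ∈ Ω, inner ℂ (grad χ x) (grad (fun y => (r y : ℂ)) x) =
      ((h (r x) * ‖grad (fun y => (r y : ℂ)) x‖ ^ 2 : ℝ) : ℂ) := fun x hx => by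
    have hx' := hΩ.mem_nhds hx
    have e1 : grad χ x = grad (fun y => (F (r y) : ℂ)) x := grad_congr <| by
      filter_upwards [hx'] with y hy
      rw [hχ, indicator_of_mem hy]
    rw [e1, grad_ofReal_comp ((hr.contDiffAt hx').differentiableAt (by norm_num)) (hFd _),
      inner_smul_left, inner_self_eq_norm_sq_to_K]
    simp
  rw [setIntegral_congr_fun hΩ.measurableSet hpt, integral_complex_ofReal] at hgreen
  have h5 : ∫ x in Ω, h (r x) * ‖grad (fun y => (r y : ℂ)) x‖ ^ 2 ≤
      ‖∫ x in Ω, star (χ x) * Laplacian.laplacian (fun x => (r x : ℂ)) x‖ := by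
    rw [hgreen, norm_neg, Complex.norm_real]
    exact le_abs_self _
  refine h5.trans ((norm_integral_le_integral_norm _).trans ?_)
  rw [← integral_const_mul]
  refine integral_mono_of_nonneg (Eventually.of_forall fun _ => norm_nonneg _)
    (hL.norm.const_mul _) (Eventually.of_forall fun x => ?_)
  simp only [norm_mul, norm_star]
  gcongr
  by_cases hx : x ∈ Ω
  · rw [hχ, indicator_of_mem hx, Complex.norm_real]; exact hFb _
  · rw [hχ, indicator_of_notMem hx, norm_zero]; positivity

/-- A real classical function with square integrable Laplacian and zero boundary values belongs
to `H¹₀`, and satisfies Green's formula there. -/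
theorem exists_vSpace_of_real {r : Space d → ℝ} (hΩ : IsOpen Ω) (hb : Bornology.IsBounded Ω)
    (hr : ContDiffOn ℝ 2 r Ω) (hrc : ContinuousOn r (closure Ω)) (hr0 : ∀ x ∈ frontier Ω, r x = 0)
    (hL : MemLp (Laplacian.laplacian fun x => (r x : ℂ)) 2 (volume.restrict Ω)) :
    ∃ v : VSpace Ω, toH v =ᵐ[volume.restrict Ω] (fun x => (r x : ℂ)) ∧
      ∀ χ : VSpace Ω, inner ℂ (weakGrad χ) (weakGrad v) = -inner ℂ (toH χ) hL.toLp := by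
  have hv : volume Ω ≠ ⊤ := hb.measure_lt_top.ne
  have : IsFiniteMeasure (volume.restrict Ω) := ⟨by simpa using hv.lt_top⟩
  have hLi : Integrable (Laplacian.laplacian fun x => (r x : ℂ)) (volume.restrict Ω) :=
    hL.integrable (by norm_num)
  have hRc : ContDiffOn ℝ 2 (fun x => (r x : ℂ)) Ω := Complex.ofRealCLM.contDiff.comp_contDiffOn hr
  have hRm : MemLp (fun x => (r x : ℂ)) 2 (volume.restrict Ω) := by
    have hcomp : IsCompact (closure Ω) := hb.isCompact_closure
    obtain ⟨C, hC⟩ := hcomp.exists_bound_of_continuousOn hrc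
    refine MemLp.of_bound (hRc.continuousOn.aestronglyMeasurable hΩ.measurableSet) C ?_
    filter_upwards [ae_restrict_mem hΩ.measurableSet] with x hx
    rw [Complex.norm_real]; exact hC x (subset_closure hx)
  -- The truncations converge to r uniformly and their gradients are Cauchy in L², so r lies in V,
  -- although no integrability of its gradient was assumed.
  set w : ℕ → Space d → ℂ := fun n => Ω.indicator fun x => (trunc n (r x) : ℂ) with hw
  have hwc := fun n : ℕ => trunc_comp_contDiff (n := 2) hΩ hb hr hrc hr0
    ((contDiff_primitive (contDiff_truncDeriv n)).of_le (by norm_cast))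
    (by positivity : (0 : ℝ) < 1 / (n + 1)) (primitive_eq_zero fun _ h => truncDeriv_eq_zero h)
  have hw1 : ∀ n, ContDiff ℝ 1 (w n) := fun n => (hwc n).1.of_le (by norm_num)
  choose v hvr using fun n => exists_isRep_of_contDiff_one hΩ hv (hw1 n) (hwc n).2.1 (hwc n).2.2
  have hgw : ∀ n, ∀ x ∈ Ω, grad (w n) x =
      (truncDeriv n (r x) : ℂ) • grad (fun y => (r y : ℂ)) x := fun n x hx => by
    have hx' := hΩ.mem_nhds hx
    have e1 : grad (w n) x = grad (fun y => (trunc n (r y) : ℂ)) x := grad_congr <| by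
      filter_upwards [hx'] with y hy
      rw [hw]; exact indicator_of_mem hy _
    rw [e1, grad_ofReal_comp ((hr.contDiffAt hx').differentiableAt (by norm_num))
      (show HasDerivAt (trunc n) (truncDeriv n (r x)) (r x) from
        hasDerivAt_primitive (contDiff_truncDeriv n).continuous _)]
  have hlimH : Tendsto (fun n => toH (v n)) atTop (𝓝 hRm.toLp) := by
    rw [tendsto_iff_norm_sub_tendsto_zero]
    have hlim : Tendsto (fun n : ℕ => (volume Ω).toReal ^ (1 / 2 : ℝ) * (4 / ((n : ℝ) + 1))) atTop
        (𝓝 0) := by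
      have := (tendsto_one_div_add_atTop_nhds_zero_nat (𝕜 := ℝ)).const_mul
        ((volume Ω).toReal ^ (1 / 2 : ℝ) * 4)
      rw [mul_zero] at this
      exact this.congr fun n => by ring
    refine squeeze_zero (fun _ => norm_nonneg _) (fun n => ?_) hlim
    refine norm_lp_le_of_bound hv (by positivity) ?_
    filter_upwards [Lp.coeFn_sub (toH (v n)) hRm.toLp, (hvr n).1, hRm.coeFn_toLp,
      ae_restrict_mem hΩ.measurableSet] with x a b c hx
    rw [a, Pi.sub_apply, b, c, hw]
    simp only
    rw [indicator_of_mem hx, ← Complex.ofReal_sub, Complex.norm_real]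
    exact abs_trunc_sub_self_le n _
  have hcau : CauchySeq fun n => weakGrad (v n) := by
    set I := ∫ x in Ω, ‖Laplacian.laplacian (fun x => (r x : ℂ)) x‖
    refine cauchySeq_of_le_tendsto_0 (fun k : ℕ => √(4 / (k + 1) * I)) (fun n m k hn hm => ?_) ?_
    · rw [dist_eq_norm, ← map_sub]
      refine Real.le_sqrt_of_sq_le ?_
      have hd : ∀ n, ∀ x ∈ Ω, DifferentiableAt ℝ (w n) x := fun n x _ =>
        ((hw1 n).differentiable (by norm_num)) x
      rw [norm_sq_lp_eq_integral ((hvr n).sub (hvr m) (hd n) (hd m) hΩ.measurableSet).2]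
      refine le_trans (le_of_eq ?_) (integral_truncDeriv_sub_le hΩ hb hr hrc hr0 hLi hn hm)
      refine setIntegral_congr_fun hΩ.measurableSet fun x hx => ?_
      rw [grad_sub (hd n x hx) (hd m x hx), hgw n x hx, hgw m x hx, ← sub_smul, norm_smul, mul_pow,
        ← Complex.ofReal_sub, Complex.norm_real, Real.norm_eq_abs, sq_abs]
    · have := (tendsto_one_div_add_atTop_nhds_zero_nat (𝕜 := ℝ)).const_mul (4 * I)
      rw [mul_zero] at this
      have h2 := (Real.continuous_sqrt.tendsto 0).comp this
      rw [Real.sqrt_zero] at h2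
      exact h2.congr fun n => by simp only [Function.comp]; congr 1; ring
  obtain ⟨b, hbl⟩ := cauchySeq_tendsto_of_complete hcau
  obtain ⟨u, hu1, hu2⟩ := exists_vSpace_of_tendsto hlimH hbl
  refine ⟨u, hu1 ▸ hRm.coeFn_toLp, fun χ => ?_⟩
  rw [hu2]
  -- The limit gradient `b` is not identified with the classical one. Both derivatives are moved
  -- onto the test function, the limit is taken, and Green's formulas for r itself move them back.
  have htest : ∀ (ψ : Space d → ℂ) (q : VSpace Ω), IsTest Ω ψ → IsRep q ψ →
      inner ℂ (weakGrad q) b = -inner ℂ (toH q) hL.toLp := by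
    intro ψ q hψ hq
    have hψ2 : ContDiff ℝ 2 ψ := hψ.contDiff.of_le (by norm_cast)
    have hLψ : MemLp (Laplacian.laplacian ψ) 2 (volume.restrict Ω) :=
      memLp_laplacian_of_hasCompactSupport hψ2 hψ.hasCompactSupport
    have e1 : ∀ n, inner ℂ (weakGrad q) (weakGrad (v n)) = -inner ℂ hLψ.toLp (toH (v n)) := fun n => by
      rw [inner_lp_eq_integral hq.2 (hvr n).2, inner_lp_eq_integral hLψ.coeFn_toLp (hvr n).1]
      have := green_right hΩ (hw1 n).contDiffOn hψ2 hψ.hasCompactSupport hψ.tsupport_subset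
      rw [← neg_eq_iff_eq_neg.2 this]
      simp [mul_comm]
    have e2 : inner ℂ (weakGrad q) b = -inner ℂ hLψ.toLp hRm.toLp :=
      tendsto_nhds_unique (tendsto_const_nhds.inner hbl)
        (((tendsto_const_nhds.inner hlimH).neg).congr fun n => (e1 n).symm)
    rw [e2, inner_lp_eq_integral hLψ.coeFn_toLp hRm.coeFn_toLp,
      inner_lp_eq_integral hq.1 hL.coeFn_toLp]
    have g1 := green_right hΩ (hRc.of_le (by norm_num)) hψ2 hψ.hasCompactSupport hψ.tsupport_subset
    have g2 := green_left hΩ hRc (hψ.contDiff.of_le (by norm_cast)) hψ.hasCompactSupport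
      hψ.tsupport_subset
    rw [← g1] at g2
    simp only [RCLike.inner_apply]
    simpa [mul_comm] using g2.symm
  obtain ⟨ψ, q, hψ, hq, hlim⟩ := exists_test_tendsto χ
  exact tendsto_nhds_unique ((((weakGrad (Ω := Ω)).continuous.tendsto χ).comp hlim).inner
    tendsto_const_nhds) (((((toH (Ω := Ω)).continuous.tendsto χ).comp hlim).inner
      tendsto_const_nhds).neg.congr fun n => (htest _ _ (hψ n) (hq n)).symm)

end SpaceFactor

/-! ### Radial mollifiers and the mean value property. -/

section Weyl

open Filter Topology
open scoped Convolution

variable {d : ℕ} {Ω : Set (Space d)}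

/-- A radial mollifier `ρ` supported in the ball of radius `r`, and `P` with `∇P = x ρ`. -/
theorem exists_radial_mollifier {r : ℝ} (hr : 0 < r) : ∃ ρ P : Space d → ℝ,
    ContDiff ℝ ∞ ρ ∧ ContDiff ℝ ∞ P ∧ (∀ x, r ≤ ‖x‖ → ρ x = 0) ∧ (∀ x, r ≤ ‖x‖ → P x = 0) ∧
    (∀ x v, fderiv ℝ P x v = ρ x * inner ℝ x v) ∧ ∫ x, ρ x = 1 := by
  set q : ℝ → ℝ := fun s => Real.smoothTransition (1 - s / r ^ 2) with hq
  have hqc : ContDiff ℝ ∞ q :=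
    Real.smoothTransition.contDiff.comp (contDiff_const.sub (contDiff_id.div_const _))
  have hq0 : ∀ s, r ^ 2 ≤ s → q s = 0 := fun s hs => by
    refine Real.smoothTransition.zero_of_nonpos ?_
    rw [sub_nonpos, le_div_iff₀ (by positivity)]
    linarith
  -- The primitive of q normalized to vanish beyond r²; then ½ p(‖x‖²) has compact support and
  -- gradient q(‖x‖²) x.
  set p : ℝ → ℝ := fun s => (∫ τ in (0 : ℝ)..s, q τ) - ∫ τ in (0 : ℝ)..(r ^ 2), q τ with hp
  have hpc : ContDiff ℝ ∞ p := (contDiff_primitive hqc).sub contDiff_const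
  have hpd : ∀ s, HasDerivAt p (q s) s := fun s =>
    (hasDerivAt_primitive hqc.continuous s).sub_const _
  have hp0 : ∀ s, r ^ 2 ≤ s → p s = 0 := fun s hs => by
    simp only [hp]
    rw [intervalIntegral.integral_interval_sub_left (hqc.continuous.intervalIntegrable _ _)
      (hqc.continuous.intervalIntegrable _ _)]
    refine intervalIntegral.integral_zero_ae (Eventually.of_forall fun τ hτ => hq0 τ ?_)
    rw [uIoc_of_le hs] at hτ
    exact hτ.1.le
  have hns : ContDiff ℝ ∞ fun x : Space d => ‖x‖ ^ 2 := contDiff_norm_sq ℝ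
  have hsq : ∀ x : Space d, r ≤ ‖x‖ → r ^ 2 ≤ ‖x‖ ^ 2 := fun x hx => by gcongr
  have hρc : ContDiff ℝ ∞ fun x : Space d => q (‖x‖ ^ 2) := hqc.comp hns
  have hz : ∀ x : Space d, r ≤ ‖x‖ → q (‖x‖ ^ 2) = 0 := fun x hx => hq0 _ (hsq x hx)
  have hcs : HasCompactSupport fun x : Space d => q (‖x‖ ^ 2) :=
    HasCompactSupport.intro (isCompact_closedBall 0 r) fun x hx => hz x (by
      rw [mem_closedBall_zero_iff, not_le] at hx; exact hx.le)
  set c : ℝ := ∫ x : Space d, q (‖x‖ ^ 2) with hc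
  have hcpos : 0 < c := by
    refine hρc.continuous.integral_pos_of_hasCompactSupport_nonneg_nonzero hcs
      (fun x => Real.smoothTransition.nonneg _) (x := 0) ?_
    simp [hq]
  refine ⟨fun x => c⁻¹ * q (‖x‖ ^ 2), fun x => c⁻¹ * (1 / 2 * p (‖x‖ ^ 2)), contDiff_const.mul hρc,
    contDiff_const.mul (contDiff_const.mul (hpc.comp hns)), fun x hx => by simp only [hz x hx, mul_zero],
    fun x hx => by simp only [hp0 _ (hsq x hx), mul_zero], fun x v => ?_, ?_⟩
  · have h1 : HasFDerivAt (fun x : Space d => ‖x‖ ^ 2) (2 • innerSL ℝ x) x :=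
      (hasStrictFDerivAt_norm_sq x).hasFDerivAt
    have h2 := ((((hpd (‖x‖ ^ 2)).comp_hasFDerivAt x h1).const_mul (1 / 2)).const_mul c⁻¹).fderiv
    have h3 : fderiv ℝ (fun x : Space d => c⁻¹ * (1 / 2 * p (‖x‖ ^ 2))) x = _ := h2
    rw [h3]
    simp
    ring
  · rw [integral_const_mul, ← hc, inv_mul_cancel₀ hcpos.ne']

theorem hasCompactSupport_of_ball {E : Type*} [Zero E] {f : Space d → E} {r : ℝ}
    (h : ∀ x, r ≤ ‖x‖ → f x = 0) : HasCompactSupport f :=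
  HasCompactSupport.intro (isCompact_closedBall 0 r) fun x hx => h x (by
      rw [mem_closedBall_zero_iff, not_le] at hx; exact hx.le)

theorem eq_sum_single (v : Space d) : v = ∑ i, v i • EuclideanSpace.single i (1 : ℝ) := by
  ext j; simp [Pi.single_apply]

/-- The mean value property of harmonic functions. -/
theorem integral_radial_mul_eq {r : ℝ} {ρ P : Space d → ℝ} (hρ : ContDiff ℝ ∞ ρ)
    (hP : ContDiff ℝ ∞ P) (hρ0 : ∀ x, r ≤ ‖x‖ → ρ x = 0) (hP0 : ∀ x, r ≤ ‖x‖ → P x = 0)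
    (hPρ : ∀ x v, fderiv ℝ P x v = ρ x * inner ℝ x v) (h1 : ∫ x, ρ x = 1) {ψ : Space d → ℂ}
    (hψ : ContDiff ℝ ∞ ψ) (hΔ : ∀ x, ‖x‖ ≤ r → Laplacian.laplacian ψ x = 0) :
    ∫ y, (ρ y : ℂ) * ψ y = ψ 0 := by
  have hρc := hasCompactSupport_of_ball hρ0
  have hψd : ∀ x, DifferentiableAt ℝ ψ x := fun x => (hψ.differentiable (by simp)) x
  -- Dilation joins the value ψ(0), at t = 0, to the mean, at t = 1.
  set Φ : ℝ → ℂ := fun t => ∫ y, (ρ y : ℂ) * ψ (t • y) with hΦ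
  have hder : ∀ t, HasDerivAt Φ (∫ y, (ρ y : ℂ) * fderiv ℝ ψ (t • y) y) t := by
    intro t₀
    obtain ⟨C, hC⟩ := (isCompact_closedBall (0 : Space d) ((|t₀| + 1) * |r|)).exists_bound_of_continuousOn
      (hψ.continuous_fderiv (by simp)).continuousOn
    have hρC : Continuous fun y => (ρ y : ℂ) := Complex.continuous_ofReal.comp hρ.continuous
    refine (hasDerivAt_integral_of_dominated_loc_of_deriv_le (s := Metric.ball t₀ 1)
      (bound := fun y => ‖ρ y‖ * (C * |r|))
      (F' := fun t y => (ρ y : ℂ) * fderiv ℝ ψ (t • y) y) (Metric.ball_mem_nhds t₀ one_pos)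
      (Eventually.of_forall fun t => ?_) ?_ ?_ (Eventually.of_forall fun y t ht => ?_) ?_
      (Eventually.of_forall fun y t _ => ?_)).2
    · exact (hρC.mul (hψ.continuous.comp (continuous_const_smul t))).aestronglyMeasurable
    · refine (hρC.mul (hψ.continuous.comp (continuous_const_smul t₀))).integrable_of_hasCompactSupport
        (HasCompactSupport.mul_right ?_)
      exact hρc.comp_left (g := Complex.ofReal) Complex.ofReal_zero
    · exact (hρC.mul (((hψ.continuous_fderiv (by simp)).comp (continuous_const_smul t₀)).clm_apply
        continuous_id)).aestronglyMeasurable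
    · rw [norm_mul, Complex.norm_real]
      by_cases hy : r ≤ ‖y‖
      · rw [hρ0 y hy]; simp
      · have hyr : ‖y‖ ≤ |r| := (not_le.1 hy).le.trans (le_abs_self r)
        have ht' : |t| ≤ |t₀| + 1 := by
          rw [Metric.mem_ball, Real.dist_eq] at ht
          linarith [abs_sub_abs_le_abs_sub t t₀]
        have hb := hC (t • y) (by
          rw [mem_closedBall_zero_iff, norm_smul, Real.norm_eq_abs]; gcongr)
        have hC0 : 0 ≤ C := (norm_nonneg _).trans hb
        gcongr
        exact (ContinuousLinearMap.le_opNorm _ _).trans (by gcongr)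
    · exact ((hρ.continuous.norm.mul continuous_const)).integrable_of_hasCompactSupport
        (HasCompactSupport.mul_right hρc.norm)
    · have e1 : HasDerivAt (fun t : ℝ => t • y) y t := by
        simpa using (hasDerivAt_id t).smul_const y
      exact ((hψd (t • y)).hasFDerivAt.comp_hasDerivAt t e1).const_mul _
  -- Since ρ(y) y = ∇P(y), integration by parts turns the integral into -t ∫ P(y) Δψ(ty) dy, and Δψ
  -- vanishes wherever P does not.
  have hzero : ∀ t ∈ Icc (0 : ℝ) 1, ∫ y, (ρ y : ℂ) * fderiv ℝ ψ (t • y) y = 0 := by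
    intro t ht
    have hPC : ContDiff ℝ 1 fun y => (P y : ℂ) :=
      Complex.ofRealCLM.contDiff.comp (hP.of_le (by norm_cast))
    have hPcs : HasCompactSupport fun y => (P y : ℂ) :=
      (hasCompactSupport_of_ball hP0).comp_left (g := Complex.ofReal) Complex.ofReal_zero
    have hPf : ∀ y v, fderiv ℝ (fun y => (P y : ℂ)) y v = (ρ y * inner ℝ y v : ℝ) := fun y v => by
      have : HasFDerivAt (fun y => (P y : ℂ)) (Complex.ofRealCLM ∘L fderiv ℝ P y) y :=
        Complex.ofRealCLM.hasFDerivAt.comp y ((hP.differentiable (by simp)) y).hasFDerivAt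
      rw [this.fderiv]; simp [hPρ]
    have hD : ∀ i : Fin d, ContDiff ℝ 1 fun y => fderiv ℝ ψ y (EuclideanSpace.single i 1) :=
      fun i => ((hψ.fderiv_right (m := 1) (by norm_cast)).clm_apply contDiff_const)
    have hp := fun i : Fin d => integral_mul_fderiv_test
      (f := fun y => fderiv ℝ ψ (t • y) (EuclideanSpace.single i 1)) isOpen_univ
      ((hD i).comp (contDiff_const_smul t)).contDiffOn hPC hPcs (subset_univ _)
      (EuclideanSpace.single i 1)
    have e : ∀ y, (ρ y : ℂ) * fderiv ℝ ψ (t • y) y = ∑ i, fderiv ℝ ψ (t • y)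
        (EuclideanSpace.single i 1) * fderiv ℝ (fun y => (P y : ℂ)) y (EuclideanSpace.single i 1) := by
      intro y
      have h2 : fderiv ℝ ψ (t • y) y = ∑ i, (y i : ℂ) * fderiv ℝ ψ (t • y) (EuclideanSpace.single i 1) := by
        refine (congrArg (fderiv ℝ ψ (t • y)) (eq_sum_single y)).trans ?_
        rw [map_sum]
        simp
      rw [h2, Finset.mul_sum]
      refine Finset.sum_congr rfl fun i _ => ?_
      rw [hPf]
      simp [EuclideanSpace.inner_single_right]
      ring
    simp only [e]
    rw [integral_finsetSum _ fun i _ => (hp i).1]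
    have h3 := fun i => (hp i).2.2
    simp only [Measure.restrict_univ] at h3
    simp only [h3]
    rw [Finset.sum_neg_distrib, ← integral_finsetSum _ fun i _ => (hp i).2.1, neg_eq_zero]
    refine integral_eq_zero_of_ae (Eventually.of_forall fun y => ?_)
    simp only [← Finset.sum_mul, Pi.zero_apply]
    by_cases hy : r ≤ ‖y‖
    · rw [hP0 y hy]; simp
    · have h4 : ∀ i, fderiv ℝ (fun y => fderiv ℝ ψ (t • y) (EuclideanSpace.single i 1)) y
          (EuclideanSpace.single i 1) = t * fderiv ℝ (fun y => fderiv ℝ ψ y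
            (EuclideanSpace.single i 1)) (t • y) (EuclideanSpace.single i 1) := fun i => by
        have h5 : HasFDerivAt (fun y : Space d => t • y) (t • ContinuousLinearMap.id ℝ (Space d)) y :=
          (ContinuousLinearMap.id ℝ (Space d)).hasFDerivAt.const_smul t
        have h6 := (((hD i).differentiable (by norm_num)) (t • y)).hasFDerivAt.comp y h5
        have h7 : fderiv ℝ (fun y => fderiv ℝ ψ (t • y) (EuclideanSpace.single i 1)) y = _ := h6.fderiv
        rw [h7]
        simp
      simp only [h4]
      rw [← Finset.mul_sum, ← laplacian_eq_sum (hψ.contDiffAt.of_le (by norm_cast)), hΔ, mul_zero, zero_mul]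
      rw [norm_smul, Real.norm_eq_abs, abs_of_nonneg ht.1]
      nlinarith [norm_nonneg y, ht.2, ht.1]
  have hconst : Φ 1 = Φ 0 := by
    refine (constant_of_has_deriv_right_zero (a := 0) (b := 1) (f := Φ)
      (fun t _ => (hder t).continuousAt.continuousWithinAt)
      (fun t ht => ?_)) 1 (by simp)
    have := hder t
    rw [hzero t ⟨ht.1, ht.2.le⟩] at this
    exact this.hasDerivWithinAt
  have e1 : Φ 1 = ∫ y, (ρ y : ℂ) * ψ y := by simp [hΦ]
  have e0 : Φ 0 = ψ 0 := by
    simp only [hΦ, zero_smul]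
    rw [integral_mul_const, integral_complex_ofReal, h1]
    simp
  rw [← e1, hconst, e0]

end Weyl

/-! ### Weyl's lemma. -/

section WeylLemma

open Filter Topology
open scoped Convolution

variable {d : ℕ} {Ω : Set (Space d)}

theorem fderiv_convolution_apply {f χ : Space d → ℂ} (hf : LocallyIntegrable f)
    (hχ : ContDiff ℝ 1 χ) (hc : HasCompactSupport χ) (z v : Space d) :
    fderiv ℝ (f ⋆[ContinuousLinearMap.mul ℝ ℂ, volume] χ) z v =
      (f ⋆[ContinuousLinearMap.mul ℝ ℂ, volume] fun y => fderiv ℝ χ y v) z := by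
  rw [(hc.hasFDerivAt_convolution_right (ContinuousLinearMap.mul ℝ ℂ) hf hχ z).fderiv,
    convolution_precompR_apply _ hf (hc.fderiv ℝ) (hχ.continuous_fderiv (by norm_num))]

theorem laplacian_convolution {f χ : Space d → ℂ} (hf : LocallyIntegrable f)
    (hχ : ContDiff ℝ ∞ χ) (hc : HasCompactSupport χ) (z : Space d) :
    Laplacian.laplacian (f ⋆[ContinuousLinearMap.mul ℝ ℂ, volume] χ) z =
      (f ⋆[ContinuousLinearMap.mul ℝ ℂ, volume] Laplacian.laplacian χ) z := by
  have h1 : ContDiff ℝ ∞ (f ⋆[ContinuousLinearMap.mul ℝ ℂ, volume] χ) :=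
    hc.contDiff_convolution_right _ hf hχ
  have hχ1 : ContDiff ℝ 1 χ := hχ.of_le (by norm_cast)
  have hD : ∀ i : Fin d, ContDiff ℝ 1 fun y => fderiv ℝ χ y (EuclideanSpace.single i 1) :=
    fun i => ((hχ.fderiv_right (m := 1) (by norm_cast)).clm_apply contDiff_const)
  have hDc := fun i : Fin d => hc.fderiv_apply ℝ (EuclideanSpace.single i (1 : ℝ))
  rw [laplacian_eq_sum (h1.contDiffAt.of_le (by norm_cast))]
  have e : Laplacian.laplacian χ = fun y => ∑ i, fderiv ℝ (fun y => fderiv ℝ χ y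
      (EuclideanSpace.single i 1)) y (EuclideanSpace.single i 1) :=
    funext fun y => laplacian_eq_sum (hχ.contDiffAt.of_le (by norm_cast))
  simp only [fderiv_convolution_apply hf hχ1 hc, fderiv_convolution_apply hf (hD _) (hDc _), e]
  simp only [convolution_def, ContinuousLinearMap.mul_apply']
  rw [← integral_finsetSum]
  · simp only [Finset.mul_sum]
  · intro i _
    exact ((hDc i).fderiv_apply ℝ (EuclideanSpace.single i (1 : ℝ))).convolutionExists_right
      (ContinuousLinearMap.mul ℝ ℂ) hf
      (((hD i).continuous_fderiv (by norm_num)).clm_apply continuous_const) z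

theorem laplacian_comp_add_left (χ : Space d → ℂ) (hχ : ContDiff ℝ 2 χ) (z x : Space d) :
    Laplacian.laplacian (fun y => χ (z + y)) x = Laplacian.laplacian χ (z + x) := by
  have h : ContDiff ℝ 2 fun y => χ (z + y) := hχ.comp (contDiff_const.add contDiff_id)
  rw [laplacian_eq_sum h.contDiffAt, laplacian_eq_sum hχ.contDiffAt]
  simp only [fderiv_comp_add_left]
  refine Finset.sum_congr rfl fun i _ => ?_
  rw [fderiv_comp_add_left (f := fun y => fderiv ℝ χ y (EuclideanSpace.single i 1))]

/-- H agrees on the small ball with its mollification g = ρ * H. For a test function χ there, ψ(z) =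
∫ H(x) χ(z + x) dx is harmonic for ‖z‖ ≤ r, because χ(z + ·) still has its support in Ω; this is why
the radius 2r is assumed. The mean value property ∫ ρψ = ψ(0) is, by Fubini, the identity ∫ χg = ∫
χH. -/
theorem weyl_local {H : Space d → ℂ} (hH : Integrable H)
    (h : ∀ χ, IsTest Ω χ → ∫ x, H x * Laplacian.laplacian χ x = 0) {x₀ : Space d} {r : ℝ}
    (hr : 0 < r) (hb : Metric.ball x₀ (2 * r) ⊆ Ω) :
    ∃ g : Space d → ℂ, ContDiff ℝ ∞ g ∧ ∀ᵐ x, x ∈ Metric.ball x₀ r → H x = g x := by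
  obtain ⟨ρ, P, hρ, hP, hρ0, hP0, hPρ, hρ1⟩ := exists_radial_mollifier (d := d) hr
  have hρc := hasCompactSupport_of_ball hρ0
  have hρi : Integrable ρ := hρ.continuous.integrable_of_hasCompactSupport hρc
  set g : Space d → ℂ := ρ ⋆[ContinuousLinearMap.lsmul ℝ ℝ, volume] H with hg
  have hgc : ContDiff ℝ ∞ g := hρc.contDiff_convolution_left _ hρ hH.locallyIntegrable
  refine ⟨g, hgc, ?_⟩
  suffices ∀ᵐ x, x ∈ Metric.ball x₀ r → H x - g x = 0 from
    this.mono fun x hx hxb => sub_eq_zero.1 (hx hxb)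
  refine Metric.isOpen_ball.ae_eq_zero_of_integral_contDiff_smul_eq_zero
    ((hH.locallyIntegrable.sub hgc.continuous.locallyIntegrable).locallyIntegrableOn _)
    fun η h1 h2 h3 => ?_
  set χ : Space d → ℂ := fun x => (η x : ℂ) with hχ
  have hχc : ContDiff ℝ ∞ χ := Complex.ofRealCLM.contDiff.comp h1
  have hχs : HasCompactSupport χ := h2.comp_left (g := Complex.ofReal) Complex.ofReal_zero
  have hχt : tsupport χ ⊆ Metric.ball x₀ r :=
    (closure_mono fun x hx => by
      rw [Function.mem_support] at hx ⊢; intro h0; exact hx (by simp [hχ, h0])).trans h3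
  have hHn : LocallyIntegrable fun t => H (-t) := hH.comp_neg.locallyIntegrable
  -- Reflecting H turns the correlation of H and χ into a convolution, whose smoothness and
  -- Laplacian come from χ.
  set ψ : Space d → ℂ := (fun t => H (-t)) ⋆[ContinuousLinearMap.mul ℝ ℂ, volume] χ with hψ
  have hconv : ∀ (κ : Space d → ℂ) z, ((fun t => H (-t)) ⋆[ContinuousLinearMap.mul ℝ ℂ, volume] κ) z =
      ∫ x, H x * κ (z + x) := fun κ z => by
    rw [convolution_def, ← integral_neg_eq_self]
    simp
  have hψc : ContDiff ℝ ∞ ψ := hχs.contDiff_convolution_right _ hHn hχc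
  have hΔ : ∀ z, ‖z‖ ≤ r → Laplacian.laplacian ψ z = 0 := by
    intro z hz
    rw [hψ, laplacian_convolution hHn hχc hχs, hconv]
    simp only [← laplacian_comp_add_left χ (hχc.of_le (by norm_cast))]
    refine h _ ⟨hχc.comp (contDiff_const.add contDiff_id),
      hχs.comp_homeomorph (Homeomorph.addLeft z), ?_⟩
    refine Subset.trans ?_ hb
    have hts : tsupport (fun y => χ (z + y)) ⊆ (fun y => z + y) ⁻¹' tsupport χ :=
      tsupport_comp_subset_preimage χ (continuous_const.add continuous_id)
    intro x hx
    have := hχt (hts hx)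
    rw [Metric.mem_ball, dist_eq_norm] at this ⊢
    calc ‖x - x₀‖ = ‖(z + x - x₀) - z‖ := by congr 1; abel
      _ ≤ ‖z + x - x₀‖ + ‖z‖ := norm_sub_le _ _
      _ < 2 * r := by linarith
  have hmv := integral_radial_mul_eq hρ hP hρ0 hP0 hPρ hρ1 hψc hΔ
  have hψz : ∀ z, ψ z = ∫ x, H x * χ (z + x) := hconv χ
  obtain ⟨C, hC⟩ := hχc.continuous.bounded_above_of_compact_support hχs
  have hint : Integrable (fun p : Space d × Space d => χ p.1 * (ρ p.2 • H (p.1 - p.2)))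
      (volume.prod volume) :=
    Integrable.bdd_mul (c := C)
      (hρi.convolution_integrand (ContinuousLinearMap.lsmul ℝ ℝ) hH)
      ((hχc.continuous.comp continuous_fst).aestronglyMeasurable)
      (Eventually.of_forall fun p => hC p.1)
  have e1 : ∫ y, χ y * g y = ∫ z, (ρ z : ℂ) * ψ z := by
    calc ∫ y, χ y * g y = ∫ y, ∫ z, χ y * (ρ z • H (y - z)) := by
          refine integral_congr_ae (Eventually.of_forall fun y => ?_)
          simp only [hg, convolution_def, ContinuousLinearMap.lsmul_apply]
          rw [integral_const_mul]
      _ = ∫ z, ∫ y, χ y * (ρ z • H (y - z)) := integral_integral_swap hint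
      _ = _ := by
          refine integral_congr_ae (Eventually.of_forall fun z => ?_)
          simp only
          rw [hψz, ← integral_const_mul, ← integral_add_left_eq_self _ z]
          refine integral_congr_ae (Eventually.of_forall fun x => ?_)
          simp only [add_sub_cancel_left, Complex.real_smul]
          ring
  rw [hmv, hψz] at e1
  simp only [zero_add] at e1
  have hi1 : Integrable fun x => η x • H x :=
    Integrable.bdd_mul (c := C) (f := χ) hH hχc.continuous.aestronglyMeasurable
      (Eventually.of_forall hC)
  have hi2 : Integrable fun x => η x • g x :=
    (h1.continuous.smul hgc.continuous).integrable_of_hasCompactSupport h2.smul_right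
  simp only [smul_sub]
  rw [integral_sub hi1 hi2, sub_eq_zero]
  simp only [Complex.real_smul]
  rw [show (∫ x, (η x : ℂ) * g x) = ∫ x, H x * χ x from e1]
  simp only [hχ, mul_comm]

/-- Weyl's lemma: a weakly harmonic function is smooth. -/
theorem weyl {H : Space d → ℂ} (hΩ : IsOpen Ω) (hH : Integrable H)
    (h : ∀ χ, IsTest Ω χ → ∫ x, H x * Laplacian.laplacian χ x = 0) :
    ∃ g : Space d → ℂ, ContDiffOn ℝ ∞ g Ω ∧ ∀ᵐ x, x ∈ Ω → H x = g x := by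
  have hloc : ∀ x : Space d, ∃ (g : Space d → ℂ) (r : ℝ), x ∈ Ω → 0 < r ∧ ContDiff ℝ ∞ g ∧
      ∀ᵐ y, y ∈ Metric.ball x r → H y = g y := by
    intro x
    by_cases hx : x ∈ Ω
    · obtain ⟨s, hs, hsb⟩ := Metric.isOpen_iff.1 hΩ x hx
      obtain ⟨g, hg⟩ := weyl_local hH h (half_pos hs) (by rwa [mul_div_cancel₀ _ two_ne_zero])
      exact ⟨g, s / 2, fun _ => ⟨half_pos hs, hg⟩⟩
    · exact ⟨0, 0, fun h' => absurd h' hx⟩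
  choose g r hgr using hloc
  -- Continuous local representatives that agree almost everywhere on an overlap agree there, so the
  -- diagonal choice `g x x` is locally one smooth function.
  have hagree : ∀ x ∈ Ω, ∀ y ∈ Ω, y ∈ Metric.ball x (r x) → g y y = g x y := by
    intro x hx y hy hyx
    obtain ⟨hr1, hc1, ha1⟩ := hgr x hx
    obtain ⟨hr2, hc2, ha2⟩ := hgr y hy
    refine Measure.eqOn_open_of_ae_eq (μ := volume) (U := Metric.ball x (r x) ∩ Metric.ball y (r y))
      ?_ (Metric.isOpen_ball.inter Metric.isOpen_ball) hc2.continuous.continuousOn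
      hc1.continuous.continuousOn ⟨hyx, Metric.mem_ball_self hr2⟩
    rw [EventuallyEq, ae_restrict_iff' (Metric.isOpen_ball.inter Metric.isOpen_ball).measurableSet]
    filter_upwards [ha1, ha2] with z h1 h2 hz
    rw [← h1 hz.1, ← h2 hz.2]
  refine ⟨fun x => g x x, fun x hx => ?_, ?_⟩
  · obtain ⟨hr1, hc1, -⟩ := hgr x hx
    refine (hc1.contDiffAt.congr_of_eventuallyEq ?_).contDiffWithinAt
    filter_upwards [hΩ.mem_nhds hx, Metric.ball_mem_nhds x hr1] with y hy hyx
    exact hagree x hx y hy hyx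
  · have : volume {x | x ∈ Ω ∧ H x ≠ g x x} = 0 := by
      refine measure_null_of_locally_null _ fun x hx => ?_
      obtain ⟨hr1, -, ha1⟩ := hgr x hx.1
      refine ⟨{x | x ∈ Ω ∧ H x ≠ g x x} ∩ Metric.ball x (r x),
        inter_mem_nhdsWithin _ (Metric.ball_mem_nhds x hr1), ?_⟩
      refine measure_mono_null ?_ (ae_iff.1 ha1)
      rintro y ⟨⟨hy, hne⟩, hyx⟩
      simp only [mem_ofPred_eq, Classical.not_imp]
      exact ⟨hyx, fun he => hne (he.trans (hagree x hx.1 y hy hyx).symm)⟩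
    rw [ae_iff]
    simpa only [Classical.not_imp] using this

/-- The smooth representative of a weakly harmonic function is harmonic. -/
theorem laplacian_ae_eq_zero {g : Space d → ℂ} (hΩ : IsOpen Ω) (hg : ContDiffOn ℝ ∞ g Ω)
    (h : ∀ χ, IsTest Ω χ → ∫ x in Ω, g x * Laplacian.laplacian χ x = 0) :
    ∀ᵐ x, x ∈ Ω → Laplacian.laplacian g x = 0 := by
  have hg2 : ContDiffOn ℝ 2 g Ω := hg.of_le (by norm_cast)
  have hcont : ContinuousOn (Laplacian.laplacian g) Ω := by
    have h1 : ContinuousOn (fun x => ∑ i, fderiv ℝ (fun y => fderiv ℝ g y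
        (EuclideanSpace.single i 1)) x (EuclideanSpace.single i 1)) Ω :=
      continuousOn_finsetSum _ fun i _ =>
        ((contDiffOn_fderiv_apply hΩ hg2 _).continuousOn_fderiv_of_isOpen hΩ (by norm_num)).clm_apply
          continuousOn_const
    exact h1.congr fun x hx => laplacian_eq_sum (hg2.contDiffAt (hΩ.mem_nhds hx))
  refine hΩ.ae_eq_zero_of_integral_contDiff_smul_eq_zero
    (hcont.locallyIntegrableOn hΩ.measurableSet) fun η h1 h2 h3 => ?_
  set χ : Space d → ℂ := fun x => (η x : ℂ) with hχ
  have hχc : ContDiff ℝ ∞ χ := Complex.ofRealCLM.contDiff.comp h1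
  have hχs : HasCompactSupport χ := h2.comp_left (g := Complex.ofReal) Complex.ofReal_zero
  have hχt : tsupport χ ⊆ Ω :=
    (closure_mono fun x hx => by
      rw [Function.mem_support] at hx ⊢; intro h0; exact hx (by simp [hχ, h0])).trans h3
  have hχ2 : ContDiff ℝ 2 χ := hχc.of_le (by norm_cast)
  have g1 := green_left hΩ hg2 (hχc.of_le (by norm_cast)) hχs hχt
  have g2 := green_right hΩ (hg2.of_le (by norm_num)) hχ2 hχs hχt
  rw [← g2] at g1
  have hstar : ∀ x, star (χ x) = χ x := fun x => by simp [hχ]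
  have hstar2 : ∀ x, star (Laplacian.laplacian χ x) = Laplacian.laplacian χ x := fun x => by
    rw [← laplacian_star hχ2.contDiffAt]; simp only [hstar]
  simp only [hstar, hstar2] at g1
  have h4 := h χ ⟨hχc, hχs, hχt⟩
  simp only [mul_comm] at h4 g1
  rw [h4] at g1
  rw [← g1]
  refine Eq.trans ?_ ((setIntegral_mul_test (f := Laplacian.laplacian g) hχt).symm.trans ?_) <;>
  refine integral_congr_ae (Eventually.of_forall fun x => ?_) <;> simp [hχ, mul_comm]

end WeylLemma

/-! ### Exterior balls and barriers at the boundary. -/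

section Barrier

open Filter Topology

variable {d : ℕ} {Ω : Set (Space d)}

/-- A domain with smooth boundary satisfies the exterior ball condition. -/
theorem exists_exterior_ball (hΩ : IsOpen Ω) (hs : HasSmoothBoundary Ω) {p : Space d}
    (hp : p ∈ frontier Ω) : ∃ (y : Space d) (r : ℝ), 0 < r ∧ ‖p - y‖ = r ∧ ∀ x ∈ Ω, r ≤ ‖x - y‖ := by
  obtain ⟨W, ρ, hW, hpW, hρ, hne, hΩW⟩ := hs p hp
  have hpΩ : p ∉ Ω := by rw [hΩ.frontier_eq] at hp; exact hp.2
  have hρp : 0 ≤ ρ p := by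
    by_contra h
    have : p ∈ Ω ∩ W := by rw [hΩW]; exact ⟨hpW, not_le.1 h⟩
    exact hpΩ this.1
  have hcd : ContDiffAt ℝ 1 (fderiv ℝ ρ) p :=
    (hρ.contDiffAt (hW.mem_nhds hpW)).fderiv_right (m := 1) (by norm_cast)
  obtain ⟨K, t, ht, hK⟩ := hcd.exists_lipschitzOnWith
  obtain ⟨s, hs0, hsb⟩ := Metric.mem_nhds_iff.1 (inter_mem ht (hW.mem_nhds hpW))
  set D := fderiv ℝ ρ p with hD
  set n : Space d := (InnerProductSpace.toDual ℝ (Space d)).symm D with hn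
  have hDn : ∀ v, D v = inner ℝ n v := fun v => by simp [hn]
  have hn0 : n ≠ 0 := by
    simpa [hn] using hne p hpW
  have ha : 0 < ‖n‖ := norm_pos_iff.2 hn0
  -- The gradient of ρ is Lipschitz near p, so the first-order expansion has a quadratic error.
  have hlow : ∀ x ∈ Metric.ball p s, ρ p + D (x - p) - K * ‖x - p‖ ^ 2 ≤ ρ x := by
    intro x hx
    have hsub : Metric.closedBall p ‖x - p‖ ⊆ Metric.ball p s :=
      Metric.closedBall_subset_ball (by rwa [Metric.mem_ball, dist_eq_norm] at hx)
    have h1 := (convex_closedBall p ‖x - p‖).norm_image_sub_le_of_norm_hasFDerivWithin_le' (f := ρ)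
      (f' := fderiv ℝ ρ) (φ := D) (C := K * ‖x - p‖) (x := p) (y := x) (fun z hz => ?_) (fun z hz => ?_)
      (Metric.mem_closedBall_self (norm_nonneg _)) (by simp [dist_eq_norm])
    · rw [Real.norm_eq_abs] at h1
      have := neg_abs_le (ρ x - ρ p - D (x - p))
      nlinarith
    · exact ((hρ.contDiffAt (hW.mem_nhds (hsb (hsub hz)).2)).differentiableAt
        (by simp)).hasFDerivAt.hasFDerivWithinAt
    · refine (hK.norm_sub_le (hsb (hsub hz)).1 (hsb (Metric.mem_ball_self hs0)).1).trans ?_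
      have : ‖z - p‖ ≤ ‖x - p‖ := by rwa [Metric.mem_closedBall, dist_eq_norm] at hz
      gcongr
  -- The ball of radius r centred at distance r along n satisfies ‖n‖‖v‖² ≤ 2r ⟨n, v⟩ for v = x - p.
  -- With 2rK ≤ ‖n‖ the linear term then dominates the quadratic error, so ρ ≥ 0 in this ball; 2r ≤
  -- s keeps the ball where the expansion is valid.
  obtain ⟨r, hr, hrs, hrK⟩ : ∃ r : ℝ, 0 < r ∧ 2 * r ≤ s ∧ 2 * r * K ≤ ‖n‖ := by
    refine ⟨min (s / 2) (‖n‖ / (2 * (K + 1))), by positivity, ?_, ?_⟩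
    · linarith [min_le_left (s / 2) (‖n‖ / (2 * ((K : ℝ) + 1)))]
    · have h1 := min_le_right (s / 2) (‖n‖ / (2 * ((K : ℝ) + 1)))
      rw [le_div_iff₀ (by positivity)] at h1
      have h2 : 0 < min (s / 2) (‖n‖ / (2 * ((K : ℝ) + 1))) := by positivity
      nlinarith
  have hnn : ‖(r / ‖n‖) • n‖ = r := by
    rw [norm_smul, Real.norm_eq_abs, abs_of_pos (by positivity), div_mul_cancel₀ _ ha.ne']
  refine ⟨p + (r / ‖n‖) • n, r, hr, by rw [sub_add_cancel_left, norm_neg, hnn], fun x hx => ?_⟩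
  by_contra hlt
  rw [not_le, ← sub_sub] at hlt
  set v := x - p with hv
  have hv2 : ‖v‖ < 2 * r := by
    calc ‖v‖ = ‖(v - (r / ‖n‖) • n) + (r / ‖n‖) • n‖ := by rw [sub_add_cancel]
      _ ≤ ‖v - (r / ‖n‖) • n‖ + ‖(r / ‖n‖) • n‖ := norm_add_le _ _
      _ < 2 * r := by rw [hnn]; linarith
  have hxb : x ∈ Metric.ball p s := by
    rw [Metric.mem_ball, dist_eq_norm]; linarith
  have h3 := hlow x hxb
  have h4 : ‖v - (r / ‖n‖) • n‖ ^ 2 < r ^ 2 := by gcongr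
  rw [norm_sub_sq_real, hnn, inner_smul_right, real_inner_comm] at h4
  have h5 : ‖n‖ * ‖v‖ ^ 2 ≤ 2 * r * inner ℝ n v := by
    have h6 : ‖n‖ * (r / ‖n‖ * inner ℝ n v) = r * inner ℝ n v := by field_simp
    nlinarith
  have h7 : 0 ≤ ρ x := by
    rw [hDn] at h3
    have h8 : K * ‖v‖ ^ 2 ≤ inner ℝ n v := by
      have : 2 * r * (K * ‖v‖ ^ 2) ≤ 2 * r * inner ℝ n v :=
        le_trans (by nlinarith [sq_nonneg ‖v‖]) h5
      exact le_of_mul_le_mul_left this (by positivity)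
    linarith
  have h9 : x ∈ Ω ∩ W := ⟨hx, (hsb hxb).2⟩
  rw [hΩW] at h9
  exact absurd h9.2 (not_lt.2 h7)

theorem laplacian_gaussian (α : ℝ) (y x : Space d) :
    Laplacian.laplacian (fun x : Space d => (Real.exp (-α * ‖x - y‖ ^ 2) : ℂ)) x =
      (((4 * α ^ 2 * ‖x - y‖ ^ 2 - 2 * α * d) * Real.exp (-α * ‖x - y‖ ^ 2) : ℝ) : ℂ) := by
  set E : Space d → ℝ := fun x => Real.exp (-α * ‖x - y‖ ^ 2) with hE
  have hEd : ∀ x, HasFDerivAt E (E x • (-α • (2 • innerSL ℝ (x - y)))) x := fun x => by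
    have h1 : HasFDerivAt (fun x : Space d => ‖x - y‖ ^ 2) (2 • innerSL ℝ (x - y)) x := by
      have := (hasStrictFDerivAt_norm_sq (x - y)).hasFDerivAt.comp x ((hasFDerivAt_id x).sub_const y)
      simpa using! this
    exact (h1.const_mul (-α)).exp
  have hcd : ContDiff ℝ ∞ fun x => (E x : ℂ) :=
    Complex.ofRealCLM.contDiff.comp (Real.contDiff_exp.comp (contDiff_const.mul
      ((contDiff_norm_sq ℝ).comp (contDiff_id.sub contDiff_const))))
  rw [laplacian_eq_sum (hcd.contDiffAt.of_le (by norm_cast))]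
  have h1 : ∀ (z : Space d) (i : Fin d), fderiv ℝ (fun x => (E x : ℂ)) z (EuclideanSpace.single i 1) =
      ((-2 * α * (z i - y i) * E z : ℝ) : ℂ) := fun z i => by
    have := (Complex.ofRealCLM.hasFDerivAt.comp z (hEd z)).fderiv
    have h2 : fderiv ℝ (fun x => (E x : ℂ)) z = _ := this
    rw [h2]
    simp [EuclideanSpace.inner_single_right]
    ring
  have h2 : ∀ i : Fin d, fderiv ℝ (fun z : Space d => ((-2 * α * (z i - y i) * E z : ℝ) : ℂ)) x
      (EuclideanSpace.single i 1) = (((4 * α ^ 2 * (x i - y i) ^ 2 - 2 * α) * E x : ℝ) : ℂ) := fun i => by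
    have hi : HasFDerivAt (fun z : Space d => -2 * α * (z i - y i))
        ((-2 * α) • (EuclideanSpace.proj i : Space d →L[ℝ] ℝ)) x :=
      ((EuclideanSpace.proj i : Space d →L[ℝ] ℝ).hasFDerivAt.sub_const (y i)).const_mul (-2 * α)
    have := (Complex.ofRealCLM.hasFDerivAt.comp x (hi.mul (hEd x))).fderiv
    have h3 : fderiv ℝ (fun z : Space d => ((-2 * α * (z i - y i) * E z : ℝ) : ℂ)) x = _ := this
    rw [h3]
    simp [EuclideanSpace.inner_single_right]
    ring
  simp only [h1, h2]
  have hsum : ∑ i, (x i - y i) ^ 2 = ‖x - y‖ ^ 2 := by rw [EuclideanSpace.norm_sq_eq]; simp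
  rw [← Complex.ofReal_sum, ← Finset.sum_mul, Finset.sum_sub_distrib, ← Finset.mul_sum, hsum,
    Finset.sum_const, Finset.card_univ, Fintype.card_fin, nsmul_eq_mul, mul_comm (d : ℝ)]

/-- A barrier at a boundary point: a smooth function, nonnegative in `Ω`, which vanishes at the
point and whose Laplacian is at most `-1` in `Ω`. -/
theorem exists_barrier (hΩ : IsOpen Ω) (hb : Bornology.IsBounded Ω) (hs : HasSmoothBoundary Ω)
    {p : Space d} (hp : p ∈ frontier Ω) : ∃ b : Space d → ℝ, ContDiff ℝ ∞ b ∧ b p = 0 ∧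
      (∀ x ∈ Ω, 0 ≤ b x) ∧ ∀ x ∈ Ω, (Laplacian.laplacian (fun x => (b x : ℂ)) x).re ≤ -1 := by
  obtain ⟨y, r, hr, hpy, hout⟩ := exists_exterior_ball hΩ hs hp
  obtain ⟨R, hR⟩ := hb.exists_norm_le
  -- With this α, 4α²‖x - y‖² - 2αd ≥ 4α(d + 1) - 2αd ≥ 4α outside the exterior ball.
  set α : ℝ := (d + 1) / r ^ 2 with hα
  have hα0 : 0 < α := by positivity
  have hαr : α * r ^ 2 = d + 1 := div_mul_cancel₀ _ (by positivity)
  set S : ℝ := R + ‖y‖ with hS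
  -- On Ω the Gaussian is at least exp(-αS²), and κ scales 4α exp(-αS²) to 1.
  set κ : ℝ := Real.exp (α * S ^ 2) / (4 * α) with hκ
  have hκ0 : 0 < κ := by positivity
  have hE : ContDiff ℝ ∞ fun x : Space d => Real.exp (-α * ‖x - y‖ ^ 2) :=
    Real.contDiff_exp.comp (contDiff_const.mul
      ((contDiff_norm_sq ℝ).comp (contDiff_id.sub contDiff_const)))
  refine ⟨fun x => κ * (Real.exp (-α * r ^ 2) - Real.exp (-α * ‖x - y‖ ^ 2)),
    contDiff_const.mul (contDiff_const.sub hE), by simp [hpy], fun x hx => ?_, fun x hx => ?_⟩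
  · refine mul_nonneg hκ0.le (sub_nonneg.2 (Real.exp_le_exp.2 ?_))
    have := hout x hx
    have : r ^ 2 ≤ ‖x - y‖ ^ 2 := by gcongr
    nlinarith
  · have e : (fun x : Space d => ((κ * (Real.exp (-α * r ^ 2) - Real.exp (-α * ‖x - y‖ ^ 2)) : ℝ) : ℂ)) =
        (fun _ => ((κ * Real.exp (-α * r ^ 2) : ℝ) : ℂ)) -
          κ • fun x : Space d => (Real.exp (-α * ‖x - y‖ ^ 2) : ℂ) := by
      ext x; simp; ring
    have hEC : ContDiff ℝ 2 fun x : Space d => (Real.exp (-α * ‖x - y‖ ^ 2) : ℂ) :=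
      (Complex.ofRealCLM.contDiff.comp hE).of_le (by norm_cast)
    have hs2 : ContDiffAt ℝ 2 (κ • fun x : Space d => (Real.exp (-α * ‖x - y‖ ^ 2) : ℂ)) x :=
      (hEC.const_smul κ).contDiffAt
    rw [e, ContDiffAt.laplacian_sub contDiffAt_const hs2,
      InnerProductSpace.laplacian_smul κ hEC.contDiffAt, laplacian_gaussian]
    rw [show Laplacian.laplacian (fun _ : Space d => ((κ * Real.exp (-α * r ^ 2) : ℝ) : ℂ)) x = 0 from
      congrFun InnerProductSpace.laplacian_const x, zero_sub, Complex.neg_re, Complex.smul_re,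
      Complex.ofReal_re, smul_eq_mul]
    have h1 : r ^ 2 ≤ ‖x - y‖ ^ 2 := by have := hout x hx; gcongr
    have h2 : ‖x - y‖ ^ 2 ≤ S ^ 2 := by
      have : ‖x - y‖ ≤ S := (norm_sub_le _ _).trans (by simp only [hS]; linarith [hR x hx])
      gcongr
    have h3 : 4 * α ≤ 4 * α ^ 2 * ‖x - y‖ ^ 2 - 2 * α * d := by
      have : α * (α * r ^ 2) ≤ α * (α * ‖x - y‖ ^ 2) := by gcongr
      rw [hαr] at this
      have hd0 : (0 : ℝ) ≤ d := Nat.cast_nonneg d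
      nlinarith
    have h4 : Real.exp (-α * S ^ 2) ≤ Real.exp (-α * ‖x - y‖ ^ 2) :=
      Real.exp_le_exp.2 (by nlinarith)
    have h5 : κ * (4 * α * Real.exp (-α * S ^ 2)) = 1 := by
      have : Real.exp (α * S ^ 2) * Real.exp (-α * S ^ 2) = 1 := by
        rw [← Real.exp_add]; simp
      rw [hκ, div_mul_eq_mul_div, mul_left_comm, mul_div_assoc, this]
      field_simp
    have h6 : κ * (4 * α * Real.exp (-α * S ^ 2)) ≤
        κ * ((4 * α ^ 2 * ‖x - y‖ ^ 2 - 2 * α * d) * Real.exp (-α * ‖x - y‖ ^ 2)) := by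
      gcongr
      linarith
    linarith

end Barrier

/-! ### The weak maximum principle. -/

section MaximumPrinciple

open Filter Topology

variable {d : ℕ} {Ω : Set (Space d)}

/-- A smooth version of the positive part. -/
def posPart (s : ℝ) : ℝ := ∫ τ in (0 : ℝ)..s, Real.smoothTransition τ

theorem contDiff_posPart : ContDiff ℝ ∞ posPart :=
  contDiff_primitive Real.smoothTransition.contDiff

theorem hasDerivAt_posPart (s : ℝ) : HasDerivAt posPart (Real.smoothTransition s) s :=
  hasDerivAt_primitive (Real.smoothTransition.contDiff (n := 0)).continuous s

theorem abs_posPart_sub_le (s t : ℝ) : |posPart s - posPart t| ≤ |s - t| := by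
  have hc := (Real.smoothTransition.contDiff (n := 0)).continuous
  rw [posPart, posPart, intervalIntegral.integral_interval_sub_left
    (hc.intervalIntegrable _ _) (hc.intervalIntegrable _ _)]
  have := intervalIntegral.norm_integral_le_of_norm_le_const (f := Real.smoothTransition) (a := t)
    (b := s) (C := 1) fun x _ => by
      rw [Real.norm_eq_abs, abs_of_nonneg (Real.smoothTransition.nonneg x)]
      exact Real.smoothTransition.le_one x
  simpa using this

theorem posPart_of_nonpos {s : ℝ} (hs : s ≤ 0) : posPart s = 0 := by
  refine intervalIntegral.integral_zero_ae (Eventually.of_forall fun x hx => ?_)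
  rw [uIoc_of_ge hs] at hx
  exact Real.smoothTransition.zero_of_nonpos hx.2

theorem posPart_pos {s : ℝ} (hs : 0 < s) : 0 < posPart s :=
  intervalIntegral.intervalIntegral_pos_of_pos_on
    ((Real.smoothTransition.contDiff (n := 0)).continuous.intervalIntegrable _ _)
    (fun _ hx => Real.smoothTransition.pos_of_pos hx.1) hs

theorem posPart_nonneg (s : ℝ) : 0 ≤ posPart s := by
  rcases le_or_gt s 0 with h | h
  · rw [posPart_of_nonpos h]
  · exact (posPart_pos h).le

/-- Because b ≥ 0 in Ω, the positive part vanishes wherever φ does. The indicator is there because b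
may be negative outside Ω. -/
theorem isTest_posPart {φ : Space d → ℂ} {b : Space d → ℝ} (hΩ : IsOpen Ω) (hφ : IsTest Ω φ)
    (hb : ContDiff ℝ ∞ b) (hb0 : ∀ x ∈ Ω, 0 ≤ b x) :
    IsTest Ω (Ω.indicator fun x => (posPart ((φ x).re - b x) : ℂ)) := by
  have hsub : tsupport (Ω.indicator fun x => (posPart ((φ x).re - b x) : ℂ)) ⊆ tsupport φ := by
    refine closure_mono fun x hx => ?_
    rw [Function.mem_support] at hx ⊢
    intro h0
    apply hx
    by_cases hxΩ : x ∈ Ω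
    · rw [indicator_of_mem hxΩ, h0, posPart_of_nonpos (by simpa using hb0 x hxΩ)]; simp
    · exact indicator_of_notMem hxΩ _
  refine ⟨contDiff_iff_contDiffAt.2 fun x => ?_, hφ.hasCompactSupport.mono'
    (subset_closure.trans hsub), hsub.trans hφ.tsupport_subset⟩
  by_cases hx : x ∈ tsupport (Ω.indicator fun x => (posPart ((φ x).re - b x) : ℂ))
  swap
  · exact contDiffAt_const.congr_of_eventuallyEq (notMem_tsupport_iff_eventuallyEq.1 hx)
  have h1 : ContDiff ℝ ∞ fun x => (posPart ((φ x).re - b x) : ℂ) :=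
    Complex.ofRealCLM.contDiff.comp
      (contDiff_posPart.comp ((Complex.reCLM.contDiff.comp hφ.contDiff).sub hb))
  refine h1.contDiffAt.congr_of_eventuallyEq ?_
  filter_upwards [hΩ.mem_nhds (hφ.tsupport_subset (hsub hx))] with y hy
  exact indicator_of_mem hy _

theorem re_inner_ofReal_smul_grad {r : Space d → ℝ} {φ : Space d → ℂ} {x : Space d}
    (hr : DifferentiableAt ℝ r x) (hφ : DifferentiableAt ℝ φ x) :
    (inner ℂ (grad (fun y => (r y : ℂ)) x) (grad φ x)).re =
      (inner ℂ (grad (fun y => (r y : ℂ)) x) (grad (fun y => ((φ y).re : ℂ)) x)).re := by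
  have h1 : ∀ v, fderiv ℝ (fun y => (r y : ℂ)) x v = (fderiv ℝ r x v : ℂ) := fun v => by
    have := (Complex.ofRealCLM.hasFDerivAt.comp x hr.hasFDerivAt).fderiv
    have h2 : fderiv ℝ (fun y => (r y : ℂ)) x = _ := this
    rw [h2]; simp
  have h2 : ∀ v, fderiv ℝ (fun y => ((φ y).re : ℂ)) x v = ((fderiv ℝ φ x v).re : ℂ) := fun v => by
    have := ((Complex.ofRealCLM ∘L Complex.reCLM).hasFDerivAt.comp x hφ.hasFDerivAt).fderiv
    have h2 : fderiv ℝ (fun y => ((φ y).re : ℂ)) x = _ := this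
    rw [h2]; simp
  rw [inner_grad, inner_grad, Complex.re_sum, Complex.re_sum]
  refine Finset.sum_congr rfl fun i _ => ?_
  rw [h1, h2]
  simp

/-- The pointwise inequality behind the weak maximum principle. -/
theorem norm_sq_grad_posPart_le {φ : Space d → ℂ} {b : Space d → ℝ} {x : Space d}
    (hφ : DifferentiableAt ℝ φ x) (hb : DifferentiableAt ℝ b x) :
    ‖grad (fun x => (posPart ((φ x).re - b x) : ℂ)) x‖ ^ 2 ≤
      (inner ℂ (grad (fun x => (posPart ((φ x).re - b x) : ℂ)) x) (grad φ x)).re -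
      (inner ℂ (grad (fun x => (posPart ((φ x).re - b x) : ℂ)) x) (grad (fun y => (b y : ℂ)) x)).re := by
  have hre : DifferentiableAt ℝ (fun x => (φ x).re) x := Complex.reCLM.differentiableAt.comp x hφ
  have hr : DifferentiableAt ℝ (fun x => (φ x).re - b x) x := hre.sub hb
  have hC : ∀ {f : Space d → ℝ}, DifferentiableAt ℝ f x → DifferentiableAt ℝ (fun y => (f y : ℂ)) x :=
    fun h => Complex.ofRealCLM.differentiableAt.comp x h
  rw [grad_ofReal_comp hr (hasDerivAt_posPart _)]
  set g := Real.smoothTransition ((φ x).re - b x)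
  have e1 : grad (fun y => (((φ y).re - b y : ℝ) : ℂ)) x =
      grad (fun y => ((φ y).re : ℂ)) x - grad (fun y => (b y : ℂ)) x := by
    rw [← grad_sub (hC hre) (hC hb)]
    congr 1; ext y; simp
  have e2 := re_inner_ofReal_smul_grad hr hφ
  set q := grad (fun y => (((φ y).re - b y : ℝ) : ℂ)) x
  have e3 : (inner ℂ q (grad (fun y => ((φ y).re : ℂ)) x)).re -
      (inner ℂ q (grad (fun y => (b y : ℂ)) x)).re = ‖q‖ ^ 2 := by
    rw [← Complex.sub_re, ← inner_sub_right, ← e1]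
    exact (norm_sq_eq_re_inner (𝕜 := ℂ) q).symm
  rw [inner_smul_left, inner_smul_left, Complex.conj_ofReal, Complex.re_ofReal_mul,
    Complex.re_ofReal_mul, e2, ← mul_sub, e3, norm_smul, mul_pow, Complex.norm_real,
    Real.norm_eq_abs, sq_abs]
  -- The gradient of the positive part is `g • q` with 0 ≤ g ≤ 1, and g² ≤ g gives the inequality.
  have h0 := Real.smoothTransition.nonneg ((φ x).re - b x)
  have h1 := Real.smoothTransition.le_one ((φ x).re - b x)
  gcongr
  nlinarith

/-- The energy estimate behind the weak maximum principle. -/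
theorem norm_weakGrad_posPart_le {φ : Space d → ℂ} {b : Space d → ℝ} (hΩ : IsOpen Ω)
    (hφ : IsTest Ω φ) (hb : ContDiff ℝ ∞ b) (hb0 : ∀ x ∈ Ω, 0 ≤ b x) {M : ℝ}
    (hL : ∀ x ∈ Ω, (Laplacian.laplacian (fun x => (b x : ℂ)) x).re ≤ -M)
    {F : StateSpace Ω} (hF : ∀ᵐ x ∂volume.restrict Ω, ‖F x‖ ≤ M) {v w q : VSpace Ω}
    (hv : ∀ χ : VSpace Ω, inner ℂ (weakGrad χ) (weakGrad v) = inner ℂ (toH χ) F)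
    (hw : IsRep w φ) (hq : IsRep q (Ω.indicator fun x => (posPart ((φ x).re - b x) : ℂ))) :
    ‖weakGrad q‖ ≤ ‖w - v‖ := by
  set χ : Space d → ℂ := Ω.indicator fun x => (posPart ((φ x).re - b x) : ℂ) with hχ
  have ht : IsTest Ω χ := isTest_posPart hΩ hφ hb hb0
  have hbC : ContDiff ℝ ∞ fun y => (b y : ℂ) := Complex.ofRealCLM.contDiff.comp hb
  have hg : ∀ {f : Space d → ℂ}, ContDiff ℝ ∞ f → Continuous (grad f) := fun h =>
    continuous_grad (h.of_le (by norm_cast))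
  have hgc := hasCompactSupport_grad ht.hasCompactSupport
  have hi : ∀ {f : Space d → ℂ}, ContDiff ℝ ∞ f →
      Integrable (fun x => inner ℂ (grad χ x) (grad f x)) (volume.restrict Ω) := fun h => by
    refine (((hg ht.contDiff).inner (hg h)).integrable_of_hasCompactSupport
      (hgc.mono fun x hx => ?_)).restrict
    rw [Function.mem_support] at hx ⊢
    intro h0; simp [h0] at hx
  have hχr : ∀ x ∈ Ω, χ x = (posPart ((φ x).re - b x) : ℂ) := fun x hx => indicator_of_mem hx _
  have hχ0 : ∀ x ∈ Ω, ‖χ x‖ = posPart ((φ x).re - b x) := fun x hx => by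
    rw [hχr x hx, Complex.norm_real, Real.norm_eq_abs, abs_of_nonneg (posPart_nonneg _)]
  have hχi : Integrable χ (volume.restrict Ω) :=
    (ht.contDiff.continuous.integrable_of_hasCompactSupport ht.hasCompactSupport).restrict
  have hpw : ∀ x ∈ Ω, ‖grad χ x‖ ^ 2 ≤ (inner ℂ (grad χ x) (grad φ x)).re -
      (inner ℂ (grad χ x) (grad (fun y => (b y : ℂ)) x)).re := fun x hx => by
    have : grad χ x = grad (fun x => (posPart ((φ x).re - b x) : ℂ)) x := grad_congr <| by
      filter_upwards [hΩ.mem_nhds hx] with y hy using hχr y hy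
    rw [this]
    exact norm_sq_grad_posPart_le (hφ.differentiableAt x) ((hb.differentiable (by simp)) x)
  have h1 : ‖weakGrad q‖ ^ 2 ≤ (inner ℂ (weakGrad q) (weakGrad w)).re -
      (∫ x in Ω, inner ℂ (grad χ x) (grad (fun y => (b y : ℂ)) x)).re := by
    rw [norm_sq_lp_eq_integral hq.2, inner_lp_eq_integral hq.2 hw.2, ← Complex.sub_re,
      ← integral_sub (hi hφ.contDiff) (hi hbC)]
    have := integral_re ((hi hφ.contDiff).sub (hi hbC))
    simp only [Pi.sub_apply] at this
    refine le_trans ?_ this.le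
    refine setIntegral_mono_on ((integrable_norm_sq (hg ht.contDiff) hgc).restrict)
      ((hi hφ.contDiff).sub (hi hbC)).re hΩ.measurableSet fun x hx => ?_
    simpa using hpw x hx
  have h2 : -(∫ x in Ω, inner ℂ (grad χ x) (grad (fun y => (b y : ℂ)) x)).re ≤
      -(M * ∫ x in Ω, ‖χ x‖) := by
    rw [← Complex.neg_re, ← green_left hΩ (hbC.contDiffOn.of_le (by norm_cast))
      (ht.contDiff.of_le (by norm_cast)) ht.hasCompactSupport ht.tsupport_subset, ← neg_mul,
      ← integral_const_mul]
    have hi2 : Integrable (fun x => star (χ x) * Laplacian.laplacian (fun y => (b y : ℂ)) x)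
        (volume.restrict Ω) := by
      refine (((continuous_star.comp ht.contDiff.continuous).mul (continuous_laplacian
        (hbC.of_le (by norm_cast)))).integrable_of_hasCompactSupport
        (ht.hasCompactSupport.mono fun x hx => ?_)).restrict
      rw [Function.mem_support] at hx ⊢
      intro h0; simp [h0] at hx
    refine (integral_re hi2).symm.le.trans ?_
    refine setIntegral_mono_on hi2.re (hχi.norm.const_mul _) hΩ.measurableSet fun x hx => ?_
    rw [hχ0 x hx, hχr x hx]
    have := hL x hx
    have h0 := posPart_nonneg ((φ x).re - b x)
    simp only [RCLike.re_to_complex, Complex.star_def, Complex.conj_ofReal, Complex.re_ofReal_mul]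
    nlinarith
  have h3 : (inner ℂ (weakGrad q) (weakGrad v)).re ≤ M * ∫ x in Ω, ‖χ x‖ := by
    rw [hv, inner_lp_eq_integral hq.1 (EventuallyEq.refl _ _), ← integral_const_mul]
    refine (Complex.re_le_norm _).trans ((norm_integral_le_integral_norm _).trans ?_)
    refine integral_mono_of_nonneg (Eventually.of_forall fun _ => norm_nonneg _)
      (hχi.norm.const_mul _) ?_
    filter_upwards [hF] with x hx
    refine (norm_inner_le_norm _ _).trans ?_
    rw [mul_comm M]
    gcongr
  have h4 : (inner ℂ (weakGrad q) (weakGrad w)).re ≤ (inner ℂ (weakGrad q) (weakGrad v)).re +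
      ‖weakGrad q‖ * ‖w - v‖ := by
    have e : weakGrad w = weakGrad v + weakGrad (w - v) := by rw [← map_add]; simp
    rw [e, inner_add_right, Complex.add_re]
    gcongr
    exact (Complex.re_le_norm _).trans ((norm_inner_le_norm _ _).trans (by
      gcongr; exact norm_weakGrad_le _))
  -- The two terms M ∫ |χ| cancel, one coming from -Δb ≥ M and one from |F| ≤ M. Only the
  -- approximation error remains.
  have h5 : ‖weakGrad q‖ ^ 2 ≤ ‖weakGrad q‖ * ‖w - v‖ := by linarith
  rcases (norm_nonneg (weakGrad q)).eq_or_lt with h | h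
  · rw [← h]; exact norm_nonneg _
  · rw [sq] at h5; exact le_of_mul_le_mul_left h5 h

theorem eLpNorm_le_enorm_add {α : Type*} [MeasurableSpace α] {μ : Measure α} {f : α → ℝ}
    (a b : Lp ℂ 2 μ) (h : ∀ᵐ x ∂μ, |f x| ≤ ‖a x‖ + ‖b x‖) : eLpNorm f 2 μ ≤ ‖a‖ₑ + ‖b‖ₑ := by
  have h1 : eLpNorm f 2 μ ≤ eLpNorm ((fun x => ‖a x‖) + fun x => ‖b x‖) 2 μ :=
    eLpNorm_mono_ae_real h
  refine h1.trans ((eLpNorm_add_le (Lp.aestronglyMeasurable a).norm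
    (Lp.aestronglyMeasurable b).norm (by norm_num)).trans (le_of_eq ?_))
  rw [eLpNorm_norm, eLpNorm_norm, Lp.enorm_def, Lp.enorm_def]

/-- The weak maximum principle, with a supersolution `b`. -/
theorem re_toH_le {b : Space d → ℝ} (hd : 0 < d) (hΩ : IsOpen Ω) (hbd : Bornology.IsBounded Ω)
    (hb : ContDiff ℝ ∞ b) (hb0 : ∀ x ∈ Ω, 0 ≤ b x) {M : ℝ}
    (hL : ∀ x ∈ Ω, (Laplacian.laplacian (fun x => (b x : ℂ)) x).re ≤ -M)
    {F : StateSpace Ω} (hF : ∀ᵐ x ∂volume.restrict Ω, ‖F x‖ ≤ M) {v : VSpace Ω}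
    (hv : ∀ χ : VSpace Ω, inner ℂ (weakGrad χ) (weakGrad v) = inner ℂ (toH χ) F) :
    ∀ᵐ x ∂volume.restrict Ω, (toH v x).re ≤ b x := by
  obtain ⟨R, hR⟩ := hbd.exists_norm_le
  -- Positive parts are taken of the smooth approximants rather than of v, which avoids a chain rule
  -- in V.
  obtain ⟨φ, w, hφ, hw, hlim⟩ := exists_test_tendsto v
  choose q hq using fun n => exists_isRep_of_test (isTest_posPart hΩ (hφ n) hb hb0)
  have hw0 : Tendsto (fun n => ‖w n - v‖) atTop (𝓝 0) := tendsto_iff_norm_sub_tendsto_zero.1 hlim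
  have hq0 : Tendsto (fun n => toH (q n)) atTop (𝓝 0) := by
    rw [tendsto_zero_iff_norm_tendsto_zero]
    have h2 : Tendsto (fun n => √(4 * R ^ 2 * ‖w n - v‖ ^ 2)) atTop (𝓝 0) := by
      have := (Real.continuous_sqrt.tendsto _).comp ((hw0.pow 2).const_mul (4 * R ^ 2))
      simp only [ne_eq, OfNat.ofNat_ne_zero, not_false_eq_true, zero_pow, mul_zero,
        Real.sqrt_zero] at this
      exact this
    refine squeeze_zero (fun _ => norm_nonneg _) (fun n => Real.le_sqrt_of_sq_le ?_) h2
    refine (poincare hd hR _).trans ?_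
    have := norm_weakGrad_posPart_le hΩ (hφ n) hb hb0 hL hF hv (hw n) (hq n)
    gcongr
  have hTw : Tendsto (fun n => toH (w n) - toH v) atTop (𝓝 0) := by
    have := (((toH (Ω := Ω)).continuous.tendsto v).comp hlim).sub_const (toH v)
    simpa using this
  have hmeas : AEStronglyMeasurable (fun x => posPart ((toH v x).re - b x)) (volume.restrict Ω) :=
    contDiff_posPart.continuous.comp_aestronglyMeasurable
      ((Complex.continuous_re.comp_aestronglyMeasurable (Lp.aestronglyMeasurable _)).sub
        hb.continuous.aestronglyMeasurable)
  have hle : ∀ n, eLpNorm (fun x => posPart ((toH v x).re - b x)) 2 (volume.restrict Ω) ≤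
      ‖toH (q n)‖ₑ + ‖toH (w n) - toH v‖ₑ := fun n => by
    refine eLpNorm_le_enorm_add _ _ ?_
    filter_upwards [(hq n).1, (hw n).1, Lp.coeFn_sub (toH (w n)) (toH v),
      ae_restrict_mem hΩ.measurableSet] with x h1 h2 h3 hx
    rw [h1, h3, Pi.sub_apply, h2, indicator_of_mem hx, Complex.norm_real]
    have h4 := abs_posPart_sub_le ((toH v x).re - b x) ((φ n x).re - b x)
    have h5 := Complex.abs_re_le_norm (φ n x - toH v x)
    rw [Complex.sub_re, abs_sub_comm] at h5
    rw [sub_sub_sub_cancel_right] at h4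
    have h6 := abs_sub_abs_le_abs_sub (posPart ((toH v x).re - b x)) (posPart ((φ n x).re - b x))
    rw [Real.norm_eq_abs]
    linarith
  have h0 : eLpNorm (fun x => posPart ((toH v x).re - b x)) 2 (volume.restrict Ω) = 0 := by
    have := hq0.enorm.add hTw.enorm
    simp only [enorm_zero, add_zero] at this
    exact le_antisymm (ge_of_tendsto' this hle) bot_le
  rw [eLpNorm_eq_zero_iff hmeas (by norm_num)] at h0
  filter_upwards [h0] with x hx
  by_contra hlt
  exact (posPart_pos (sub_pos.2 (not_le.1 hlt))).ne' hx

end MaximumPrinciple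

/-! ### The Dirichlet problem: weak solutions and their regularity. -/

section Dirichlet

open Filter Topology

variable {d : ℕ} {Ω : Set (Space d)}

/-- Space factors belong to `H¹₀(Ω)`, and Green's formula holds for them. -/
theorem exists_vSpace_of_spaceFactor {φ : Space d → ℂ} (hΩ : IsOpen Ω)
    (hb : Bornology.IsBounded Ω) (hφ : IsSpaceFactor Ω φ) :
    ∃ v : VSpace Ω, toH v =ᵐ[volume.restrict Ω] φ ∧ ∀ χ : VSpace Ω,
      inner ℂ (weakGrad χ) (weakGrad v) = -inner ℂ (toH χ) hφ.memLp_laplacian.toLp := by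
  have key : ∀ l : ℂ →L[ℝ] ℝ, ∃ (v : VSpace Ω) (L : StateSpace Ω),
      toH v =ᵐ[volume.restrict Ω] (fun x => (l (φ x) : ℂ)) ∧
      L =ᵐ[volume.restrict Ω] (fun x => (l (Laplacian.laplacian φ x) : ℂ)) ∧
      ∀ χ : VSpace Ω, inner ℂ (weakGrad χ) (weakGrad v) = -inner ℂ (toH χ) L := fun l => by
    have e : ∀ x ∈ Ω, Laplacian.laplacian (fun x => (l (φ x) : ℂ)) x =
        (l (Laplacian.laplacian φ x) : ℂ) := fun x hx =>
      (hφ.contDiffOn.contDiffAt (hΩ.mem_nhds hx)).laplacian_CLM_comp_left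
        (l := Complex.ofRealCLM ∘L l)
    have e' : (fun x => (l (Laplacian.laplacian φ x) : ℂ)) =ᵐ[volume.restrict Ω]
        Laplacian.laplacian fun x => (l (φ x) : ℂ) := by
      filter_upwards [ae_restrict_mem hΩ.measurableSet] with x hx using (e x hx).symm
    have hL : MemLp (Laplacian.laplacian fun x => (l (φ x) : ℂ)) 2 (volume.restrict Ω) :=
      ((Complex.ofRealCLM ∘L l).comp_memLp' hφ.memLp_laplacian).ae_eq e'
    obtain ⟨v, hv, hv'⟩ := exists_vSpace_of_real hΩ hb (l.contDiff.comp_contDiffOn hφ.contDiffOn)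
      (l.continuous.comp_continuousOn hφ.continuousOn) (fun x hx => by simp [hφ.boundary x hx]) hL
    exact ⟨v, hL.toLp, hv, hL.coeFn_toLp.trans e'.symm, hv'⟩
  obtain ⟨v, L, h1, h2, h3⟩ := key Complex.reCLM
  obtain ⟨v', L', h1', h2', h3'⟩ := key Complex.imCLM
  have hL : hφ.memLp_laplacian.toLp = L + Complex.I • L' := by
    refine Lp.ext ?_
    filter_upwards [hφ.memLp_laplacian.coeFn_toLp, Lp.coeFn_add L (Complex.I • L'),
      Lp.coeFn_smul Complex.I L', h2, h2'] with x a b c e f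
    rw [a, b, Pi.add_apply, c, Pi.smul_apply, e, f, smul_eq_mul, mul_comm]
    exact (Complex.re_add_im _).symm
  refine ⟨v + Complex.I • v', ?_, fun χ => ?_⟩
  · rw [map_add, map_smul]
    filter_upwards [Lp.coeFn_add (toH v) (Complex.I • toH v'), Lp.coeFn_smul Complex.I (toH v'),
      h1, h1'] with x b c e f
    rw [b, Pi.add_apply, c, Pi.smul_apply, e, f, smul_eq_mul, mul_comm]
    exact Complex.re_add_im _
  · rw [hL, map_add, map_smul, inner_add_right, inner_add_right, inner_smul_right,
      inner_smul_right, h3, h3']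
    ring

theorem inner_weakGrad_test {ψ : Space d → ℂ} {q : VSpace Ω} (hΩ : IsOpen Ω) (hψ : IsTest Ω ψ)
    (hq : IsRep q ψ) (hL : MemLp (Laplacian.laplacian ψ) 2 (volume.restrict Ω)) (χ : VSpace Ω) :
    inner ℂ (weakGrad χ) (weakGrad q) = -inner ℂ (toH χ) hL.toLp := by
  have htest : ∀ (φ : Space d → ℂ) (p : VSpace Ω), IsTest Ω φ → IsRep p φ →
      inner ℂ (weakGrad p) (weakGrad q) = -inner ℂ (toH p) hL.toLp := by
    intro φ p hφ hp
    have g := green_left hΩ ((hψ.contDiff.of_le (by norm_cast)).contDiffOn (s := Ω))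
      (hφ.contDiff.of_le (by norm_cast)) hφ.hasCompactSupport hφ.tsupport_subset
    rw [inner_lp_eq_integral hp.2 hq.2, inner_lp_eq_integral hp.1 hL.coeFn_toLp,
      ← neg_eq_iff_eq_neg.2 g]
    simp [mul_comm]
  obtain ⟨φ, p, hφ, hp, hlim⟩ := exists_test_tendsto χ
  exact tendsto_nhds_unique ((((weakGrad (Ω := Ω)).continuous.tendsto χ).comp hlim).inner
    tendsto_const_nhds) (((((toH (Ω := Ω)).continuous.tendsto χ).comp hlim).inner
      tendsto_const_nhds).neg.congr fun n => (htest _ _ (hφ n) (hp n)).symm)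

theorem eq_zero_of_inner_test (hΩ : IsOpen Ω) (hb : Bornology.IsBounded Ω) {z : StateSpace Ω}
    (h : ∀ (ψ : Space d → ℂ) (q : VSpace Ω), IsTest Ω ψ → IsRep q ψ → inner ℂ (toH q) z = 0) :
    z = 0 := by
  have : IsFiniteMeasure (volume.restrict Ω) := ⟨by simpa using hb.measure_lt_top⟩
  have hzi : Integrable z (volume.restrict Ω) := (Lp.memLp z).integrable (by norm_num)
  have h0 := hΩ.ae_eq_zero_of_integral_contDiff_smul_eq_zero (μ := volume) (f := z)
    (IntegrableOn.locallyIntegrableOn hzi) fun g hg hgc hgs => by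
      have hgC : IsTest Ω fun x => (g x : ℂ) := ⟨Complex.ofRealCLM.contDiff.comp hg,
        hgc.comp_left Complex.ofReal_zero,
        (closure_mono fun x hx => by
          rw [Function.mem_support] at hx ⊢; exact_mod_cast hx).trans hgs⟩
      obtain ⟨q, hq⟩ := exists_isRep_of_test hgC
      have h1 := h _ q hgC hq
      rw [inner_lp_eq_integral hq.1 (EventuallyEq.refl _ _)] at h1
      rw [← setIntegral_eq_integral_of_forall_compl_eq_zero (s := Ω), ← h1]
      · refine integral_congr_ae (Eventually.of_forall fun x => ?_)
        simp [mul_comm]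
      · intro x hx
        rw [image_eq_zero_of_notMem_tsupport fun h => hx (hgs h), zero_smul]
  refine Lp.ext ?_
  filter_upwards [(ae_restrict_iff' hΩ.measurableSet).2 h0, Lp.coeFn_zero ℂ 2 (volume.restrict Ω)]
    with x h1 h2
  rw [h1, h2, Pi.zero_apply]

theorem denseRange_toH (hΩ : IsOpen Ω) (hb : Bornology.IsBounded Ω) :
    DenseRange (toH (Ω := Ω)) := by
  change Dense ((toH (Ω := Ω)).range : Set (StateSpace Ω))
  rw [Submodule.dense_iff_topologicalClosure_eq_top, Submodule.topologicalClosure_eq_top_iff,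
    Submodule.eq_bot_iff]
  exact fun z hz => eq_zero_of_inner_test hΩ hb fun _ q _ _ => hz _ ⟨q, rfl⟩

/-- The weak solution of the Dirichlet problem. -/
theorem exists_weak_dirichlet (hd : 0 < d) (hb : Bornology.IsBounded Ω) (F : StateSpace Ω) :
    ∃ v : VSpace Ω, ∀ χ : VSpace Ω, inner ℂ (weakGrad χ) (weakGrad v) = inner ℂ (toH χ) F := by
  obtain ⟨R, hR⟩ := hb.exists_norm_le
  set A : VSpace Ω →L[ℂ] VSpace Ω :=
    (ContinuousLinearMap.adjoint (weakGrad (Ω := Ω))) ∘L weakGrad with hA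
  have hAi : ∀ v w, inner ℂ v (A w) = inner ℂ (weakGrad v) (weakGrad w) := fun v w => by
    rw [hA, ContinuousLinearMap.comp_apply, ContinuousLinearMap.adjoint_inner_right]
  have hc : (0 : ℝ) < 1 / (4 * R ^ 2 + 1) := by positivity
  -- Lax–Milgram: `A` represents the Dirichlet form in V, and the Poincaré inequality gives ‖v‖² ≤
  -- (4R² + 1) ‖∇v‖².
  have hunit : IsUnit A := by
    refine ContinuousLinearMap.isUnit_of_forall_le_norm_inner_map A (c := ⟨_, hc.le⟩)
      (by exact_mod_cast hc) fun v => ?_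
    have h1 : ‖inner ℂ (A v) v‖ = ‖weakGrad v‖ ^ 2 := by
      refine (norm_inner_symm (𝕜 := ℂ) (A v) v).trans ?_
      rw [hAi, inner_self_eq_norm_sq_to_K]
      simp
    rw [h1, norm_sq_vSpace]
    change (‖toH v‖ ^ 2 + ‖weakGrad v‖ ^ 2) * (1 / (4 * R ^ 2 + 1)) ≤ _
    rw [mul_one_div, div_le_iff₀ (by positivity)]
    linarith [poincare hd hR v]
  obtain ⟨v, hv⟩ := (ContinuousLinearMap.isUnit_iff_bijective.1 hunit).2
    (ContinuousLinearMap.adjoint (toH (Ω := Ω)) F)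
  exact ⟨v, fun χ => by rw [← hAi, hv, ContinuousLinearMap.adjoint_inner_right]⟩

/-- The bound for weak solutions of the Dirichlet problem by a supersolution. -/
theorem norm_toH_le_of_barrier {b : Space d → ℝ} (hd : 0 < d) (hΩ : IsOpen Ω)
    (hbd : Bornology.IsBounded Ω) (hb : ContDiff ℝ ∞ b) (hb0 : ∀ x ∈ Ω, 0 ≤ b x)
    (hL : ∀ x ∈ Ω, (Laplacian.laplacian (fun x => (b x : ℂ)) x).re ≤ -1)
    {M : ℝ} (hM : 0 ≤ M) {F : StateSpace Ω} (hF : ∀ᵐ x ∂volume.restrict Ω, ‖F x‖ ≤ M)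
    {v : VSpace Ω}
    (hv : ∀ χ : VSpace Ω, inner ℂ (weakGrad χ) (weakGrad v) = inner ℂ (toH χ) F) :
    ∀ᵐ x ∂volume.restrict Ω, ‖toH v x‖ ≤ 2 * (M * b x) := by
  have hLM : ∀ x ∈ Ω, (Laplacian.laplacian (fun x => ((M * b x : ℝ) : ℂ)) x).re ≤ -M := by
    intro x hx
    have hbC : ContDiff ℝ 2 fun x => (b x : ℂ) :=
      (Complex.ofRealCLM.contDiff.comp hb).of_le (by norm_cast)
    have e : (fun x => ((M * b x : ℝ) : ℂ)) = M • fun x => (b x : ℂ) := by ext x; simp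
    rw [e, InnerProductSpace.laplacian_smul M hbC.contDiffAt, Complex.smul_re, smul_eq_mul]
    nlinarith [hL x hx]
  -- The problem is invariant under rotation by a unit c; the choices ±1 and ±i bound the real and
  -- the imaginary part by M b, whence the factor 2.
  have key : ∀ c : ℂ, ‖c‖ = 1 → ∀ᵐ x ∂volume.restrict Ω, (c * toH v x).re ≤ M * b x := by
    intro c hc
    have h := re_toH_le (F := c • F) (v := c • v) (b := fun x => M * b x) hd hΩ hbd
      (contDiff_const.mul hb) (fun x hx => mul_nonneg hM (hb0 x hx)) hLM
      (by
        filter_upwards [hF, Lp.coeFn_smul c F] with x h1 h2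
        rw [h2, Pi.smul_apply, norm_smul, hc, one_mul]; exact h1)
      (fun χ => by rw [map_smul, inner_smul_right, inner_smul_right, hv])
    rw [map_smul] at h
    filter_upwards [h, Lp.coeFn_smul c (toH v)] with x h1 h2
    rwa [h2, Pi.smul_apply, smul_eq_mul] at h1
  filter_upwards [key 1 (by simp), key (-1) (by simp), key Complex.I (by simp),
    key (-Complex.I) (by simp)] with x h1 h2 h3 h4
  have := Complex.norm_le_abs_re_add_abs_im (toH v x)
  simp only [one_mul, neg_mul, Complex.neg_re, Complex.mul_re, Complex.I_re, Complex.I_im,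
    zero_mul, zero_sub, one_mul, neg_neg] at h1 h2 h3 h4
  have h5 : |(toH v x).re| ≤ M * b x := abs_le.2 ⟨by linarith, h1⟩
  have h6 : |(toH v x).im| ≤ M * b x := abs_le.2 ⟨by linarith, by linarith⟩
  linarith

/-- The classical solution of the Dirichlet problem with a smooth right-hand side. -/
theorem exists_spaceFactor_laplacian_eq (hd : 0 < d) (hΩ : IsOpen Ω)
    (hbd : Bornology.IsBounded Ω) (hs : HasSmoothBoundary Ω) {p : Space d → ℂ}
    (hp : ContDiff ℝ ∞ p) : ∃ φ : Space d → ℂ, IsSpaceFactor Ω φ ∧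
      Laplacian.laplacian φ =ᵐ[volume.restrict Ω] Laplacian.laplacian p := by
  have hfin : IsFiniteMeasure (volume.restrict Ω) := ⟨by simpa using hbd.measure_lt_top⟩
  have hp2 : ContDiff ℝ 2 p := hp.of_le (by norm_cast)
  have hcl : IsCompact (closure Ω) := hbd.isCompact_closure
  have hbound : ∀ {f : Space d → ℂ}, Continuous f → MemLp f 2 (volume.restrict Ω) := by
    intro f hf
    obtain ⟨C, hC⟩ := hcl.exists_bound_of_continuousOn hf.continuousOn
    refine MemLp.of_bound hf.aestronglyMeasurable C ?_
    filter_upwards [ae_restrict_mem hΩ.measurableSet] with x hx using hC x (subset_closure hx)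
  have hLc := continuous_laplacian hp2
  have hLp := hbound hLc
  obtain ⟨M, hM⟩ := hcl.exists_bound_of_continuousOn hLc.continuousOn
  obtain ⟨v, hv⟩ := exists_weak_dirichlet hd hbd (-hLp.toLp)
  have hF : ∀ᵐ x ∂volume.restrict Ω, ‖(-hLp.toLp : StateSpace Ω) x‖ ≤ max M 0 := by
    filter_upwards [Lp.coeFn_neg hLp.toLp, hLp.coeFn_toLp, ae_restrict_mem hΩ.measurableSet]
      with x h1 h2 hx
    rw [h1, Pi.neg_apply, h2, norm_neg]
    exact (hM x (subset_closure hx)).trans (le_max_left _ _)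
  have hTi : Integrable (toH v) (volume.restrict Ω) := (Lp.memLp _).integrable (by norm_num)
  have hpi : Integrable p (volume.restrict Ω) := (hbound hp.continuous).integrable (by norm_num)
  -- The weak solution v and p have the same distributional Laplacian, so v - p is weakly harmonic
  -- and Weyl's lemma applies to it.
  have hharm : ∀ χ, IsTest Ω χ → ∫ x in Ω, (toH v x - p x) * Laplacian.laplacian χ x = 0 := by
    intro χ hχ
    have hχs : IsTest Ω fun x => star (χ x) := ⟨contDiff_star hχ.contDiff, by
      rw [HasCompactSupport, tsupport_star]; exact hχ.hasCompactSupport, by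
      rw [tsupport_star]; exact hχ.tsupport_subset⟩
    have hχ2 : ContDiff ℝ 2 χ := hχ.contDiff.of_le (by norm_cast)
    have hχs2 : ContDiff ℝ 2 fun x => star (χ x) := hχs.contDiff.of_le (by norm_cast)
    obtain ⟨q, hq⟩ := exists_isRep_of_test hχs
    have hL : MemLp (Laplacian.laplacian fun x => star (χ x)) 2 (volume.restrict Ω) :=
      memLp_laplacian_of_hasCompactSupport hχs2 hχs.hasCompactSupport
    have h1 := inner_weakGrad_test hΩ hχs hq hL v
    have h2 := hv q
    rw [← inner_conj_symm, h1, map_neg, inner_conj_symm, inner_neg_right, neg_inj,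
      inner_lp_eq_integral hL.coeFn_toLp (EventuallyEq.refl _ _),
      inner_lp_eq_integral hq.1 hLp.coeFn_toLp] at h2
    have h3 := green_left hΩ hp2.contDiffOn (hχs2.of_le (by norm_num)) hχs.hasCompactSupport
      hχs.tsupport_subset
    have h4 := green_right hΩ (hp2.of_le (by norm_num)).contDiffOn hχs2 hχs.hasCompactSupport
      hχs.tsupport_subset
    rw [← h4] at h3
    have e1 : ∫ x in Ω, toH v x * Laplacian.laplacian χ x = ∫ x in Ω, p x * Laplacian.laplacian χ x := by
      simp only [RCLike.inner_apply, laplacian_star hχ2.contDiffAt] at h2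
      simp only [laplacian_star hχ2.contDiffAt, star_star] at h3
      simp only [Complex.star_def, Complex.conj_conj] at h2 h3
      rw [h2]
      simpa only [mul_comm] using h3
    obtain ⟨C, hC⟩ := (HasCompactSupport.of_support_subset_isCompact hχ.hasCompactSupport
      (support_laplacian_subset χ)).exists_bound_of_continuous (continuous_laplacian hχ2)
    simp only [sub_mul]
    rw [integral_sub (hTi.mul_bdd (continuous_laplacian hχ2).aestronglyMeasurable
      (Eventually.of_forall hC)) (hpi.mul_bdd (continuous_laplacian hχ2).aestronglyMeasurable
      (Eventually.of_forall hC)), e1, sub_self]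
  obtain ⟨g, hg, hgae⟩ := weyl (H := Ω.indicator fun x => toH v x - p x) hΩ
    ((integrable_indicator_iff hΩ.measurableSet).2 (hTi.sub hpi)) fun χ hχ => by
      rw [← hharm χ hχ, ← integral_indicator hΩ.measurableSet]
      congr 1; ext x
      by_cases hx : x ∈ Ω <;> simp [hx]
  have hgae' : ∀ᵐ x ∂volume.restrict Ω, toH v x = g x + p x := by
    rw [ae_restrict_iff' hΩ.measurableSet]
    filter_upwards [hgae] with x h1 hx
    rw [← h1 hx, indicator_of_mem hx]; ring
  have hΔg := laplacian_ae_eq_zero hΩ hg fun χ hχ => by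
    rw [← hharm χ hχ]
    refine integral_congr_ae ?_
    filter_upwards [hgae'] with x h1
    rw [h1]; ring
  -- The boundary condition holds by definition; continuity at the boundary is what the barrier has
  -- to supply.
  set φ : Space d → ℂ := Ω.indicator fun x => g x + p x with hφ
  have hφe : ∀ x ∈ Ω, φ =ᶠ[𝓝 x] g + p := fun x hx => by
    filter_upwards [hΩ.mem_nhds hx] with y hy using indicator_of_mem hy _
  have hgp : ∀ x ∈ Ω, ContDiffAt ℝ 2 (g + p) x := fun x hx =>
    ((hg.of_le (by norm_cast)).contDiffAt (hΩ.mem_nhds hx)).add hp2.contDiffAt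
  have hφ2 : ContDiffOn ℝ 2 φ Ω := fun x hx =>
    ((hgp x hx).congr_of_eventuallyEq (hφe x hx)).contDiffWithinAt
  have hΔφ : Laplacian.laplacian φ =ᵐ[volume.restrict Ω] Laplacian.laplacian p := by
    rw [EventuallyEq, ae_restrict_iff' hΩ.measurableSet]
    filter_upwards [hΔg] with x h1 hx
    rw [(InnerProductSpace.laplacian_congr_nhds (hφe x hx)).eq_of_nhds,
      ContDiffAt.laplacian_add ((hg.of_le (by norm_cast)).contDiffAt (hΩ.mem_nhds hx))
        hp2.contDiffAt, h1 hx, zero_add]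
  have hφ0 : ∀ x ∈ frontier Ω, φ x = 0 := fun x hx => by
    rw [hΩ.frontier_eq] at hx; exact indicator_of_notMem hx.2 _
  refine ⟨φ, ⟨hφ2, fun x hx => ?_, hφ0, hLp.ae_eq hΔφ.symm⟩, hΔφ⟩
  by_cases hxΩ : x ∈ Ω
  · exact ((hφ2.continuousOn.continuousAt (hΩ.mem_nhds hxΩ))).continuousWithinAt
  have hxf : x ∈ frontier Ω := by rw [hΩ.frontier_eq]; exact ⟨hx, hxΩ⟩
  obtain ⟨b, hb, hbx, hb0, hbL⟩ := exists_barrier hΩ hbd hs hxf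
  have hle := norm_toH_le_of_barrier hd hΩ hbd hb hb0 hbL (le_max_right M 0) hF hv
  -- Stating the inequality as an equality of continuous functions upgrades it from almost
  -- everywhere to everywhere in Ω.
  have hle' : EqOn (fun y => max ‖φ y‖ (2 * (max M 0 * b y))) (fun y => 2 * (max M 0 * b y)) Ω := by
    refine Measure.eqOn_open_of_ae_eq (μ := volume) ?_ hΩ
      (hφ2.continuousOn.norm.sup (hb.continuous.const_mul _ |>.const_mul _).continuousOn)
      (hb.continuous.const_mul _ |>.const_mul _).continuousOn
    filter_upwards [hle, hgae', ae_restrict_mem hΩ.measurableSet] with y h1 h2 hy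
    refine max_eq_right ?_
    rw [hφ, indicator_of_mem hy, ← h2]; exact h1
  rw [ContinuousWithinAt, hφ0 x hxf, tendsto_zero_iff_norm_tendsto_zero]
  have hlim : Tendsto (fun y => |2 * (max M 0 * b y)|) (𝓝[closure Ω] x) (𝓝 0) := by
    have : ContinuousAt (fun y => |2 * (max M 0 * b y)|) x := by
      have := hb.continuous; fun_prop
    have h2 := this.tendsto
    simp only [hbx, mul_zero, abs_zero] at h2
    exact h2.mono_left nhdsWithin_le_nhds
  refine squeeze_zero (fun _ => norm_nonneg _) (fun y => ?_) hlim
  by_cases hy : y ∈ Ω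
  · exact (max_eq_right_iff.1 (hle' hy)).trans (le_abs_self _)
  · rw [hφ, indicator_of_notMem hy, norm_zero]; exact abs_nonneg _

end Dirichlet

/-! ### Totality of Δφ and of φ - Δφ for space factors φ. -/

section Density

open Filter Topology FourierTransform
open scoped SchwartzMap

variable {d : ℕ} {Ω : Set (Space d)}

theorem laplacian_cexp (L : Space d →L[ℝ] ℂ) (x : Space d) :
    Laplacian.laplacian (fun x => Complex.exp (L x)) x =
      (∑ i, L (EuclideanSpace.single i 1) ^ 2) * Complex.exp (L x) := by
  have hd : ∀ x v, fderiv ℝ (fun x => Complex.exp (L x)) x v = L v * Complex.exp (L x) := by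
    intro x v
    rw [(L.hasFDerivAt.cexp (x := x)).fderiv]
    simp [mul_comm]
  have hc : ContDiff ℝ 2 fun x => Complex.exp (L x) := L.contDiff.cexp
  rw [laplacian_eq_sum hc.contDiffAt, Finset.sum_mul]
  refine Finset.sum_congr rfl fun i _ => ?_
  simp only [hd]
  rw [fderiv_const_mul ((hc.differentiable (by norm_num)) x)]
  simp only [smul_apply, hd, smul_eq_mul]
  ring

/-- The linear form `x ↦ -2πi ⟨x, ξ⟩`. -/
def phase (ξ : Space d) : Space d →L[ℝ] ℂ :=
  (-2 * Real.pi * Complex.I : ℂ) • (Complex.ofRealCLM ∘L innerSL ℝ ξ)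

theorem phase_apply (ξ x : Space d) :
    phase ξ x = ((-2 * Real.pi * inner ℝ x ξ : ℝ) : ℂ) * Complex.I := by
  simp only [phase, smul_apply, ContinuousLinearMap.comp_apply, innerSL_apply_apply,
    Complex.ofRealCLM_apply, smul_eq_mul, real_inner_comm ξ x]
  push_cast
  ring

theorem sum_phase_sq (ξ : Space d) :
    ∑ i, phase ξ (EuclideanSpace.single i 1) ^ 2 = ((-(4 * Real.pi ^ 2 * ‖ξ‖ ^ 2) : ℝ) : ℂ) := by
  rw [EuclideanSpace.norm_sq_eq, Finset.mul_sum, ← Finset.sum_neg_distrib, Complex.ofReal_sum]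
  refine Finset.sum_congr rfl fun i _ => ?_
  rw [phase_apply, mul_pow, Complex.I_sq, EuclideanSpace.inner_single_left]
  simp
  ring

/-- The Laplacians of the space factors are dense. -/
theorem eq_zero_of_inner_laplacian (hd : 0 < d) (hΩ : IsOpen Ω) (hb : Bornology.IsBounded Ω)
    (hs : HasSmoothBoundary Ω) {z : StateSpace Ω}
    (h : ∀ (φ : Space d → ℂ) (hφ : IsSpaceFactor Ω φ), inner ℂ hφ.memLp_laplacian.toLp z = 0) :
    z = 0 := by
  have : IsFiniteMeasure (volume.restrict Ω) := ⟨by simpa using hb.measure_lt_top⟩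
  have hzi : Integrable (Ω.indicator z) :=
    (integrable_indicator_iff hΩ.measurableSet).2 ((Lp.memLp z).integrable (by norm_num))
  -- An exponential is an eigenfunction of Δ with a nonzero eigenvalue for ξ ≠ 0, so some Δφ is a
  -- nonzero multiple of it. The frequency is -ξ because the inner product conjugates its first
  -- argument.
  have hF : ∀ ξ : Space d, ξ ≠ 0 → 𝓕 (Ω.indicator z) ξ = 0 := by
    intro ξ hξ
    have hξ' : -ξ ≠ 0 := neg_ne_zero.2 hξ
    obtain ⟨φ, hφ, hΔ⟩ := exists_spaceFactor_laplacian_eq hd hΩ hb hs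
      (p := fun x => Complex.exp (phase (-ξ) x)) (phase (-ξ)).contDiff.cexp
    rw [show Laplacian.laplacian (fun x => Complex.exp (phase (-ξ) x)) = _ from
      funext (laplacian_cexp _), sum_phase_sq] at hΔ
    have h1 := h φ hφ
    rw [inner_lp_eq_integral (hφ.memLp_laplacian.coeFn_toLp.trans hΔ) (EventuallyEq.refl _ _)] at h1
    simp only [RCLike.inner_apply, map_mul, Complex.conj_ofReal,
      ← Complex.exp_conj, phase_apply, Complex.conj_I, inner_neg_right] at h1
    rw [Real.fourier_eq']
    simp only [smul_eq_mul]
    have h2 : ∫ x in Ω, z x * ((((-(4 * Real.pi ^ 2 * ‖-ξ‖ ^ 2) : ℝ) : ℂ)) *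
        Complex.exp (((-2 * Real.pi * -inner ℝ x ξ : ℝ) : ℂ) * -Complex.I)) =
        ((-(4 * Real.pi ^ 2 * ‖-ξ‖ ^ 2) : ℝ) : ℂ) *
          ∫ x, Complex.exp (((-2 * Real.pi * inner ℝ x ξ : ℝ) : ℂ) * Complex.I) *
            Ω.indicator z x := by
      rw [← integral_const_mul, ← integral_indicator hΩ.measurableSet]
      congr 1; ext x
      by_cases hx : x ∈ Ω
      · simp only [indicator_of_mem hx]
        rw [show ((-2 * Real.pi * -inner ℝ x ξ : ℝ) : ℂ) * -Complex.I =
          ((-2 * Real.pi * inner ℝ x ξ : ℝ) : ℂ) * Complex.I by push_cast; ring]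
        ring
      · simp [hx]
    rw [h2, mul_eq_zero] at h1
    refine h1.resolve_left ?_
    rw [Complex.ofReal_eq_zero, neg_eq_zero, ← ne_eq]
    positivity
  refine eq_zero_of_inner_test hΩ hb fun ψ q hψ hq => ?_
  have hψs : IsTest Ω fun x => star (ψ x) := ⟨contDiff_star hψ.contDiff, by
    rw [HasCompactSupport, tsupport_star]; exact hψ.hasCompactSupport, by
    rw [tsupport_star]; exact hψ.tsupport_subset⟩
  set g : 𝓢(Space d, ℂ) := hψs.hasCompactSupport.toSchwartzMap hψs.contDiff with hg
  set k : 𝓢(Space d, ℂ) := 𝓕⁻ g with hk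
  -- The transform is shifted onto k, the inverse transform of the conjugated test function; the
  -- exceptional frequency 0 is a null set as 0 < d.
  have h1 := VectorFourier.integral_fourierIntegral_smul_eq_flip (μ := volume) (ν := volume)
    (e := Real.fourierChar) (L := innerₗ (Space d)) (f := Ω.indicator z) (g := ⇑k)
    Real.continuous_fourierChar continuous_inner hzi k.integrable
  have h2 : ∫ ξ, VectorFourier.fourierIntegral Real.fourierChar volume (innerₗ (Space d))
      (Ω.indicator z) ξ • k ξ = 0 := by
    have : Nonempty (Fin d) := ⟨⟨0, hd⟩⟩
    refine integral_eq_zero_of_ae ?_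
    filter_upwards [Measure.ae_ne volume (0 : Space d)] with ξ hξ
    have := hF ξ hξ
    change VectorFourier.fourierIntegral Real.fourierChar volume (innerₗ (Space d))
      (Ω.indicator z) ξ = 0 at this
    rw [this, zero_smul, Pi.zero_apply]
  have h3 : VectorFourier.fourierIntegral Real.fourierChar volume (innerₗ (Space d)).flip
      (⇑k) = g := by
    rw [flip_innerₗ]
    change 𝓕 ⇑k = g
    rw [← SchwartzMap.fourier_coe, hk, FourierInvPair.fourier_fourierInv_eq]
  rw [h2, h3] at h1
  rw [inner_lp_eq_integral hq.1 (EventuallyEq.refl _ _), h1, ← integral_indicator hΩ.measurableSet]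
  congr 1; ext x
  by_cases hx : x ∈ Ω
  · simp [hx, hg]
  · simp [hx]

/-- The functions `φ - Δφ`, with a space factor `φ`, are dense. -/
theorem eq_zero_of_inner_sub_laplacian (hd : 0 < d) (hΩ : IsOpen Ω) (hb : Bornology.IsBounded Ω)
    (hs : HasSmoothBoundary Ω) {z : StateSpace Ω}
    (h : ∀ (φ : Space d → ℂ) (hφ : IsSpaceFactor Ω φ) (v : VSpace Ω),
      toH v =ᵐ[volume.restrict Ω] φ → inner ℂ (toH v - hφ.memLp_laplacian.toLp) z = 0) :
    z = 0 := by
  -- Duality: with -Δv = z weakly, ⟪φ, z⟫ = ⟪∇φ, ∇v⟫ = -⟪Δφ, v⟫, so orthogonality of z to φ - Δφ is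
  -- orthogonality of v + z to Δφ. Then z = -v, and ‖∇v‖² = ⟪v, z⟫ = -‖z‖² forces z = 0.
  obtain ⟨v, hv⟩ := exists_weak_dirichlet hd hb z
  have h1 : toH v + z = 0 := eq_zero_of_inner_laplacian hd hΩ hb hs fun φ hφ => by
    obtain ⟨w, hw, hw'⟩ := exists_vSpace_of_spaceFactor hΩ hb hφ
    have h2 := h φ hφ w hw
    rw [inner_sub_left, ← hv, ← inner_conj_symm, hw', map_neg, inner_conj_symm] at h2
    rw [inner_add_right]
    linear_combination -h2
  have h2 := hv v
  rw [eq_neg_of_add_eq_zero_left h1, inner_neg_left, inner_self_eq_norm_sq_to_K,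
    inner_self_eq_norm_sq_to_K] at h2
  have h3 : ‖weakGrad v‖ ^ 2 = -‖z‖ ^ 2 := by exact_mod_cast h2
  have : ‖z‖ ^ 2 = 0 := by nlinarith [sq_nonneg ‖weakGrad v‖, sq_nonneg ‖z‖]
  simpa using this

end Density

/-! ### Operator families, energy estimate and duality pairing. -/

section AbstractEvolution

open Filter Topology

variable {H V : Type*} [NormedAddCommGroup H] [InnerProductSpace ℂ H] [CompleteSpace H]
  [NormedAddCommGroup V] [InnerProductSpace ℂ V] [CompleteSpace V]

/-- Operators which depend on `t` in a weakly differentiable way depend on `t` continuously. -/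
theorem continuousAt_of_weak_differentiableAt {A : ℝ → H →L[ℂ] H} {t₀ : ℝ}
    (h : ∀ φ ψ : H, DifferentiableAt ℝ (fun t => inner ℂ ψ (A t φ)) t₀) : ContinuousAt A t₀ := by
  refine tendsto_of_seq_tendsto fun u hu => ?_
  -- The difference quotients are weakly bounded. The uniform boundedness principle, applied twice,
  -- bounds them in operator norm, so `A (u n) - A t₀` is of order |u n - t₀|.
  set D : ℕ → H →L[ℂ] H := fun n => ((u n - t₀ : ℝ) : ℂ)⁻¹ • (A (u n) - A t₀) with hD
  have h1 : ∀ φ ψ : H, ∃ C, ∀ n, ‖inner ℂ ψ (D n φ)‖ ≤ C := fun φ ψ => by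
    obtain ⟨c, hc⟩ := (h φ ψ).isBigO_sub.bound
    have hb : IsBoundedUnder (· ≤ ·) atTop fun n => ‖inner ℂ ψ (D n φ)‖ := by
      refine ⟨max c 0, ?_⟩
      rw [eventually_map]
      filter_upwards [hu.eventually hc] with n hn
      rw [hD]
      simp only [smul_apply, sub_apply, inner_smul_right,
        inner_sub_right, norm_mul, norm_inv, Complex.norm_real]
      rcases eq_or_ne (u n - t₀) 0 with h0 | h0
      · simp [h0]
      · rw [inv_mul_le_iff₀ (norm_pos_iff.2 h0), mul_comm]
        exact hn.trans (by gcongr; exact le_max_left _ _)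
    obtain ⟨C, hC⟩ := hb.bddAbove_range
    exact ⟨C, fun n => hC ⟨n, rfl⟩⟩
  have h2 : ∀ φ : H, ∃ C, ∀ n, ‖D n φ‖ ≤ C := fun φ => by
    obtain ⟨C, hC⟩ := banach_steinhaus (g := fun n => innerSL ℂ (D n φ)) fun ψ => by
      obtain ⟨C, hC⟩ := h1 φ ψ
      exact ⟨C, fun n => by rw [innerSL_apply_apply, norm_inner_symm]; exact hC n⟩
    exact ⟨C, fun n => by simpa using hC n⟩
  obtain ⟨C, hC⟩ := banach_steinhaus h2
  rw [tendsto_iff_norm_sub_tendsto_zero]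
  have h3 : Tendsto (fun n => |u n - t₀| * C) atTop (𝓝 0) := by
    have := ((tendsto_iff_norm_sub_tendsto_zero.1 hu)).mul_const C
    simpa using this
  refine squeeze_zero (fun _ => norm_nonneg _) (fun n => ?_) h3
  rcases eq_or_ne (u n) t₀ with h0 | h0
  · simp [h0]
  · have h4 : A (u n) - A t₀ = ((u n - t₀ : ℝ) : ℂ) • D n := by
      rw [hD]
      simp only
      rw [smul_smul, mul_inv_cancel₀ (by rw [Complex.ofReal_ne_zero]; exact sub_ne_zero.2 h0),
        one_smul]
    rw [Function.comp_apply, h4, norm_smul, Complex.norm_real, Real.norm_eq_abs]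
    gcongr
    exact hC n

/-- Norm continuity of the family serves here to make t ↦ A(t) z(t) measurable. -/
theorem memLp_clm_apply {A : ℝ → H →L[ℂ] H} {T C : ℝ} (hA : ContinuousOn A (Ioo 0 T))
    (hC : ∀ t ∈ Ioo 0 T, ‖A t‖ ≤ C) {z : ℝ → H} (hz : MemLp z 2 (timeMeasure T)) :
    MemLp (fun t => A t (z t)) 2 (timeMeasure T) := by
  refine hz.of_le_mul (c := C) ?_ ?_
  · exact (ContinuousLinearMap.apply ℂ H).flip.aestronglyMeasurable_comp₂
      (hA.aestronglyMeasurable measurableSet_Ioo) hz.aestronglyMeasurable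
  · filter_upwards [ae_restrict_mem measurableSet_Ioo] with t ht
    exact ((A t).le_opNorm _).trans (by gcongr; exact hC t ht)

/-- The integral has the form ⟪ψ, x⟫ with a vector x that depends on η only. If it vanishes on a
total set then x = 0, and the identity holds for every ψ. -/
theorem eq_zero_of_weak_evolution_of_total {J : V →L[ℂ] H} (hJ : ∀ v, ‖J v‖ ≤ ‖v‖)
    (hd : DenseRange J) {S : Set H} (hS : ∀ x : H, (∀ ψ ∈ S, inner ℂ ψ x = 0) → x = 0) {T : ℝ}
    {z g : ℝ → H} (hz : MemLp z 2 (timeMeasure T)) (hg : MemLp g 2 (timeMeasure T))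
    (him : ∀ᵐ t ∂timeMeasure T, (inner ℂ (z t) (g t)).im = 0)
    (h : ∀ η : ℝ → ℝ, ContDiff ℝ ∞ η → HasCompactSupport η → tsupport η ⊆ Ioo 0 T → ∀ ψ ∈ S,
      ∫ t in Ioo 0 T, (-Complex.I * (η t : ℂ) * inner ℂ (solutionOp J ψ) (z t) +
        (((∫ s in Ioo 0 t, η s) - ∫ s in Ioo 0 T, η s : ℝ) : ℂ) *
          ((1 / 2 : ℂ) * inner ℂ (solutionOp J ψ - ψ) (z t) -
            inner ℂ (solutionOp J ψ) (g t))) = 0) :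
    z =ᵐ[timeMeasure T] 0 := by
  set B := solutionOp J with hB
  refine eq_zero_of_weak_evolution (B := B) (inner_solutionOp J)
    (norm_one_sub_solutionOp_le hJ) (tendsto_one_sub_solutionOp_pow hJ hd) hz hg him
    fun η h1 h2 h3 ψ => ?_
  set θ : ℝ → ℝ := fun t => (∫ s in Ioo 0 t, η s) - ∫ s in Ioo 0 T, η s with hθ
  have hηi : IntegrableOn η (Ioo 0 T) := integrableOn_test h1.continuous
  have hθc : ContinuousOn θ (Icc 0 T) := (continuousOn_primitive_Ioo hηi).sub continuousOn_const
  obtain ⟨C, hC⟩ := isCompact_Icc.exists_bound_of_continuousOn hθc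
  obtain ⟨C', hC'⟩ := h2.exists_bound_of_continuous h1.continuous
  have hzi : Integrable z (timeMeasure T) := hz.integrable (by norm_num)
  have hgi : Integrable g (timeMeasure T) := hg.integrable (by norm_num)
  set k : ℝ → H := fun t => (-Complex.I * (η t : ℂ)) • B (z t) +
    ((θ t : ℝ) : ℂ) • ((1 / 2 : ℂ) • (B (z t) - z t) - B (g t)) with hk
  have hθm : AEStronglyMeasurable (fun t => ((θ t : ℝ) : ℂ)) (timeMeasure T) :=
    Complex.continuous_ofReal.comp_aestronglyMeasurable
      ((hθc.mono Ioo_subset_Icc_self).aestronglyMeasurable measurableSet_Ioo)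
  have hηm : AEStronglyMeasurable (fun t => -Complex.I * (η t : ℂ)) (timeMeasure T) :=
    (continuous_const.mul (Complex.continuous_ofReal.comp h1.continuous)).aestronglyMeasurable
  have hki : Integrable k (timeMeasure T) := by
    refine Integrable.add ?_ ?_
    · refine (B.integrable_comp hzi).bdd_smul C' hηm (Eventually.of_forall fun t => ?_)
      simpa using hC' t
    · refine ((((B.integrable_comp hzi).sub hzi).smul (1 / 2 : ℂ)).sub
        (B.integrable_comp hgi)).bdd_smul C hθm ?_
      filter_upwards [ae_restrict_mem measurableSet_Ioo] with t ht
      rw [Complex.norm_real]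
      exact hC t (Ioo_subset_Icc_self ht)
  have key : ∀ ψ, ∫ t in Ioo 0 T, (-Complex.I * (η t : ℂ) * inner ℂ (B ψ) (z t) +
        ((θ t : ℝ) : ℂ) * ((1 / 2 : ℂ) * inner ℂ (B ψ - ψ) (z t) - inner ℂ (B ψ) (g t))) =
      inner ℂ ψ (∫ t in Ioo 0 T, k t) := fun ψ => by
    rw [← integral_inner hki]
    refine integral_congr_ae (Eventually.of_forall fun t => ?_)
    simp only [hk, inner_add_right, inner_smul_right, inner_sub_right, inner_sub_left, hB,
      inner_solutionOp]
  have h0 : ∫ t in Ioo 0 T, k t = 0 := hS _ fun ψ hψ => by rw [← key]; exact h η h1 h2 h3 ψ hψ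
  rw [key, h0, inner_zero_right]

/-- The energy estimate for functions whose derivative is controlled in the direction of the
function. -/
theorem norm_le_of_re_inner_deriv_le {T : ℝ} {v v' w : ℝ → H} {a : H}
    (hv' : IntegrableOn v' (Ioo 0 T)) (hv : ∀ t ∈ Icc 0 T, v t = a + ∫ s in Ioo 0 t, v' s)
    (hvT : v T = 0) (hw : IntegrableOn w (Ioo 0 T))
    (h : ∀ᵐ t ∂timeMeasure T, |(inner ℂ (v t) (v' t)).re| ≤ ‖v t‖ * ‖w t‖) {t : ℝ}
    (ht : t ∈ Icc 0 T) : ‖v t‖ ≤ 4 * ∫ t in Ioo 0 T, ‖w t‖ := by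
  have hvc : ContinuousOn v (Icc 0 T) :=
    ContinuousOn.congr (f := fun t => a + ∫ s in Ioo 0 t, v' s)
      (continuousOn_const.add (continuousOn_primitive_Ioo hv')) hv
  obtain ⟨m, hm, hmax⟩ := isCompact_Icc.exists_isMaxOn ⟨t, ht⟩ hvc.norm
  have hmax' : ∀ s ∈ Icc 0 T, ‖v s‖ ≤ ‖v m‖ := fun s hs => hmax hs
  have hI : 0 ≤ ∫ t in Ioo 0 T, ‖w t‖ := integral_nonneg fun _ => norm_nonneg _
  have key : ∀ τ ∈ Icc 0 T, |‖v τ‖ ^ 2 - ‖a‖ ^ 2| ≤ 2 * (‖v m‖ * ∫ t in Ioo 0 T, ‖w t‖) := by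
    intro τ hτ
    have hsub : Ioo 0 τ ⊆ Ioo 0 T := Ioo_subset_Ioo_right hτ.2
    have hae : ∀ᵐ s ∂timeMeasure τ, v s = a + ∫ r in Ioo 0 s, v' r := by
      filter_upwards [ae_restrict_mem measurableSet_Ioo] with s hs
      exact hv s (Ioo_subset_Icc_self (hsub hs))
    obtain ⟨i1, i2, e⟩ := bilin_integral_by_parts (a := a) (b := a) (reInner (H := H)) (hv'.mono_set hsub)
      (hv'.mono_set hsub) hae hae
    rw [← hv τ hτ, ← integral_add i1 i2] at e
    simp only [reInner_apply] at e
    have e1 : ∀ x : H, (inner ℂ x x).re = ‖x‖ ^ 2 := fun x => (norm_sq_eq_re_inner (𝕜 := ℂ) x).symm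
    rw [e1, e1] at e
    rw [← e]
    refine abs_integral_le_integral_abs.trans ?_
    rw [← integral_const_mul, ← integral_const_mul]
    refine le_trans (integral_mono_of_nonneg (Eventually.of_forall fun _ => abs_nonneg _)
      (((hw.mono_set hsub).norm.const_mul _).const_mul _) ?_) (setIntegral_mono_set
        ((hw.norm.const_mul _).const_mul _) (Eventually.of_forall fun _ => by positivity)
        (Eventually.of_forall hsub))
    filter_upwards [ae_restrict_of_ae_restrict_of_subset hsub h,
      ae_restrict_mem measurableSet_Ioo] with s h1 hs
    have h2 : (inner ℂ (v' s) (v s)).re = (inner ℂ (v s) (v' s)).re := by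
      rw [← inner_conj_symm, Complex.conj_re]
    rw [h2, ← two_mul, abs_mul, abs_two]
    have h3 := hmax' s (Ioo_subset_Icc_self (hsub hs))
    have : ‖v s‖ * ‖w s‖ ≤ ‖v m‖ * ‖w s‖ := by gcongr
    linarith
  have hT : T ∈ Icc 0 T := ⟨ht.1.trans ht.2, le_rfl⟩
  -- Since v(T) = 0, the choice τ = T bounds ‖a‖² by 2‖v m‖ ∫‖w‖; the choice τ = m adds the same
  -- amount again, whence the factor 4.
  have k1 := key T hT
  have k2 := key m hm
  rw [hvT] at k1
  have k3 : ‖v m‖ ^ 2 ≤ 4 * (‖v m‖ * ∫ t in Ioo 0 T, ‖w t‖) := by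
    have := abs_le.1 k1
    have := abs_le.1 k2
    simp only [norm_zero] at *
    nlinarith
  refine (hmax' t ht).trans ?_
  rcases (norm_nonneg (v m)).eq_or_lt with h0 | h0
  · rw [← h0]; positivity
  · nlinarith

/-- The pairing of the antidual space and the space as a real bilinear map. -/
def dualPairing : (V →L⋆[ℂ] ℂ) →L[ℝ] V →L[ℝ] ℂ :=
  LinearMap.mkContinuous₂ (LinearMap.mk₂ ℝ (fun (f : V →L⋆[ℂ] ℂ) (v : V) => f v)
    (fun _ _ _ => rfl) (fun _ _ _ => rfl) (fun _ _ _ => map_add _ _ _) (fun c f v => by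
      rw [← Complex.coe_smul, map_smulₛₗ]; simp)) 1 fun f v => by
        simpa using f.le_opNorm v

theorem dualPairing_apply (f : V →L⋆[ℂ] ℂ) (v : V) : dualPairing f v = f v := rfl

/-- The embedding of `H` into the antidual space which is induced by `J`. -/
def dualEmbedding (J : V →L[ℂ] H) : H →L[ℂ] V →L⋆[ℂ] ℂ :=
  LinearMap.mkContinuous ⟨⟨fun h => (innerSLFlip ℂ h).comp J, fun a b => by ext; simp⟩,
    fun c a => by ext; simp⟩ ‖J‖ fun h => by
      rw [mul_comm]
      refine (ContinuousLinearMap.opNorm_comp_le (innerSLFlip ℂ h) J).trans ?_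
      gcongr
      exact ContinuousLinearMap.opNorm_le_bound _ (norm_nonneg _) fun k => by
        simpa [mul_comm] using norm_inner_le_norm k h

theorem dualEmbedding_apply (J : V →L[ℂ] H) (h : H) :
    dualEmbedding J h = (innerSLFlip ℂ h).comp J := rfl

/-- Integration by parts for functions with a weak derivative in the antidual space. -/
theorem integral_weakDeriv_by_parts (J : V →L[ℂ] H) {T : ℝ} (hT : 0 < T) {u : ℝ → V}
    {w : ℝ → V →L⋆[ℂ] ℂ} (hu : IntegrableOn u (Ioo 0 T)) (hw : IntegrableOn w (Ioo 0 T))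
    (hder : ∀ θ : ℝ → ℝ, ContDiff ℝ ∞ θ → HasCompactSupport θ → tsupport θ ⊆ Ioo 0 T →
      ∫ t in Ioo 0 T, ((deriv θ t : ℝ) : ℂ) • (innerSLFlip ℂ (J (u t))).comp J =
        -∫ t in Ioo 0 T, ((θ t : ℝ) : ℂ) • w t)
    {y : ℝ → H} (hy : ContinuousOn y (Icc 0 T)) (huy : ∀ᵐ t ∂timeMeasure T, J (u t) = y t)
    {v v' : ℝ → V} {a : V} (hv' : IntegrableOn v' (Ioo 0 T))
    (hv : ∀ t ∈ Icc 0 T, v t = a + ∫ s in Ioo 0 t, v' s) (hvT : v T = 0) :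
    Integrable (fun t => inner ℂ (J (v' t)) (J (u t)) + w t (v t)) (timeMeasure T) ∧
      ∫ t in Ioo 0 T, (inner ℂ (J (v' t)) (J (u t)) + w t (v t)) = -inner ℂ (J (v 0)) (y 0) := by
  obtain ⟨c, hc⟩ := exists_eq_add_primitive_of_weakDeriv hT
    (g := fun t => dualEmbedding J (J (u t)))
    ((dualEmbedding J).integrable_comp (J.integrable_comp hu)) hw fun θ h1 h2 h3 => by
      have := hder θ h1 h2 h3
      have e : ∀ (r : ℝ) (f : V →L⋆[ℂ] ℂ), (r : ℂ) • f = r • f := fun r f => by ext; simp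
      simp only [e] at this
      exact this
  have hae : ∀ᵐ t ∂timeMeasure T, v t = a + ∫ s in Ioo 0 t, v' s := by
    filter_upwards [ae_restrict_mem measurableSet_Ioo] with t ht
    exact hv t (Ioo_subset_Icc_self ht)
  obtain ⟨i1, i2, e⟩ := bilin_integral_by_parts (a := c) (b := a) dualPairing hw hv' hc hae
  have hva : v 0 = a := by rw [hv 0 ⟨le_rfl, hT.le⟩]; simp
  -- The continuous representative in H and the primitive in the antidual space describe the same
  -- function, so the integration constant is the image of y(0).
  have hc0 : dualEmbedding J (y 0) = c := by
    have := eqOn_Icc_of_ae_eq hT (f := fun t => dualEmbedding J (y t))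
      (g := fun t => c + ∫ s in Ioo 0 t, w s) ((dualEmbedding J).continuous.comp_continuousOn hy)
      (continuousOn_const.add (continuousOn_primitive_Ioo hw)) (by
        filter_upwards [huy, hc] with t h1 h2
        rw [← h1, h2]) ⟨le_rfl, hT.le⟩
    simpa using this
  rw [← hv T ⟨hT.le, le_rfl⟩, hvT, map_zero, zero_sub, ← hva, ← hc0, ← integral_add i1 i2] at e
  refine ⟨(i1.add i2).congr (Eventually.of_forall fun t => ?_), ?_⟩
  · simp only [Pi.add_apply, dualPairing_apply, dualEmbedding_apply]
    rw [add_comm]; rfl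
  · rw [show -inner ℂ (J (v 0)) (y 0) = -dualPairing (dualEmbedding J (y 0)) (v 0) from rfl, ← e]
    refine integral_congr_ae (Eventually.of_forall fun t => ?_)
    simp only [dualPairing_apply, dualEmbedding_apply]
    rw [add_comm]; rfl

end AbstractEvolution

/-! ### Continuous representatives under graph closure. -/

section Closure

open Filter Topology

variable {H : Type*} [NormedAddCommGroup H]

theorem exists_integral_norm_le (T : ℝ) :
    ∃ C : ℝ, 0 ≤ C ∧ ∀ w : Lp H 2 (timeMeasure T), ∫ t in Ioo 0 T, ‖w t‖ ≤ C * ‖w‖ := by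
  refine ⟨(timeMeasure T univ ^ (1 / (1 : ENNReal).toReal - 1 / (2 : ENNReal).toReal)).toReal,
    ENNReal.toReal_nonneg, fun w => ?_⟩
  have h := eLpNorm_le_eLpNorm_mul_rpow_measure_univ (μ := timeMeasure T) (p := 1) (q := 2)
    (by norm_num) (Lp.aestronglyMeasurable w)
  have hfin : timeMeasure T univ ^ (1 / (1 : ENNReal).toReal - 1 / (2 : ENNReal).toReal) ≠ ⊤ :=
    ENNReal.rpow_ne_top_of_nonneg (by norm_num) (measure_ne_top _ _)
  rw [integral_norm_eq_lintegral_enorm (Lp.aestronglyMeasurable w), ← eLpNorm_one_eq_lintegral_enorm,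
    Lp.norm_def, mul_comm, ← ENNReal.toReal_mul]
  exact ENNReal.toReal_mono (ENNReal.mul_ne_top (Lp.eLpNorm_ne_top w) hfin) h

/-- Initial values survive the closure of a graph, by an estimate in the uniform norm. -/
theorem exists_continuousOn_of_mem_closure [CompleteSpace H] {T : ℝ} (hT : 0 < T)
    {G : Set (Lp H 2 (timeMeasure T) × Lp H 2 (timeMeasure T))} {C : ℝ} (hC : 0 ≤ C)
    (hsub : ∀ p ∈ G, ∀ q ∈ G, p - q ∈ G)
    (hG : ∀ p ∈ G, ∃ y : ℝ → H, ContinuousOn y (Icc 0 T) ∧ p.1 =ᵐ[timeMeasure T] y ∧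
      ∀ t ∈ Icc 0 T, ‖y t‖ ≤ C * ‖p.2‖)
    {p : Lp H 2 (timeMeasure T) × Lp H 2 (timeMeasure T)} (hp : p ∈ closure G) :
    ∃ y : ℝ → H, ContinuousOn y (Icc 0 T) ∧ p.1 =ᵐ[timeMeasure T] y ∧
      ∃ (q : ℕ → Lp H 2 (timeMeasure T) × Lp H 2 (timeMeasure T)) (yq : ℕ → ℝ → H),
        (∀ n, q n ∈ G ∧ ContinuousOn (yq n) (Icc 0 T) ∧ (q n).1 =ᵐ[timeMeasure T] yq n) ∧
        Tendsto q atTop (𝓝 p) ∧ Tendsto (fun n => yq n 0) atTop (𝓝 (y 0)) := by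
  obtain ⟨q, hq, hlim⟩ := mem_closure_iff_seq_limit.1 hp
  choose yq hyc hyae hyb using fun n => hG _ (hq n)
  -- G is stable under differences, so the bound turns convergence of the second components into
  -- uniform convergence of the representatives.
  have hdiff : ∀ m n, ∀ t ∈ Icc 0 T, ‖yq m t - yq n t‖ ≤ C * ‖(q m).2 - (q n).2‖ := by
    intro m n
    obtain ⟨y, h1, h2, h3⟩ := hG _ (hsub _ (hq m) _ (hq n))
    have := eqOn_Icc_of_ae_eq hT h1 ((hyc m).sub (hyc n)) (by
      filter_upwards [h2, hyae m, hyae n, Lp.coeFn_sub (q m).1 (q n).1] with t a b c e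
      rw [← a, Pi.sub_apply, ← b, ← c, Prod.fst_sub, e, Pi.sub_apply])
    intro t ht
    rw [← Pi.sub_apply, ← this ht]
    exact h3 t ht
  have hcau : CauchySeq fun n => (q n).2 := ((continuous_snd.tendsto p).comp hlim).cauchySeq
  have hucau : UniformCauchySeqOn yq atTop (Icc 0 T) := by
    rw [Metric.uniformCauchySeqOn_iff]
    intro ε hε
    obtain ⟨N, hN⟩ := Metric.cauchySeq_iff.1 hcau (ε / (C + 1)) (by positivity)
    refine ⟨N, fun m hm n hn t ht => ?_⟩
    rw [dist_eq_norm]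
    have h1 := hN m hm n hn
    rw [dist_eq_norm, lt_div_iff₀ (by positivity)] at h1
    have := hdiff m n t ht
    nlinarith [norm_nonneg ((q m).2 - (q n).2)]
  have hpt : ∀ t, ∃ y, t ∈ Icc 0 T → Tendsto (fun n => yq n t) atTop (𝓝 y) := fun t => by
    by_cases ht : t ∈ Icc 0 T
    · obtain ⟨y, hy⟩ := cauchySeq_tendsto_of_complete (hucau.cauchySeq ht)
      exact ⟨y, fun _ => hy⟩
    · exact ⟨0, fun h => absurd h ht⟩
  choose y hy using hpt
  have hunif := hucau.tendstoUniformlyOn_of_tendsto fun t ht => hy t ht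
  refine ⟨y, hunif.continuousOn (Frequently.of_forall hyc), ?_, q, yq,
    fun n => ⟨hq n, hyc n, hyae n⟩, hlim, hy 0 ⟨le_rfl, hT.le⟩⟩
  have hm := tendstoInMeasure_of_tendsto_Lp ((continuous_fst.tendsto p).comp hlim)
  obtain ⟨ns, hns, hae⟩ := hm.exists_seq_tendsto_ae
  filter_upwards [hae, ae_all_iff.2 hyae, ae_restrict_mem measurableSet_Ioo] with t h1 h2 ht
  refine tendsto_nhds_unique h1 (((hy t (Ioo_subset_Icc_self ht)).comp hns.tendsto_atTop).congr
    fun n => ?_)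
  exact (h2 (ns n)).symm

end Closure

/-! ### The potential as a family of bounded symmetric operators. -/

section Potential

open Filter Topology

variable {d : ℕ} {Ω : Set (Space d)}

/-- `A` is the family of multiplication operators with the potential. -/
structure IsPotentialOp (T : ℝ) (𝒱 : ℝ → Space d → ℝ)
    (A : ℝ → StateSpace Ω →L[ℂ] StateSpace Ω) (C : ℝ) : Prop where
  apply_ae : ∀ t ∈ Ioo 0 T, ∀ φ : StateSpace Ω,
    A t φ =ᵐ[volume.restrict Ω] fun x => (𝒱 t x : ℂ) * φ x
  norm_le : ∀ t ∈ Ioo 0 T, ‖A t‖ ≤ C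
  continuousOn : ContinuousOn A (Ioo 0 T)

theorem IsPotentialOp.inner_right {T : ℝ} {𝒱 : ℝ → Space d → ℝ}
    {A : ℝ → StateSpace Ω →L[ℂ] StateSpace Ω} {C : ℝ} (hA : IsPotentialOp T 𝒱 A C) {t : ℝ}
    (ht : t ∈ Ioo 0 T) (φ ψ : StateSpace Ω) :
    inner ℂ ψ (A t φ) = ∫ x in Ω, (𝒱 t x : ℂ) * φ x * star (ψ x) := by
  rw [inner_lp_eq_integral (EventuallyEq.refl _ _) (hA.apply_ae t ht φ)]
  simp

theorem IsPotentialOp.symm {T : ℝ} {𝒱 : ℝ → Space d → ℝ}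
    {A : ℝ → StateSpace Ω →L[ℂ] StateSpace Ω} {C : ℝ} (hA : IsPotentialOp T 𝒱 A C) {t : ℝ}
    (ht : t ∈ Ioo 0 T) (φ ψ : StateSpace Ω) : inner ℂ (A t φ) ψ = inner ℂ φ (A t ψ) := by
  rw [inner_lp_eq_integral (hA.apply_ae t ht φ) (EventuallyEq.refl _ _),
    inner_lp_eq_integral (EventuallyEq.refl _ _) (hA.apply_ae t ht ψ)]
  refine integral_congr_ae (Eventually.of_forall fun x => ?_)
  simp only [RCLike.inner_apply, map_mul, Complex.conj_ofReal]
  ring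

theorem exists_potentialOp {T : ℝ} {𝒱 : ℝ → Space d → ℝ} (h : IsAdmissiblePotential T Ω 𝒱) :
    ∃ (A : ℝ → StateSpace Ω →L[ℂ] StateSpace Ω) (C : ℝ), IsPotentialOp T 𝒱 A C := by
  obtain ⟨C, hC⟩ := h.bounded
  have hex : ∀ t : ℝ, ∃ A : StateSpace Ω →L[ℂ] StateSpace Ω, t ∈ Ioo 0 T →
      (∀ φ : StateSpace Ω, A φ =ᵐ[volume.restrict Ω] fun x => (𝒱 t x : ℂ) * φ x) ∧
        ‖A‖ ≤ max C 0 := fun t => by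
    by_cases ht : t ∈ Ioo 0 T
    swap
    · exact ⟨0, fun h => absurd h ht⟩
    have hm : ∀ φ : StateSpace Ω, MemLp (fun x => (𝒱 t x : ℂ) * φ x) 2 (volume.restrict Ω) :=
      fun φ => ⟨(Complex.continuous_ofReal.comp_aestronglyMeasurable
        (h.measurable_slice t ht)).mul (Lp.aestronglyMeasurable φ),
        (hC t ht φ).trans_lt (ENNReal.mul_lt_top ENNReal.ofReal_lt_top (Lp.eLpNorm_lt_top φ))⟩
    have hadd : ∀ φ ψ : StateSpace Ω, (hm (φ + ψ)).toLp = (hm φ).toLp + (hm ψ).toLp :=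
      fun φ ψ => by
        rw [← MemLp.toLp_add, MemLp.toLp_eq_toLp_iff]
        filter_upwards [Lp.coeFn_add φ ψ] with x hx
        rw [hx, Pi.add_apply, Pi.add_apply, mul_add]
    have hsmul : ∀ (c : ℂ) (φ : StateSpace Ω), (hm (c • φ)).toLp = c • (hm φ).toLp :=
      fun c φ => by
        rw [← MemLp.toLp_const_smul, MemLp.toLp_eq_toLp_iff]
        filter_upwards [Lp.coeFn_smul c φ] with x hx
        rw [hx, Pi.smul_apply, Pi.smul_apply, smul_eq_mul, smul_eq_mul]
        ring
    have hbd : ∀ φ : StateSpace Ω, ‖(hm φ).toLp‖ ≤ max C 0 * ‖φ‖ := fun φ => by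
      rw [Lp.norm_toLp, Lp.norm_def, ← ENNReal.toReal_ofReal (le_max_right C 0),
        ← ENNReal.toReal_mul]
      refine ENNReal.toReal_mono (ENNReal.mul_ne_top ENNReal.ofReal_ne_top (Lp.eLpNorm_ne_top φ)) ?_
      refine (hC t ht φ).trans ?_
      gcongr
      exact le_max_left _ _
    refine ⟨LinearMap.mkContinuous ⟨⟨fun φ => (hm φ).toLp, hadd⟩, hsmul⟩ (max C 0) hbd,
      fun _ => ⟨fun φ => (hm φ).coeFn_toLp, LinearMap.mkContinuous_norm_le _ (le_max_right _ _) _⟩⟩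
  choose A hA using hex
  refine ⟨A, max C 0, fun t ht => (hA t ht).1, fun t ht => (hA t ht).2, fun t ht => ?_⟩
  refine (continuousAt_of_weak_differentiableAt fun φ ψ => ?_).continuousWithinAt
  refine ((h.differentiable φ ψ).differentiableAt (isOpen_Ioo.mem_nhds ht)).congr_of_eventuallyEq ?_
  filter_upwards [isOpen_Ioo.mem_nhds ht] with s hs
  rw [inner_lp_eq_integral (EventuallyEq.refl _ _) ((hA s hs).1 φ)]
  simp

end Potential

/-! ### Functions of the classical domain as curves in H¹₀. -/

section ClassicalRep

open Filter Topology

variable {d : ℕ} {Ω : Set (Space d)}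

/-- The description of a function of the classical domain as a curve `v` in `V`, with its time
derivative `v'` and its Laplacian `l`. -/
structure IsClassicalRep (T : ℝ) (f : ℝ → Space d → ℂ) (v v' : ℝ → VSpace Ω)
    (l : ℝ → StateSpace Ω) : Prop where
  rep : ∀ t, toH (v t) =ᵐ[volume.restrict Ω] f t
  memLp_deriv : MemLp v' 2 (timeMeasure T)
  eq_primitive : ∀ t ∈ Icc 0 T, v t = v 0 + ∫ s in Ioo 0 t, v' s
  terminal : v T = 0
  continuousOn_laplacian : ContinuousOn l (Icc 0 T)
  green : ∀ t (χ : VSpace Ω), inner ℂ (weakGrad χ) (weakGrad (v t)) = -inner ℂ (toH χ) (l t)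
  contDiffOn : ∀ t, ContDiffOn ℝ 2 (f t) Ω
  laplacian : ∀ t, l t =ᵐ[volume.restrict Ω] Laplacian.laplacian (f t)
  differentiableAt : ∀ t ∈ Ioo 0 T, ∀ x, DifferentiableAt ℝ (fun s => f s x) t
  deriv : ∀ t ∈ Ioo 0 T, toH (v' t) =ᵐ[volume.restrict Ω] fun x => deriv (fun s => f s x) t

variable {T : ℝ}

/-- θ is C¹ only in the open interval; the fundamental theorem reaches the endpoints through
continuity and the integrability of θ', which is square integrable on a bounded interval. -/
theorem IsTimeFactor.eq_primitive {θ : ℝ → ℂ} (h : IsTimeFactor T θ) {t : ℝ} (ht : t ∈ Icc 0 T) :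
    θ t = θ 0 + ∫ s in Ioo 0 t, deriv θ s := by
  have h1 := intervalIntegral.integral_eq_sub_of_hasDerivAt_of_le ht.1
    (h.continuousOn.mono (Icc_subset_Icc_right ht.2)) (f' := deriv θ) (fun s hs =>
      ((h.contDiffOn.differentiableOn (by norm_num)).differentiableAt
        (isOpen_Ioo.mem_nhds (Ioo_subset_Ioo_right ht.2 hs))).hasDerivAt)
    ((intervalIntegrable_iff_integrableOn_Ioo_of_le ht.1).2
      (IntegrableOn.mono_set (h.memLp_deriv.integrable (by norm_num)) (Ioo_subset_Ioo_right ht.2)))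
  rw [setIntegral_Ioo_eq_interval ht.1, h1]
  ring

theorem isClassicalRep_tensor {θ : ℝ → ℂ} {φ : Space d → ℂ} (hΩ : IsOpen Ω)
    (hθ : IsTimeFactor T θ) (hφ : IsSpaceFactor Ω φ) {v : VSpace Ω}
    (hv : toH v =ᵐ[volume.restrict Ω] φ) (hg : ∀ χ : VSpace Ω,
      inner ℂ (weakGrad χ) (weakGrad v) = -inner ℂ (toH χ) hφ.memLp_laplacian.toLp) :
    IsClassicalRep T (fun t x => θ t * φ x) (fun t => θ t • v) (fun t => deriv θ t • v)
      (fun t => θ t • hφ.memLp_laplacian.toLp) where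
  rep t := by
    rw [map_smul]
    filter_upwards [Lp.coeFn_smul (θ t) (toH v), hv] with x h1 h2
    rw [h1, Pi.smul_apply, h2, smul_eq_mul]
  memLp_deriv := (ContinuousLinearMap.toSpanSingleton ℂ v).comp_memLp' hθ.memLp_deriv
  eq_primitive t ht := by rw [integral_smul_const, ← add_smul, ← hθ.eq_primitive ht]
  terminal := by simp only [hθ.terminal, zero_smul]
  continuousOn_laplacian := hθ.continuousOn.smul continuousOn_const
  green t χ := by rw [map_smul, inner_smul_right, inner_smul_right, hg, mul_neg]
  contDiffOn t := contDiffOn_const.mul hφ.contDiffOn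
  laplacian t := by
    filter_upwards [Lp.coeFn_smul (θ t) hφ.memLp_laplacian.toLp, hφ.memLp_laplacian.coeFn_toLp,
      ae_restrict_mem hΩ.measurableSet] with x h1 h2 hx
    rw [h1, Pi.smul_apply, h2]
    exact (InnerProductSpace.laplacian_smul (θ t) (hφ.contDiffOn.contDiffAt (hΩ.mem_nhds hx))).symm
  differentiableAt t ht x := ((hθ.contDiffOn.differentiableOn (by norm_num)).differentiableAt
    (isOpen_Ioo.mem_nhds ht)).mul_const _
  deriv t ht := by
    rw [map_smul]
    filter_upwards [Lp.coeFn_smul (deriv θ t) (toH v), hv] with x h1 h2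
    rw [h1, Pi.smul_apply, h2, smul_eq_mul, deriv_mul_const
      ((hθ.contDiffOn.differentiableOn (by norm_num)).differentiableAt (isOpen_Ioo.mem_nhds ht))]

theorem IsClassicalRep.add {f f₂ : ℝ → Space d → ℂ} {v v' v₂ v₂' : ℝ → VSpace Ω}
    {l l₂ : ℝ → StateSpace Ω} (hΩ : IsOpen Ω) (h : IsClassicalRep T f v v' l)
    (h₂ : IsClassicalRep T f₂ v₂ v₂' l₂) :
    IsClassicalRep T (f + f₂) (v + v₂) (v' + v₂') (l + l₂) where
  rep t := by
    rw [Pi.add_apply, map_add]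
    filter_upwards [Lp.coeFn_add (toH (v t)) (toH (v₂ t)), h.rep t, h₂.rep t] with x h1 h2 h3
    rw [h1, Pi.add_apply, h2, h3]; rfl
  memLp_deriv := h.memLp_deriv.add h₂.memLp_deriv
  eq_primitive t ht := by
    have hi : ∀ {u : ℝ → VSpace Ω}, MemLp u 2 (timeMeasure T) → IntegrableOn u (Ioo 0 t) :=
      fun hu => IntegrableOn.mono_set (hu.integrable (by norm_num)) (Ioo_subset_Ioo_right ht.2)
    simp only [Pi.add_apply]
    rw [integral_add (hi h.memLp_deriv) (hi h₂.memLp_deriv), h.eq_primitive t ht,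
      h₂.eq_primitive t ht]
    abel
  terminal := by rw [Pi.add_apply, h.terminal, h₂.terminal, add_zero]
  continuousOn_laplacian := h.continuousOn_laplacian.add h₂.continuousOn_laplacian
  green t χ := by
    simp only [Pi.add_apply]
    rw [map_add, inner_add_right, inner_add_right, h.green, h₂.green, neg_add]
  contDiffOn t := (h.contDiffOn t).add (h₂.contDiffOn t)
  laplacian t := by
    filter_upwards [Lp.coeFn_add (l t) (l₂ t), h.laplacian t, h₂.laplacian t,
      ae_restrict_mem hΩ.measurableSet] with x h1 h2 h3 hx
    rw [Pi.add_apply, h1, Pi.add_apply, h2, h3]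
    exact (ContDiffAt.laplacian_add ((h.contDiffOn t).contDiffAt (hΩ.mem_nhds hx))
      ((h₂.contDiffOn t).contDiffAt (hΩ.mem_nhds hx))).symm
  differentiableAt t ht x := (h.differentiableAt t ht x).add (h₂.differentiableAt t ht x)
  deriv t ht := by
    rw [Pi.add_apply, map_add]
    filter_upwards [Lp.coeFn_add (toH (v' t)) (toH (v₂' t)), h.deriv t ht, h₂.deriv t ht]
      with x h1 h2 h3
    rw [h1, Pi.add_apply, h2, h3]
    exact (deriv_add (h.differentiableAt t ht x) (h₂.differentiableAt t ht x)).symm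

theorem IsClassicalRep.const_smul {f : ℝ → Space d → ℂ} {v v' : ℝ → VSpace Ω}
    {l : ℝ → StateSpace Ω} (hΩ : IsOpen Ω) (c : ℂ) (h : IsClassicalRep T f v v' l) :
    IsClassicalRep T (c • f) (c • v) (c • v') (c • l) where
  rep t := by
    rw [Pi.smul_apply, map_smul]
    filter_upwards [Lp.coeFn_smul c (toH (v t)), h.rep t] with x h1 h2
    rw [h1, Pi.smul_apply, h2]; rfl
  memLp_deriv := h.memLp_deriv.const_smul c
  eq_primitive t ht := by
    simp only [Pi.smul_apply]
    rw [integral_smul, ← smul_add, ← h.eq_primitive t ht]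
  terminal := by rw [Pi.smul_apply, h.terminal, smul_zero]
  continuousOn_laplacian := continuousOn_const.smul h.continuousOn_laplacian
  green t χ := by
    simp only [Pi.smul_apply]
    rw [map_smul, inner_smul_right, inner_smul_right, h.green, mul_neg]
  contDiffOn t := (h.contDiffOn t).const_smul c
  laplacian t := by
    filter_upwards [Lp.coeFn_smul c (l t), h.laplacian t, ae_restrict_mem hΩ.measurableSet]
      with x h1 h2 hx
    rw [Pi.smul_apply, h1, Pi.smul_apply, h2]
    exact (InnerProductSpace.laplacian_smul c ((h.contDiffOn t).contDiffAt (hΩ.mem_nhds hx))).symm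
  differentiableAt t ht x := (h.differentiableAt t ht x).const_smul c
  deriv t ht := by
    rw [Pi.smul_apply, map_smul]
    filter_upwards [Lp.coeFn_smul c (toH (v' t)), h.deriv t ht] with x h1 h2
    rw [h1, Pi.smul_apply, h2]
    exact (deriv_const_smul c (h.differentiableAt t ht x)).symm

theorem isClassicalRep_zero :
    IsClassicalRep T (0 : ℝ → Space d → ℂ) (0 : ℝ → VSpace Ω) 0 (0 : ℝ → StateSpace Ω) where
  rep t := by simpa using Lp.coeFn_zero ℂ 2 (volume.restrict Ω)
  memLp_deriv := MemLp.zero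
  eq_primitive t ht := by simp
  terminal := rfl
  continuousOn_laplacian := continuousOn_const
  green t χ := by simp
  contDiffOn t := contDiffOn_const
  laplacian t := by
    rw [show Laplacian.laplacian ((0 : ℝ → Space d → ℂ) t) = 0 from
      InnerProductSpace.laplacian_const (c := (0 : ℂ))]
    exact Lp.coeFn_zero ℂ 2 (volume.restrict Ω)
  differentiableAt t ht x := differentiableAt_const _
  deriv t ht := by
    simp only [Pi.zero_apply, map_zero, deriv_const]
    exact Lp.coeFn_zero ℂ 2 (volume.restrict Ω)

/-- Induction over the span. The pointwise smoothness fields of `IsClassicalRep` are what make the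
Laplacian and the time derivative additive along it. -/
theorem exists_isClassicalRep (hΩ : IsOpen Ω) (hb : Bornology.IsBounded Ω)
    {f : ℝ → Space d → ℂ} (hf : f ∈ classicalDomain T Ω) :
    ∃ (v v' : ℝ → VSpace Ω) (l : ℝ → StateSpace Ω), IsClassicalRep T f v v' l := by
  induction hf using Submodule.span_induction with
  | mem f hf =>
    obtain ⟨θ, φ, hθ, hφ, rfl⟩ := hf
    obtain ⟨v, hv, hg⟩ := exists_vSpace_of_spaceFactor hΩ hb hφ
    exact ⟨_, _, _, isClassicalRep_tensor hΩ hθ hφ hv hg⟩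
  | zero => exact ⟨0, 0, 0, isClassicalRep_zero⟩
  | add f g _ _ h1 h2 =>
    obtain ⟨v, v', l, h1⟩ := h1
    obtain ⟨v₂, v₂', l₂, h2⟩ := h2
    exact ⟨_, _, _, h1.add hΩ h2⟩
  | smul c f _ h1 =>
    obtain ⟨v, v', l, h1⟩ := h1
    exact ⟨_, _, _, h1.const_smul hΩ c⟩

end ClassicalRep

/-! ### Ultra-weak solutions: existence and uniqueness. -/

section UltraWeak

open Filter Topology

variable {d : ℕ} {Ω : Set (Space d)} {T : ℝ} {𝒱 : ℝ → Space d → ℝ}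

/-- The Schrödinger operator on a curve in `V`. -/
def opCurve (A : ℝ → StateSpace Ω →L[ℂ] StateSpace Ω) (v v' : ℝ → VSpace Ω)
    (l : ℝ → StateSpace Ω) (t : ℝ) : StateSpace Ω :=
  Complex.I • toH (v' t) + (1 / 2 : ℂ) • l t - A t (toH (v t))

section Rep

variable {f : ℝ → Space d → ℂ} {v v' : ℝ → VSpace Ω} {l : ℝ → StateSpace Ω}
  {A : ℝ → StateSpace Ω →L[ℂ] StateSpace Ω} {C : ℝ}

theorem IsClassicalRep.opCurve_ae_eq (h : IsClassicalRep T f v v' l) (hA : IsPotentialOp T 𝒱 A C)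
    {t : ℝ} (ht : t ∈ Ioo 0 T) : opCurve A v v' l t =ᵐ[volume.restrict Ω] classicalOp 𝒱 f t := by
  filter_upwards [Lp.coeFn_sub (Complex.I • toH (v' t) + (1 / 2 : ℂ) • l t) (A t (toH (v t))),
    Lp.coeFn_add (Complex.I • toH (v' t)) ((1 / 2 : ℂ) • l t), Lp.coeFn_smul Complex.I (toH (v' t)),
    Lp.coeFn_smul (1 / 2 : ℂ) (l t), hA.apply_ae t ht (toH (v t)), h.rep t, h.laplacian t,
    h.deriv t ht] with x h1 h2 h3 h4 h5 h6 h7 h8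
  rw [opCurve, h1, Pi.sub_apply, h2, Pi.add_apply, h3, h4, h5, Pi.smul_apply, Pi.smul_apply, h6, h7,
    h8, smul_eq_mul, smul_eq_mul, classicalOp]

theorem IsClassicalRep.integrableOn_deriv (h : IsClassicalRep T f v v' l) :
    IntegrableOn v' (Ioo 0 T) := h.memLp_deriv.integrable (by norm_num)

theorem IsClassicalRep.continuousOn (h : IsClassicalRep T f v v' l) : ContinuousOn v (Icc 0 T) :=
  ContinuousOn.congr (f := fun t => v 0 + ∫ s in Ioo 0 t, v' s)
    (continuousOn_const.add (continuousOn_primitive_Ioo h.integrableOn_deriv)) h.eq_primitive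

theorem memLp_of_continuousOn {E : Type*} [NormedAddCommGroup E] {f : ℝ → E}
    (h : ContinuousOn f (Icc 0 T)) : MemLp f 2 (timeMeasure T) := by
  obtain ⟨C, hC⟩ := isCompact_Icc.exists_bound_of_continuousOn h
  refine MemLp.of_bound ((h.mono Ioo_subset_Icc_self).aestronglyMeasurable measurableSet_Ioo) C ?_
  filter_upwards [ae_restrict_mem measurableSet_Ioo] with t ht using hC t (Ioo_subset_Icc_self ht)

theorem IsClassicalRep.memLp_toH (h : IsClassicalRep T f v v' l) :
    MemLp (fun t => toH (v t)) 2 (timeMeasure T) :=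
  memLp_of_continuousOn ((toH (Ω := Ω)).continuous.comp_continuousOn h.continuousOn)

theorem IsClassicalRep.memLp_opCurve (h : IsClassicalRep T f v v' l)
    (hA : IsPotentialOp T 𝒱 A C) : MemLp (opCurve A v v' l) 2 (timeMeasure T) :=
  ((((toH (Ω := Ω)).comp_memLp' h.memLp_deriv).const_smul Complex.I).add
    ((memLp_of_continuousOn h.continuousOn_laplacian).const_smul (1 / 2 : ℂ))).sub
    (memLp_clm_apply hA.continuousOn hA.norm_le h.memLp_toH)

theorem Represents.ae_eq_toH {p : USpace T Ω} (hp : Represents p f)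
    (h : IsClassicalRep T f v v' l) : p =ᵐ[timeMeasure T] fun t => toH (v t) := by
  filter_upwards [hp] with t ht
  exact Lp.ext (ht.trans (h.rep t).symm)

theorem Represents.ae_eq_opCurve {p : USpace T Ω} (hp : Represents p (classicalOp 𝒱 f))
    (h : IsClassicalRep T f v v' l) (hA : IsPotentialOp T 𝒱 A C) :
    p =ᵐ[timeMeasure T] opCurve A v v' l := by
  filter_upwards [hp, ae_restrict_mem measurableSet_Ioo] with t ht htT
  exact Lp.ext (ht.trans (h.opCurve_ae_eq hA htT).symm)

theorem represents_of_ae_eq {p : USpace T Ω} {q : ℝ → StateSpace Ω} {g : ℝ → Space d → ℂ}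
    (h : p =ᵐ[timeMeasure T] q) (hq : ∀ t ∈ Ioo 0 T, q t =ᵐ[volume.restrict Ω] g t) :
    Represents p g := by
  filter_upwards [h, ae_restrict_mem measurableSet_Ioo] with t ht htT
  rw [ht]; exact hq t htT

theorem IsClassicalRep.inner_laplacian_left (h : IsClassicalRep T f v v' l) (t : ℝ)
    (χ : VSpace Ω) : inner ℂ (l t) (toH χ) = -inner ℂ (weakGrad (v t)) (weakGrad χ) := by
  rw [← inner_conj_symm, ← neg_eq_iff_eq_neg.2 (h.green t χ), map_neg, inner_conj_symm]

/-- Solve S*v = i v' + ½Δv - 𝒱v for v'. Both ⟪v, Δv⟫ = -‖∇v‖² and ⟪v, 𝒱v⟫ are real, so Re ⟪v, v'⟫ =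
Im ⟪v, S*v⟫. -/
theorem IsClassicalRep.abs_re_inner_le (h : IsClassicalRep T f v v' l)
    (hA : IsPotentialOp T 𝒱 A C) {t : ℝ} (ht : t ∈ Ioo 0 T) :
    |(inner ℂ (toH (v t)) (toH (v' t))).re| ≤ ‖toH (v t)‖ * ‖opCurve A v v' l t‖ := by
  have e1 : toH (v' t) = -Complex.I • (opCurve A v v' l t - (1 / 2 : ℂ) • l t + A t (toH (v t))) := by
    rw [opCurve, show ∀ a b c : StateSpace Ω, a + b - c - b + c = a from fun a b c => by abel,
      smul_smul]
    simp
  have e2 : inner ℂ (toH (v t)) (l t) = ((-‖weakGrad (v t)‖ ^ 2 : ℝ) : ℂ) := by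
    have := h.green t (v t)
    rw [inner_self_eq_norm_sq_to_K] at this
    rw [← neg_eq_iff_eq_neg.2 this]
    push_cast; rfl
  have e3 : (inner ℂ (toH (v t)) (A t (toH (v t)))).im = 0 :=
    im_inner_self_of_symm (hA.symm ht) _
  have e4 : (inner ℂ (toH (v t)) (toH (v' t))).re =
      (inner ℂ (toH (v t)) (opCurve A v v' l t)).im := by
    rw [e1, inner_smul_right, inner_add_right, inner_sub_right, inner_smul_right, e2]
    simp [e3, -Complex.ofReal_pow]
  rw [e4]
  exact (Complex.abs_im_le_norm _).trans (norm_inner_le_norm _ _)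

theorem IsClassicalRep.norm_toH_le (h : IsClassicalRep T f v v' l) (hA : IsPotentialOp T 𝒱 A C)
    {t : ℝ} (ht : t ∈ Icc 0 T) : ‖toH (v t)‖ ≤ 4 * ∫ t in Ioo 0 T, ‖opCurve A v v' l t‖ := by
  refine norm_le_of_re_inner_deriv_le (v := fun t => toH (v t)) (v' := fun t => toH (v' t))
    (a := toH (v 0)) ((toH (Ω := Ω)).integrable_comp h.integrableOn_deriv) (fun t ht => ?_) ?_
    ((h.memLp_opCurve hA).integrable (by norm_num)) ?_ ht
  · rw [ContinuousLinearMap.integral_comp_comm _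
      (h.integrableOn_deriv.mono_set (Ioo_subset_Ioo_right ht.2)), ← map_add, ← h.eq_primitive t ht]
  · simp only [h.terminal, map_zero]
  · filter_upwards [ae_restrict_mem measurableSet_Ioo] with t ht using h.abs_re_inner_le hA ht

end Rep

/-- The graph of the classical Schrödinger operator. -/
def classicalGraph (T : ℝ) (Ω : Set (Space d)) (𝒱 : ℝ → Space d → ℝ) :
    Set (USpace T Ω × USpace T Ω) :=
  {p | ∃ f ∈ classicalDomain T Ω, Represents p.1 f ∧ Represents p.2 (classicalOp 𝒱 f)}

variable {A : ℝ → StateSpace Ω →L[ℂ] StateSpace Ω} {C : ℝ}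

/-- Linearity of the pointwise operator is read off from the curves in V, where it is immediate. -/
theorem sub_mem_classicalGraph (hΩ : IsOpen Ω) (hb : Bornology.IsBounded Ω)
    (hA : IsPotentialOp T 𝒱 A C) {p q : USpace T Ω × USpace T Ω} (hp : p ∈ classicalGraph T Ω 𝒱)
    (hq : q ∈ classicalGraph T Ω 𝒱) : p - q ∈ classicalGraph T Ω 𝒱 := by
  obtain ⟨f, hf, hp1, hp2⟩ := hp
  obtain ⟨g, hg, hq1, hq2⟩ := hq
  obtain ⟨v, v', l, h⟩ := exists_isClassicalRep hΩ hb hf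
  obtain ⟨w, w', m, k⟩ := exists_isClassicalRep hΩ hb hg
  have hs := h.add hΩ (k.const_smul hΩ (-1))
  refine ⟨_, add_mem hf (Submodule.smul_mem _ (-1) hg), ?_, ?_⟩
  · refine represents_of_ae_eq ?_ fun t _ => hs.rep t
    filter_upwards [Lp.coeFn_sub p.1 q.1, hp1.ae_eq_toH h, hq1.ae_eq_toH k] with t h1 h2 h3
    rw [Prod.fst_sub, h1, Pi.sub_apply, h2, h3, Pi.add_apply, Pi.smul_apply, neg_one_smul, map_add,
      map_neg, sub_eq_add_neg]
  · refine represents_of_ae_eq ?_ fun t ht => hs.opCurve_ae_eq hA ht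
    filter_upwards [Lp.coeFn_sub p.2 q.2, hp2.ae_eq_opCurve h hA, hq2.ae_eq_opCurve k hA]
      with t h1 h2 h3
    rw [Prod.snd_sub, h1, Pi.sub_apply, h2, h3]
    simp only [opCurve, Pi.add_apply, neg_one_smul, Pi.neg_apply, map_add,
      map_neg, smul_add, smul_neg]
    abel

/-- It suffices to test ultra-weak solutions with functions of the classical domain. -/
theorem isUltraWeakSolution_of_classical (hT : 0 < T) (hΩ : IsOpen Ω)
    (hb : Bornology.IsBounded Ω) (hA : IsPotentialOp T 𝒱 A C) {u₀ : VSpace Ω} {u : USpace T Ω}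
    (h : ∀ p ∈ classicalGraph T Ω 𝒱, ∀ v₀ : StateSpace Ω, HasInitialValue p.1 v₀ →
      inner ℂ p.2 u = Complex.I * inner ℂ v₀ (toH u₀)) : IsUltraWeakSolution 𝒱 u₀ u := by
  intro v w hvw
  obtain ⟨K, hK, hKle⟩ := exists_integral_norm_le (H := StateSpace Ω) T
  obtain ⟨y, hy, hvy, q, yq, hq, hlim, hlim0⟩ := exists_continuousOn_of_mem_closure hT
    (G := classicalGraph T Ω 𝒱) (C := 4 * K) (by positivity)
    (fun p hp q hq => sub_mem_classicalGraph hΩ hb hA hp hq) (fun p hp => by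
      obtain ⟨f, hf, hp1, hp2⟩ := hp
      obtain ⟨v, v', l, k⟩ := exists_isClassicalRep hΩ hb hf
      refine ⟨fun t => toH (v t), (toH (Ω := Ω)).continuous.comp_continuousOn k.continuousOn,
        hp1.ae_eq_toH k, fun t ht => (k.norm_toH_le hA ht).trans ?_⟩
      rw [mul_assoc]
      gcongr
      refine le_trans (le_of_eq (integral_congr_ae ?_)) (hKle p.2)
      filter_upwards [hp2.ae_eq_opCurve k hA] with t ht
      rw [ht]) hvw
  refine ⟨y 0, ⟨y, hy, hvy, rfl⟩, ?_⟩
  have h1 : Tendsto (fun n => inner ℂ (q n).2 u) atTop (𝓝 (inner ℂ w u)) :=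
    ((continuous_snd.tendsto (v, w)).comp hlim).inner tendsto_const_nhds
  have h2 : Tendsto (fun n => Complex.I * inner ℂ (yq n 0) (toH u₀)) atTop
      (𝓝 (Complex.I * inner ℂ (y 0) (toH u₀))) :=
    (hlim0.inner tendsto_const_nhds).const_mul _
  exact tendsto_nhds_unique h1 (h2.congr fun n =>
    (h _ (hq n).1 _ ⟨yq n, (hq n).2.1, (hq n).2.2, rfl⟩).symm)

theorem HasInitialValue.unique (hT : 0 < T) {v : USpace T Ω} {a b : StateSpace Ω}
    (ha : HasInitialValue v a) (hb : HasInitialValue v b) : a = b := by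
  obtain ⟨y, hy, hvy, rfl⟩ := ha
  obtain ⟨z, hz, hvz, rfl⟩ := hb
  exact eqOn_Icc_of_ae_eq hT hy hz (hvy.symm.trans hvz) ⟨le_rfl, hT.le⟩

/-- Weak solutions are ultra-weak solutions. -/
theorem IsWeakSolution.isUltraWeakSolution (hT : 0 < T) (hΩ : IsOpen Ω)
    (hb : Bornology.IsBounded Ω) (hA : IsPotentialOp T 𝒱 A C) {u₀ : VSpace Ω}
    {u : Lp (VSpace Ω) 2 (timeMeasure T)} (hu : IsWeakSolution 𝒱 u₀ u) :
    IsUltraWeakSolution 𝒱 u₀ (toH.compLp u) := by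
  obtain ⟨w, z, hw, ⟨y, hy, huy, hyz⟩, hz, hweak⟩ := hu
  refine isUltraWeakSolution_of_classical hT hΩ hb hA fun p hp v₀ hv₀ => ?_
  obtain ⟨f, hf, hp1, hp2⟩ := hp
  obtain ⟨v, v', l, k⟩ := exists_isClassicalRep hΩ hb hf
  have hv0 : v₀ = toH (v 0) := hv₀.unique hT ⟨fun t => toH (v t),
    (toH (Ω := Ω)).continuous.comp_continuousOn k.continuousOn, hp1.ae_eq_toH k, rfl⟩
  have hTu : ∀ᵐ t ∂timeMeasure T, toH (u t) = y t := by
    filter_upwards [huy, (toH (Ω := Ω)).coeFn_compLp u] with t h1 h2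
    rw [← h1, h2]
  obtain ⟨hi, he⟩ := integral_weakDeriv_by_parts (toH (Ω := Ω)) hT (u := u) (w := w)
    ((Lp.memLp u).integrable (by norm_num)) ((Lp.memLp w).integrable (by norm_num)) hw hy hTu
    k.integrableOn_deriv k.eq_primitive k.terminal
  have hvL : MemLp v 2 (timeMeasure T) := memLp_of_continuousOn k.continuousOn
  -- No test in V' is needed, because the initial condition is already contained in y(0) = u₀.
  have h0 := hweak (hvL.toLp v) 0
  -- Green's formula turns ½Δv into the gradient part of the energy form; what remains is the time
  -- derivative of v.
  have hX : (fun t => inner ℂ (p.2 t) ((toH (Ω := Ω)).compLp u t)) =ᵐ[timeMeasure T] fun t =>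
      -Complex.I * inner ℂ (toH (v' t)) (toH (u t)) - energyForm 𝒱 t (u t) (v t) := by
    filter_upwards [hp2.ae_eq_opCurve k hA, (toH (Ω := Ω)).coeFn_compLp u,
      ae_restrict_mem measurableSet_Ioo] with t h1 h2 ht
    rw [h1, h2, opCurve, inner_sub_left, inner_add_left, inner_smul_left, inner_smul_left,
      k.inner_laplacian_left, hA.symm ht, hA.inner_right ht, energyForm, Complex.conj_I]
    simp only [map_div₀, map_one, map_ofNat]
    ring
  have hXi := (L2.integrable_inner (𝕜 := ℂ) p.2 ((toH (Ω := Ω)).compLp u)).congr hX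
  have h1 : ∫ t in Ioo 0 T, (Complex.I * w t ((hvL.toLp v) t) -
      energyForm 𝒱 t (u t) ((hvL.toLp v) t)) =
      inner ℂ p.2 ((toH (Ω := Ω)).compLp u) + Complex.I * -inner ℂ (toH (v 0)) (y 0) := by
    rw [L2.inner_def, integral_congr_ae hX, ← he, ← integral_const_mul,
      ← integral_add hXi (hi.const_mul _)]
    refine integral_congr_ae ?_
    filter_upwards [hvL.coeFn_toLp] with t ht
    rw [ht]
    ring
  rw [h1] at h0
  simp only [zero_apply, star_zero, mul_zero, add_zero] at h0
  rw [hv0, ← hz, ← hyz]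
  linear_combination h0

/-- The primitive is normalized at T only. Its free value at 0 is what forces zero initial data in
the uniqueness argument. -/
theorem isTimeFactor_of_test {η : ℝ → ℝ} (hη : ContDiff ℝ ∞ η) :
    IsTimeFactor T (fun t => (((∫ s in (0 : ℝ)..t, η s) - ∫ s in (0 : ℝ)..T, η s : ℝ) : ℂ)) ∧
    ∀ t, deriv (fun t => (((∫ s in (0 : ℝ)..t, η s) - ∫ s in (0 : ℝ)..T, η s : ℝ) : ℂ)) t = η t := by
  have hc : ContDiff ℝ ∞ fun t => (((∫ s in (0 : ℝ)..t, η s) - ∫ s in (0 : ℝ)..T, η s : ℝ) : ℂ) :=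
    Complex.ofRealCLM.contDiff.comp ((contDiff_primitive hη).sub contDiff_const)
  have hder : ∀ t, deriv
      (fun t => (((∫ s in (0 : ℝ)..t, η s) - ∫ s in (0 : ℝ)..T, η s : ℝ) : ℂ)) t = η t := fun t =>
    (((hasDerivAt_primitive hη.continuous t).sub_const _).ofReal_comp).deriv
  refine ⟨⟨(hc.of_le (by norm_cast)).contDiffOn, hc.continuous.continuousOn, by simp, ?_⟩, hder⟩
  rw [show deriv (fun t => (((∫ s in (0 : ℝ)..t, η s) - ∫ s in (0 : ℝ)..T, η s : ℝ) : ℂ)) =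
    fun t => (η t : ℂ) from funext hder]
  exact memLp_of_continuousOn (Complex.continuous_ofReal.comp hη.continuous).continuousOn

/-- Functions which are orthogonal to the range of the Schrödinger operator vanish. -/
theorem eq_zero_of_inner_classicalGraph (hd : 0 < d) (hT : 0 < T) (hΩ : IsOpen Ω)
    (hb : Bornology.IsBounded Ω) (hs : HasSmoothBoundary Ω) (hA : IsPotentialOp T 𝒱 A C)
    {z : USpace T Ω} (h : ∀ p ∈ classicalGraph T Ω 𝒱, inner ℂ p.2 z = 0) : z = 0 := by
  have hzm := Lp.memLp z
  have h0 : z =ᵐ[timeMeasure T] 0 := by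
    refine eq_zero_of_weak_evolution_of_total (J := toH (Ω := Ω)) Schroedinger.norm_toH_le
      (denseRange_toH hΩ hb)
      (S := {ψ | ∃ (φ : Space d → ℂ) (hφ : IsSpaceFactor Ω φ) (v : VSpace Ω),
        toH v =ᵐ[volume.restrict Ω] φ ∧ ψ = toH v - hφ.memLp_laplacian.toLp})
      (fun x hx => eq_zero_of_inner_sub_laplacian hd hΩ hb hs fun φ hφ v hv =>
        hx _ ⟨φ, hφ, v, hv, rfl⟩) hzm (memLp_clm_apply hA.continuousOn hA.norm_le hzm) ?_ ?_
    · filter_upwards [ae_restrict_mem measurableSet_Ioo] with t ht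
      exact im_inner_self_of_symm (hA.symm ht) _
    · rintro η h1 - - _ ⟨φ, hφ, v, hv, rfl⟩
      obtain ⟨v₁, hv₁, hg⟩ := exists_vSpace_of_spaceFactor hΩ hb hφ
      have hvv : toH v₁ = toH v := Lp.ext (hv₁.trans hv.symm)
      set L : StateSpace Ω := hφ.memLp_laplacian.toLp with hL
      -- Green's formula reads ⟪χ, v₁⟫_V = ⟪χ, φ - Δφ⟫_H for all χ in V, that is, J*(φ - Δφ) = v₁.
      have hB : solutionOp (toH (Ω := Ω)) (toH v - L) = toH v := by
        rw [solutionOp_apply, ← hvv]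
        congr 1
        refine ext_inner_left ℂ fun χ => ?_
        rw [ContinuousLinearMap.adjoint_inner_right, inner_vSpace, hg, inner_sub_right,
          sub_eq_add_neg]
      obtain ⟨hθ, hθ'⟩ := isTimeFactor_of_test h1
      have k := isClassicalRep_tensor hΩ hθ hφ hv₁ hg
      have e := h ⟨k.memLp_toH.toLp, (k.memLp_opCurve hA).toLp⟩ ⟨_, Submodule.subset_span
        ⟨_, φ, hθ, hφ, rfl⟩, represents_of_ae_eq k.memLp_toH.coeFn_toLp fun t _ => k.rep t,
        represents_of_ae_eq (k.memLp_opCurve hA).coeFn_toLp fun t ht => k.opCurve_ae_eq hA ht⟩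
      rw [L2.inner_def] at e
      rw [← e]
      refine integral_congr_ae ?_
      filter_upwards [(k.memLp_opCurve hA).coeFn_toLp, ae_restrict_mem measurableSet_Ioo]
        with t h2 ht
      rw [h2, opCurve, hθ', hB, setIntegral_Ioo_eq_interval ht.1.le, setIntegral_Ioo_eq_interval hT.le,
        map_smul, map_smul, hvv, map_smul, ← hL]
      simp only [inner_smul_left, inner_sub_left, inner_add_left, Complex.conj_ofReal, Complex.conj_I,
        map_div₀, map_one, map_ofNat, hA.symm ht]
      ring
  exact Lp.ext (h0.trans (Lp.coeFn_zero _ _ _).symm)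

end UltraWeak

end Schroedinger

end

theorem proposition3p3 (N : ℕ) (hN : 1 ≤ N) (T : ℝ) (hT : 0 < T)
    (Ω : Set (Schroedinger.Space (3 * N))) (hΩ : Schroedinger.IsSmoothBoundedDomain Ω)
    (𝒱 : ℝ → Schroedinger.Space (3 * N) → ℝ) (h𝒱 : Schroedinger.IsAdmissiblePotential T Ω 𝒱)
    (u₀ : Schroedinger.VSpace Ω)
    (u : Lp (Schroedinger.VSpace Ω) 2 (Schroedinger.timeMeasure T))
    (hu : Schroedinger.IsWeakSolution 𝒱 u₀ u) :
    Schroedinger.IsUltraWeakSolution 𝒱 u₀ (Schroedinger.toH.compLp u) ∧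
      ∀ z : Schroedinger.USpace T Ω, Schroedinger.IsUltraWeakSolution 𝒱 u₀ z →
        z = Schroedinger.toH.compLp u := by
  obtain ⟨A, C, hA⟩ := Schroedinger.exists_potentialOp h𝒱
  have hU := hu.isUltraWeakSolution hT hΩ.isOpen hΩ.isBounded hA
  refine ⟨hU, fun z hz => sub_eq_zero.1 ?_⟩
  -- For the difference the two right-hand sides cancel, because an element of 𝕌 has at most one
  -- initial value.
  refine Schroedinger.eq_zero_of_inner_classicalGraph (by omega) hT hΩ.isOpen hΩ.isBounded
    hΩ.smoothBoundary hA fun p hp => ?_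
  obtain ⟨a, ha, hza⟩ := hz p.1 p.2 (subset_closure hp)
  obtain ⟨b, hb, hub⟩ := hU p.1 p.2 (subset_closure hp)
  rw [inner_sub_right, hza, hub, ha.unique hT hb, sub_self]
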